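/- Setting. Let $\mathfrak H$ be a complex separable Hilbert space with inner product linear in the first argument, $(e_k)_{k\in\iota}$ a complete orthonormal system of $\mathfrak H$, and $Z=\{Z(h):h\in\mathfrak H\}$ a complex isonormal Gaussian process over $\mathfrak H$ on a probability space $(\Omega,\mathcal F,P)$: a centred jointly Gaussian family of complex random variables with $E[Z(h)^2]=0$ and $E[Z(g)\overline{Z(h)}]=\langle g,h\rangle$ for all $g,h\in\mathfrak H$. Put $J_{m,n}(z)=\sum_{r=0}^{m\wedge n}(-1)^r r!\binom mr\binom nr z^{m-r}\bar z^{\,n-r}2^r$. Elements $f$ of the Hilbert tensor product $\mathfrak H^{\otimes m}\otimes\overline{\mathfrak H}^{\otimes n}$ are written as $$f=\sum_{\alpha\in\iota^m,\ \beta\in\iota^n} f(\alpha;\beta)\,e_{\alpha_1}\otimes\cdots\otimes e_{\alpha_m}\otimes\bar e_{\beta_1}\otimes\cdots\otimes\bar e_{\beta_n},\qquad \|f\|^2=\sum_{\alpha,\beta}|f(\alpha;\beta)|^2<\infty .$$ Write $\mathfrak H^{\odot m}\otimes\mathfrak H^{\odot n}$ for the subspace of those $f$ that are symmetric in $\alpha$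 and symmetric in $\beta$, and $\tilde f$ for the symmetrization $\tilde f(\alpha;\beta)=\frac1{m!\,n!}\sum_{\pi\in S_m}\sum_{\sigma\in S_n}f(\alpha\circ\pi;\beta\circ\sigma)$. The reversed complex conjugate $h$ of $f$ is the element of $\mathfrak H^{\otimes n}\otimes\overline{\mathfrak H}^{\otimes m}$ with $h(\alpha;\beta)=\overline{f(\beta;\alpha)}$. For $f\in\mathfrak H^{\otimes a}\otimes\overline{\mathfrak H}^{\otimes b}$, $g\in\mathfrak H^{\otimes c}\otimes\overline{\mathfrak H}^{\otimes d}$, $0\le i\le a\wedge d$, $0\le j\le b\wedge c$, the contraction $f\otimes_{i,j}g\in\mathfrak H^{\otimes(a+c-i-j)}\otimes\overline{\mathfrak H}^{\otimes(b+d-i-j)}$ is $$(f\otimes_{i,j}g)(t,t';s,s')=\sum_{u\in\iota^i,\ v\in\iota^j}f(t,u;s,v)\,g(t',v;s',u),$$ where $t\in\iota^{a-i}$, $t'\in\iota^{c-j}$, $s\in\iota^{b-j}$, $s'\in\iota^{d-i}$; and $f\tilde\otimes_{i,j}g$ is its symmetrization. The complex multiple Wiener–Itô integral $I_{m,n}(f)\in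 L^2(\Omega)$ of a kernel $f$ is the sum of the series $$I_{m,n}(f)=\sum_{\alpha,\beta}f(\alpha;\beta)\prod_{k}2^{-(m_k+n_k)/2}J_{m_k,n_k}\big(\sqrt2\,Z(e_k)\big)$$ in $L^2(\Omega)$, where $m_k$ and $n_k$ are the numbers of occurrences of $k$ in $\alpha$ and in $\beta$. Statement. Let $m,n\ge0$ be integers with $m+n\ge1$, and put $l=m+n$, $l'=2(m\wedge n)$. There are constants $c_1(m,n),c_2(m,n)>0$, depending only on $m$ and $n$, such that for all $\mathfrak H$, $(e_k)$, $(\Omega,\mathcal F,P)$, $Z$ as above and all $f\in\mathfrak H^{\odot m}\otimes\mathfrak H^{\odot n}$ with reversed complex conjugate $h$, the series that defines $F=I_{m,n}(f)$ converges unconditionally in $L^2(\Omega)$, $E|F|^4<\infty$, and $$c_1(m,n)\Big(\sum_{0<i+j<l}\|f\otimes_{i,j}h\|^2+\sum_{0<i+j<l'}\|f\otimes_{i,j}f\|^2\Big)\le E[|F|^4]-2\big(E[|F|^2]\big)^2-\big|E[F^2]\big|^2$$ $$\le c_2(m,n)\Big(\sum_{0<i+j<l}\|f\tilde\otimes_{i,j}h\|^2+\sum_{0<i+j<l'}\|f\tilde\otimes_{i,j}f\|^2\Big),$$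 where $0\le i\le m$, $0\le j\le n$ in the sums over $f\otimes_{i,j}h$ and $f\tilde\otimes_{i,j}h$, and $0\le i,j\le m\wedge n$ in the sums over $f\otimes_{i,j}f$ and $f\tilde\otimes_{i,j}f$. -/

import Mathlib

universe u v w

open MeasureTheory ProbabilityTheory
open scoped ComplexConjugate

noncomputable section

namespace ComplexWiener

/-! ### Hilbert tensor powers in an orthonormal basis

If `e` is an orthonormal basis of `H` indexed by `ι`, the vectors
`e_{α 1} ⊗ ⋯ ⊗ e_{α m} ⊗ ē_{β 1} ⊗ ⋯ ⊗ ē_{β n}` form an orthonormal basis of the Hilbert tensor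
product `H^{⊗ m} ⊗ H̄^{⊗ n}`, so that this space is the space of square summable families of
coefficients indexed by the pairs `(α, β)`, with the `ℓ²` norm. -/

/-- The Hilbert tensor product `H^{⊗ m} ⊗ H̄^{⊗ n}`: square summable families of coefficients
`f (α, β)`, standing for `∑ f (α, β) e_{α 1} ⊗ ⋯ ⊗ e_{α m} ⊗ ē_{β 1} ⊗ ⋯ ⊗ ē_{β n}`. -/
abbrev Kernel (ι : Type*) (m n : ℕ) : Type _ :=
  lp (fun _ : (Fin m → ι) × (Fin n → ι) => ℂ) 2

section Kernels

variable {ι : Type*}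

theorem memlp_two_iff {A : Type*} {f : A → ℂ} :
    Memℓp f 2 ↔ Summable fun a => ‖f a‖ ^ 2 := by
  rw [memℓp_gen_iff (by norm_num)]
  norm_num

theorem Kernel.summable_sq {m n : ℕ} (f : Kernel ι m n) : Summable fun p => ‖f p‖ ^ 2 :=
  memlp_two_iff.1 (lp.memℓp f)

/-- Membership in `H^{⊙ m} ⊗ H̄^{⊙ n}`: the kernel is symmetric in its first `m` indices and
symmetric in its last `n` indices. -/
def Kernel.IsSymm {m n : ℕ} (f : Kernel ι m n) : Prop :=
  ∀ (π : Equiv.Perm (Fin m)) (σ : Equiv.Perm (Fin n)) (α : Fin m → ι) (β : Fin n → ι),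
    f (α ∘ π, β ∘ σ) = f (α, β)

/-- The kernel with its first `m` indices permuted by `π` and its last `n` indices by `σ`. -/
def Kernel.permute {m n : ℕ} (π : Equiv.Perm (Fin m)) (σ : Equiv.Perm (Fin n))
    (f : Kernel ι m n) : Kernel ι m n :=
  ⟨fun p => f (p.1 ∘ π, p.2 ∘ σ), memlp_two_iff.2 <| by
    refine f.summable_sq.comp_injective
      (i := fun p : (Fin m → ι) × (Fin n → ι) => (p.1 ∘ π, p.2 ∘ σ)) ?_
    rintro ⟨a, b⟩ ⟨a', b'⟩ h
    simp only [Prod.mk.injEq] at h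
    exact Prod.ext (π.surjective.injective_comp_right h.1) (σ.surjective.injective_comp_right h.2)⟩

/-- Symmetrization `f̃ = (1 / (m! n!)) ∑_π ∑_σ f(t_{π 1}, …, t_{π m}; s_{σ 1}, …, s_{σ n})`. -/
def Kernel.symmetrize {m n : ℕ} (f : Kernel ι m n) : Kernel ι m n :=
  ((m.factorial : ℂ) * (n.factorial : ℂ))⁻¹ •
    ∑ π : Equiv.Perm (Fin m), ∑ σ : Equiv.Perm (Fin n), Kernel.permute π σ f

/-- The reversed complex conjugate `h(t; s) = conj (f(s; t))`. -/
def Kernel.revConj {m n : ℕ} (f : Kernel ι m n) : Kernel ι n m :=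
  ⟨fun p => conj (f (p.2, p.1)), memlp_two_iff.2 <| by
    simp only [RCLike.norm_conj]
    exact f.summable_sq.comp_injective
      (i := fun p : (Fin n → ι) × (Fin m → ι) => (p.2, p.1)) Prod.swap_injective⟩

/-- The list of `a` indices that consists of the `a - i` indices `t` followed by the `i`
indices `u`. -/
def join {a i : ℕ} (hi : i ≤ a) (t : Fin (a - i) → ι) (u : Fin i → ι) : Fin a → ι :=
  Fin.append t u ∘ Fin.cast (Nat.sub_add_cancel hi).symm

theorem join_injective {a i : ℕ} (hi : i ≤ a) {t t' : Fin (a - i) → ι} {u u' : Fin i → ι}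
    (h : join hi t u = join hi t' u') : t = t' ∧ u = u' := by
  have h2 : Fin.append t u = Fin.append t' u' :=
    (finCongr (Nat.sub_add_cancel hi).symm).surjective.injective_comp_right h
  constructor
  · funext x
    simpa using congrFun h2 (Fin.castAdd i x)
  · funext x
    simpa using congrFun h2 (Fin.natAdd (a - i) x)

theorem summable_sq_tsum_mul {A B K : Type*} {F : A × K → ℂ} {G : B × K → ℂ}
    (hF : Summable fun x => ‖F x‖ ^ 2) (hG : Summable fun x => ‖G x‖ ^ 2) :
    Summable fun x : A × B => ‖∑' k, F (x.1, k) * G (x.2, k)‖ ^ 2 := by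
  have h := hF.prod.mul_of_nonneg hG.prod (fun _ => tsum_nonneg fun _ => sq_nonneg _)
    (fun _ => tsum_nonneg fun _ => sq_nonneg _)
  refine Summable.of_nonneg_of_le (fun _ => sq_nonneg _) ?_ h
  rintro ⟨a, b⟩
  have hf := hF.prod_factor a
  have hg := hG.prod_factor b
  have key := Real.inner_le_Lp_mul_Lq_tsum_of_nonneg (p := 2) (q := 2)
    (f := fun k => ‖F (a, k)‖) (g := fun k => ‖G (b, k)‖)
    (by constructor <;> norm_num) (fun _ => norm_nonneg _) (fun _ => norm_nonneg _)
    (by simpa using hf) (by simpa using hg)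
  have hs := Real.summable_mul_of_Lp_Lq_of_nonneg (p := 2) (q := 2)
    (f := fun k => ‖F (a, k)‖) (g := fun k => ‖G (b, k)‖)
    (by constructor <;> norm_num) (fun _ => norm_nonneg _) (fun _ => norm_nonneg _)
    (by simpa using hf) (by simpa using hg)
  have h1 : ‖∑' k, F (a, k) * G (b, k)‖ ≤ ∑' k, ‖F (a, k)‖ * ‖G (b, k)‖ := by
    have : (fun k => ‖F (a, k)‖ * ‖G (b, k)‖) = fun k => ‖F (a, k) * G (b, k)‖ := by
      funext k; rw [norm_mul]
    rw [this] at hs ⊢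
    exact norm_tsum_le_tsum_norm hs
  have h2 := h1.trans key
  simp only [Real.rpow_two, ← Real.sqrt_eq_rpow] at h2
  calc ‖∑' k, F (a, k) * G (b, k)‖ ^ 2
      ≤ (√(∑' k, ‖F (a, k)‖ ^ 2) * √(∑' k, ‖G (b, k)‖ ^ 2)) ^ 2 := by gcongr
    _ = _ := by
      rw [mul_pow, Real.sq_sqrt (tsum_nonneg fun _ => sq_nonneg _),
        Real.sq_sqrt (tsum_nonneg fun _ => sq_nonneg _)]

/-- The coefficients of the contraction `f ⊗_{i,j} g` of `f ∈ H^{⊗ a} ⊗ H̄^{⊗ b}` and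
`g ∈ H^{⊗ c} ⊗ H̄^{⊗ d}`:
`(f ⊗_{i,j} g)(t, t'; s, s') = ∑_{u, v} f(t, u; s, v) g(t', v; s', u)`,
where `u` runs over the lists of `i` indices and `v` over the lists of `j` indices. -/
def Kernel.contractCoeff {a b c d : ℕ} (f : Kernel ι a b) (g : Kernel ι c d) {i j : ℕ}
    (hia : i ≤ a) (hjb : j ≤ b) (hjc : j ≤ c) (hid : i ≤ d)
    (p : (Fin ((a - i) + (c - j)) → ι) × (Fin ((b - j) + (d - i)) → ι)) : ℂ :=
  ∑' k : (Fin i → ι) × (Fin j → ι),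
    f (join hia (p.1 ∘ Fin.castAdd (c - j)) k.1, join hjb (p.2 ∘ Fin.castAdd (d - i)) k.2) *
    g (join hjc (p.1 ∘ Fin.natAdd (a - i)) k.2, join hid (p.2 ∘ Fin.natAdd (b - j)) k.1)

theorem Kernel.memlp_contractCoeff {a b c d : ℕ} (f : Kernel ι a b) (g : Kernel ι c d) {i j : ℕ}
    (hia : i ≤ a) (hjb : j ≤ b) (hjc : j ≤ c) (hid : i ≤ d) :
    Memℓp (f.contractCoeff g hia hjb hjc hid) 2 := by
  have hF := f.summable_sq.comp_injective
    (i := fun x : ((Fin (a - i) → ι) × (Fin (b - j) → ι)) × ((Fin i → ι) × (Fin j → ι)) =>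
      (join hia x.1.1 x.2.1, join hjb x.1.2 x.2.2)) (by
        rintro ⟨⟨t, s⟩, u, v⟩ ⟨⟨t', s'⟩, u', v'⟩ h
        simp only [Prod.mk.injEq] at h
        obtain ⟨rfl, rfl⟩ := join_injective hia h.1
        obtain ⟨rfl, rfl⟩ := join_injective hjb h.2
        rfl)
  have hG := g.summable_sq.comp_injective
    (i := fun x : ((Fin (c - j) → ι) × (Fin (d - i) → ι)) × ((Fin i → ι) × (Fin j → ι)) =>
      (join hjc x.1.1 x.2.2, join hid x.1.2 x.2.1)) (by
        rintro ⟨⟨t, s⟩, u, v⟩ ⟨⟨t', s'⟩, u', v'⟩ h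
        simp only [Prod.mk.injEq] at h
        obtain ⟨rfl, rfl⟩ := join_injective hjc h.1
        obtain ⟨rfl, rfl⟩ := join_injective hid h.2
        rfl)
  have h := summable_sq_tsum_mul
    (F := fun x : ((Fin (a - i) → ι) × (Fin (b - j) → ι)) × ((Fin i → ι) × (Fin j → ι)) =>
      f (join hia x.1.1 x.2.1, join hjb x.1.2 x.2.2))
    (G := fun x : ((Fin (c - j) → ι) × (Fin (d - i) → ι)) × ((Fin i → ι) × (Fin j → ι)) =>
      g (join hjc x.1.1 x.2.2, join hid x.1.2 x.2.1)) hF hG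
  refine memlp_two_iff.2 (h.comp_injective
    (i := fun p : (Fin ((a - i) + (c - j)) → ι) × (Fin ((b - j) + (d - i)) → ι) =>
      ((p.1 ∘ Fin.castAdd (c - j), p.2 ∘ Fin.castAdd (d - i)),
        (p.1 ∘ Fin.natAdd (a - i), p.2 ∘ Fin.natAdd (b - j)))) ?_)
  rintro ⟨T, S⟩ ⟨T', S'⟩ hp
  simp only [Prod.mk.injEq] at hp
  obtain ⟨⟨h1, h2⟩, h3, h4⟩ := hp
  refine Prod.ext (funext fun x => ?_) (funext fun x => ?_)
  · exact Fin.addCases (fun y => congrFun h1 y) (fun y => congrFun h3 y) x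
  · exact Fin.addCases (fun y => congrFun h2 y) (fun y => congrFun h4 y) x

/-- The contraction `f ⊗_{i,j} g ∈ H^{⊗ (a + c - i - j)} ⊗ H̄^{⊗ (b + d - i - j)}`. -/
def Kernel.contract {a b c d : ℕ} (f : Kernel ι a b) (g : Kernel ι c d) (i j : ℕ)
    (hia : i ≤ a) (hjb : j ≤ b) (hjc : j ≤ c) (hid : i ≤ d) :
    Kernel ι ((a - i) + (c - j)) ((b - j) + (d - i)) :=
  ⟨f.contractCoeff g hia hjb hjc hid, f.memlp_contractCoeff g hia hjb hjc hid⟩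

/-- `∑_{0 < i + j < m + n} ‖f ⊗_{i,j} h‖²`, where `h` is the reversed complex conjugate of `f`
(so that `0 ≤ i ≤ m` and `0 ≤ j ≤ n`). -/
def Kernel.sumContractRevConj {m n : ℕ} (f : Kernel ι m n) : ℝ :=
  ∑ i : Fin (m + 1), ∑ j : Fin (n + 1),
    if 0 < (i : ℕ) + j ∧ (i : ℕ) + j < m + n then
      ‖Kernel.contract f (Kernel.revConj f) i j i.is_le j.is_le j.is_le i.is_le‖ ^ 2 else 0

/-- `∑_{0 < i + j < 2 (m ∧ n)} ‖f ⊗_{i,j} f‖²` (with `0 ≤ i, j ≤ m ∧ n`). -/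
def Kernel.sumContractSelf {m n : ℕ} (f : Kernel ι m n) : ℝ :=
  ∑ i : Fin (min m n + 1), ∑ j : Fin (min m n + 1),
    if 0 < (i : ℕ) + j ∧ (i : ℕ) + j < 2 * min m n then
      ‖Kernel.contract f f i j (i.is_le.trans (min_le_left m n)) (j.is_le.trans (min_le_right m n))
        (j.is_le.trans (min_le_left m n)) (i.is_le.trans (min_le_right m n))‖ ^ 2 else 0

/-- `∑_{0 < i + j < m + n} ‖f ⊗̃_{i,j} h‖²`, the symmetrized version of
`Kernel.sumContractRevConj`. -/
def Kernel.sumSymmContractRevConj {m n : ℕ} (f : Kernel ι m n) : ℝ :=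
  ∑ i : Fin (m + 1), ∑ j : Fin (n + 1),
    if 0 < (i : ℕ) + j ∧ (i : ℕ) + j < m + n then
      ‖(Kernel.contract f (Kernel.revConj f) i j i.is_le j.is_le j.is_le i.is_le).symmetrize‖ ^ 2 else 0

/-- `∑_{0 < i + j < 2 (m ∧ n)} ‖f ⊗̃_{i,j} f‖²`, the symmetrized version of
`Kernel.sumContractSelf`. -/
def Kernel.sumSymmContractSelf {m n : ℕ} (f : Kernel ι m n) : ℝ :=
  ∑ i : Fin (min m n + 1), ∑ j : Fin (min m n + 1),
    if 0 < (i : ℕ) + j ∧ (i : ℕ) + j < 2 * min m n then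
      ‖(Kernel.contract f f i j (i.is_le.trans (min_le_left m n)) (j.is_le.trans (min_le_right m n))
        (j.is_le.trans (min_le_left m n)) (i.is_le.trans (min_le_right m n))).symmetrize‖ ^ 2
    else 0

end Kernels

/-! ### Complex isonormal Gaussian processes and multiple Wiener–Itô integrals -/

/-- The complex Hermite polynomial
`J_{m,n}(z, ρ) = ∑_{r ≤ m ∧ n} (-1)^r r! C(m,r) C(n,r) z^{m-r} z̄^{n-r} ρ^r`. -/
def hermite (m n : ℕ) (z : ℂ) (ρ : ℝ) : ℂ :=
  ∑ r ∈ Finset.range (min m n + 1),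
    (-1) ^ r * (r.factorial : ℂ) * (m.choose r : ℂ) * (n.choose r : ℂ) *
      z ^ (m - r) * (conj z) ^ (n - r) * (ρ : ℂ) ^ r

/-- A complex isonormal Gaussian process over the complex Hilbert space `H`: a centred jointly
Gaussian family of complex random variables `Z(h)`, `h ∈ H`, such that `E[Z(h)²] = 0` and
`E[Z(g) conj Z(h)] = ⟨g, h⟩`, where `⟨g, h⟩` is linear in `g` (Mathlib's `inner ℂ h g`). -/
structure IsIsonormal {H Ω : Type*} [NormedAddCommGroup H] [InnerProductSpace ℂ H]
    [MeasurableSpace Ω] (P : Measure Ω) (Z : H → Ω → ℂ) : Prop where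
  gaussian : IsGaussianProcess Z P
  centered : ∀ h, ∫ ω, Z h ω ∂P = 0
  sq_eq_zero : ∀ h, ∫ ω, Z h ω ^ 2 ∂P = 0
  covariance : ∀ g h, ∫ ω, Z g ω * conj (Z h ω) ∂P = inner ℂ h g

section Integral

variable {ι H Ω : Type*} [NormedAddCommGroup H] [InnerProductSpace ℂ H]
  [MeasurableSpace Ω] {P : Measure Ω} {Z : H → Ω → ℂ}

/-- The number of occurrences of `k` in the list of indices `α`. -/
def multiplicity {m : ℕ} (α : Fin m → ι) (k : ι) : ℕ :=
  Nat.card {p : Fin m // α p = k}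

open Classical in
/-- The set of indices that occur in `α` or in `β`. -/
def occurring {m n : ℕ} (α : Fin m → ι) (β : Fin n → ι) : Finset ι :=
  Finset.univ.image α ∪ Finset.univ.image β

/-- The value of the multiple integral at the basis vector
`e_{α 1} ⊗ ⋯ ⊗ e_{α m} ⊗ ē_{β 1} ⊗ ⋯ ⊗ ē_{β n}` (equivalently, at its symmetrization): with `m_k`,
`n_k` the numbers of occurrences of `k` in `α` and `β`, it is
`∏_k 2^{-(m_k + n_k)/2} J_{m_k, n_k}(√2 Z(e_k), 2)`. The factors with `m_k = n_k = 0` are `1`. -/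
def hermiteProduct (Z : H → Ω → ℂ) (e : ι → H) {m n : ℕ} (α : Fin m → ι) (β : Fin n → ι)
    (ω : Ω) : ℂ :=
  ∏ k ∈ occurring α β,
    ((√(2 ^ (multiplicity α k + multiplicity β k)) : ℝ) : ℂ)⁻¹ *
      hermite (multiplicity α k) (multiplicity β k) ((√2 : ℝ) * Z (e k) ω) 2

theorem memLp_pow {X : Ω → ℂ} [IsFiniteMeasure P]
    (hX : ∀ p : ENNReal, p ≠ ⊤ → MemLp X p P) (n : ℕ) :
    ∀ p : ENNReal, p ≠ ⊤ → MemLp (fun ω => X ω ^ n) p P := by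
  induction n with
  | zero => intro p _; simpa using memLp_const (1 : ℂ)
  | succ n ih =>
    intro p hp
    have h2 : p * 2 ≠ ⊤ := ENNReal.mul_ne_top hp (by simp)
    have : ENNReal.HolderTriple (p * 2) (p * 2) p := ⟨by
      rw [ENNReal.mul_inv (by simp) (by simp), ← mul_add, ENNReal.inv_two_add_inv_two, mul_one]⟩
    simp only [pow_succ]
    exact (hX _ h2).mul (ih _ h2)

theorem memLp_mul {X Y : Ω → ℂ}
    (hX : ∀ p : ENNReal, p ≠ ⊤ → MemLp X p P) (hY : ∀ p : ENNReal, p ≠ ⊤ → MemLp Y p P) :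
    ∀ p : ENNReal, p ≠ ⊤ → MemLp (fun ω => X ω * Y ω) p P := by
  intro p hp
  have h2 : p * 2 ≠ ⊤ := ENNReal.mul_ne_top hp (by simp)
  have : ENNReal.HolderTriple (p * 2) (p * 2) p := ⟨by
    rw [ENNReal.mul_inv (by simp) (by simp), ← mul_add, ENNReal.inv_two_add_inv_two, mul_one]⟩
  exact (hY _ h2).mul (hX _ h2)

theorem memLp_hermite {X : Ω → ℂ} [IsFiniteMeasure P]
    (hX : ∀ p : ENNReal, p ≠ ⊤ → MemLp X p P) (m n : ℕ) (ρ : ℝ) :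
    ∀ p : ENNReal, p ≠ ⊤ → MemLp (fun ω => hermite m n (X ω) ρ) p P := by
  intro p hp
  have hc : ∀ p : ENNReal, p ≠ ⊤ → MemLp (fun ω => conj (X ω)) p P := fun p hp => (hX p hp).star
  unfold hermite
  refine memLp_finsetSum _ fun r _ => ?_
  have h := (memLp_mul (memLp_pow hX (m - r)) (memLp_pow hc (n - r)) p hp).const_mul
    ((-1) ^ r * (r.factorial : ℂ) * (m.choose r : ℂ) * (n.choose r : ℂ) * (ρ : ℂ) ^ r)
  refine h.congr_norm (by simpa only [mul_assoc, mul_comm, mul_left_comm] using h.1) ?_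
  filter_upwards with ω
  congr 1
  ring

theorem memLp_hermiteProduct [IsFiniteMeasure P] (hZ : IsIsonormal P Z) (e : ι → H) {m n : ℕ}
    (α : Fin m → ι) (β : Fin n → ι) : MemLp (hermiteProduct Z e α β) 2 P := by
  have hX : ∀ k, ∀ p : ENNReal, p ≠ ⊤ → MemLp (fun ω => ((√2 : ℝ) : ℂ) * Z (e k) ω) p P :=
    fun k p hp => ((hZ.gaussian.hasGaussianLaw_eval (e k)).memLp hp).const_mul _
  suffices h : ∀ s : Finset ι, ∀ p : ENNReal, p ≠ ⊤ → MemLp (fun ω => ∏ k ∈ s,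
      (((√(2 ^ (multiplicity α k + multiplicity β k)) : ℝ) : ℂ)⁻¹ *
      hermite (multiplicity α k) (multiplicity β k) ((√2 : ℝ) * Z (e k) ω) 2)) p P from
    h _ 2 (by simp)
  classical
  intro s
  induction s using Finset.induction_on with
  | empty => intro p _; simpa using memLp_const (1 : ℂ)
  | insert k s hk ih =>
    simp only [Finset.prod_insert hk]
    exact memLp_mul (fun p hp => (memLp_hermite (hX k) _ _ 2 p hp).const_mul _) ih

/-- The terms `f(α, β) I_{m,n}(e_{α 1} ⊗ ⋯ ⊗ e_{α m} ⊗ ē_{β 1} ⊗ ⋯ ⊗ ē_{β n}) ∈ L²(Ω)` of the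
series that defines `I_{m,n}(f)`. -/
def wienerItoTerm [IsFiniteMeasure P] (hZ : IsIsonormal P Z) (e : HilbertBasis ι ℂ H)
    {m n : ℕ} (f : Kernel ι m n) (p : (Fin m → ι) × (Fin n → ι)) : Lp ℂ 2 P :=
  f p • (memLp_hermiteProduct hZ e p.1 p.2).toLp (hermiteProduct Z e p.1 p.2)

/-- The complex multiple Wiener–Itô integral `I_{m,n}(f)` of a kernel `f` given by its coefficients
in the orthonormal basis `e`: the linear extension to the closed span, in `L²(Ω)`, of the values at
the basis vectors. -/
def wienerIto [IsFiniteMeasure P] (hZ : IsIsonormal P Z) (e : HilbertBasis ι ℂ H)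
    {m n : ℕ} (f : Kernel ι m n) : Lp ℂ 2 P :=
  ∑' p, wienerItoTerm hZ e f p

end Integral

end ComplexWiener

end

/-! After truncation to finitely many basis vectors, F is a Wick polynomial :P: in independent
standard complex Gaussian variables, where P = ∑ f(α;β) z_α z̄_β is homogeneous of degree l. Two
facts carry the algebra: the isometry E[:P::Q:] = ⟨P,Q⟩ = P(∂_{z̄},∂_z)Q(0) (`map_wick_mul_wick`),
and the product formula, which writes :P::Q: as the sum over r of 1/r! times the Wick ordering of
the r-fold contraction of P and Q (`wick_mul_wick`). Both follow formally from Gaussian integration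
by parts E[X_t P] = E[∂_{t̄} P]. By the binomial theorem an r-fold contraction splits into
contractions of type (i, r-i), which are those of the kernels (`Kernel.contr₂_poly`).

Lower bound. Grouping the four factors of |F|⁴ as (FF)(F̄F̄) or as (FF̄)(FF̄), the product formula
makes E|F|⁴ a sum of squares. Keeping only the orders 0 and l leaves ‖P²‖² + |⟨P,P⟩|² in the first
case and ‖PP̄‖² + ‖P‖⁴ in the second. The Leibniz rule for the operator attached to Q̄ gives ‖PQ̄‖²
= |⟨Q,P⟩|² + ‖P‖²‖Q‖² + nonnegative terms (`nsq_mul_cj_eq`). The leading terms are exactly the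
moments that the cumulant subtracts, so the cumulant dominates every remaining term. In such a term
Q is differentiated along fixed indices and then contracted with P; the fixed indices are never
symmetrized with the others, so the unsymmetrized contraction is controlled
(`Kernel.norm_sq_contract_le_prodPart`). Taking Q = P̄ yields f ⊗ h, and Q = P yields f ⊗ f.

Upper bound. Since m P = ∑ z_k ∂_{z_k} P, integration by parts turns m E|F|⁴ into three expectations
in which one factor is contracted once with another. In each, the full contraction gives m times a
product of second moments; what is left are pairings of contractions of order strictly between 0 and
l, bounded by their squared norms. Norms of polynomials see only symmetrized kernels. This settles m
= n, where l' = l (`cum4_le_of_eq`). If m ≠ n, self-contractions outside the permitted range could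
occur; but the analogous identity for n and z̄ contains the same self-contraction term, and
subtracting the two leaves (m - n) E|F|⁴ expressed through f and h alone (`cum4_le_of_ne`).

General kernels. The upper bound for finite kernels, together with ‖f ⊗ g‖ ≤ ‖f‖‖g‖, already implies
E|F|⁴ ≤ C‖f‖⁴ and so takes the place of hypercontractivity. Hence the series converges
unconditionally in L⁴. The cumulant is continuous on L⁴ and the contraction sums are continuous in
f, so the inequalities pass to the limit along truncations that preserve symmetry. -/

noncomputable section

namespace ComplexWiener

open MvPolynomial TensorProduct

/-! ### Substituting commuting operators into a polynomial -/

section Operators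

variable {τ M : Type*} [AddCommGroup M] [Module ℂ M]

open scoped IsMulCommutative in
/-- Substitution of pairwise commuting operators for the variables of a polynomial. -/
def substOp (T : τ → Module.End ℂ M) (hT : ∀ s t, T s * T t = T t * T s) :
    MvPolynomial τ ℂ →ₐ[ℂ] Module.End ℂ M :=
  -- Evaluation of polynomials needs a commutative target, so it takes place in the subalgebra
  -- generated by the operators.
  haveI := Algebra.isMulCommutative_adjoin ℂ (s := Set.range T) (by
    rintro _ ⟨s, rfl⟩ _ ⟨t, rfl⟩; exact hT s t)
  (Algebra.adjoin ℂ (Set.range T)).val.comp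
    (aeval fun t => (⟨T t, Algebra.subset_adjoin ⟨t, rfl⟩⟩ : Algebra.adjoin ℂ (Set.range T)))

@[simp] theorem substOp_X (T : τ → Module.End ℂ M) (hT : ∀ s t, T s * T t = T t * T s) (t : τ) :
    substOp T hT (X t) = T t := by
  simp [substOp]

@[simp] theorem substOp_C (T : τ → Module.End ℂ M) (hT : ∀ s t, T s * T t = T t * T s) (a : ℂ)
    (x : M) : substOp T hT (C a) x = a • x := by
  have : (C a : MvPolynomial τ ℂ) = algebraMap ℂ _ a := rfl
  rw [this, AlgHom.commutes]
  rfl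

theorem substOp_X_mul (T : τ → Module.End ℂ M) (hT : ∀ s t, T s * T t = T t * T s) (t : τ)
    (P : MvPolynomial τ ℂ) (x : M) : substOp T hT (X t * P) x = T t (substOp T hT P x) := by
  rw [map_mul, substOp_X]; rfl

end Operators

/-! ### Wick calculus for polynomials in `z` and `z̄` -/

variable {κ : Type*}

/-- Polynomials in variables `z_k = X (inl k)` and `z̄_k = X (inr k)`. -/
abbrev ZPoly (κ : Type*) := MvPolynomial (κ ⊕ κ) ℂ

/-- The partial derivative as a linear operator. -/
def pd (t : κ ⊕ κ) : Module.End ℂ (ZPoly κ) := (pderiv t).toLinearMap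

theorem pd_apply (t : κ ⊕ κ) (P : ZPoly κ) : pd t P = pderiv t P := rfl

theorem pd_mul (t : κ ⊕ κ) (P Q : ZPoly κ) : pd t (P * Q) = pd t P * Q + P * pd t Q := by
  rw [pd_apply, pderiv_mul]; rfl

open Classical in
theorem pd_X_mul (s t : κ ⊕ κ) (P : ZPoly κ) :
    pd s (X t * P) = (if s = t then P else 0) + X t * pd s P := by
  rw [pd_mul, pd_apply, pderiv_X]
  by_cases h : s = t
  · subst h; simp
  · simp [h, Ne.symm h]

@[simp] theorem pd_C (t : κ ⊕ κ) (a : ℂ) : pd t (C a) = 0 := pderiv_C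

@[simp] theorem pd_one (t : κ ⊕ κ) : pd t (1 : ZPoly κ) = 0 := pderiv_one

/-- Induction on polynomials by left multiplication by variables. -/
theorem zpoly_induction {p : ZPoly κ → Prop} (P : ZPoly κ) (hC : ∀ a, p (C a))
    (hadd : ∀ P Q, p P → p Q → p (P + Q)) (hX : ∀ t P, p P → p (X t * P)) : p P :=
  MvPolynomial.induction_on P hC hadd fun P t h => mul_comm P (X t) ▸ hX t P h

theorem pd_comm_apply (s t : κ ⊕ κ) (P : ZPoly κ) : pd s (pd t P) = pd t (pd s P) := by
  induction P using zpoly_induction with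
  | hC a => simp
  | hadd p q hp hq => simp only [map_add, hp, hq]
  | hX i p hp =>
    simp only [pd_X_mul, map_add, hp]
    split_ifs <;> (try simp) <;> abel

theorem pd_comm (s t : κ ⊕ κ) : pd s * pd t = pd t * pd s :=
  LinearMap.ext fun P => pd_comm_apply s t P

/-- The creation operator `P ↦ X_t P - ∂_{t̄} P`. -/
def creation (t : κ ⊕ κ) : Module.End ℂ (ZPoly κ) := LinearMap.mulLeft ℂ (X t) - pd t.swap

theorem creation_apply (t : κ ⊕ κ) (P : ZPoly κ) : creation t P = X t * P - pd t.swap P := rfl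

-- The only cross terms are the Kronecker deltas of (s̄, t) and (t̄, s), which agree because the bar
-- is an involution. Without commutativity Wick ordering would depend on the order of the variables.
open Classical in
theorem creation_comm (s t : κ ⊕ κ) : creation s * creation t = creation t * creation s := by
  refine LinearMap.ext fun P => ?_
  simp only [Module.End.mul_apply, creation_apply, map_sub, pd_X_mul, pd_comm_apply s.swap t.swap]
  have : s.swap = t ↔ t.swap = s := by
    constructor <;> rintro rfl <;> simp
  rw [if_congr this rfl rfl]
  ring

/-- Wick ordering of polynomials. -/
def wick : ZPoly κ →ₗ[ℂ] ZPoly κ :=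
  (LinearMap.applyₗ (1 : ZPoly κ)).comp (substOp creation creation_comm).toLinearMap

@[simp] theorem wick_C (a : ℂ) : wick (C a : ZPoly κ) = C a := by
  have : wick (C a : ZPoly κ) = substOp creation creation_comm (C a) 1 := rfl
  rw [this, substOp_C, smul_eq_C_mul, mul_one]

theorem wick_one : wick (1 : ZPoly κ) = 1 := wick_C 1

theorem wick_X_mul (t : κ ⊕ κ) (P : ZPoly κ) :
    wick (X t * P) = X t * wick P - pd t.swap (wick P) :=
  substOp_X_mul creation creation_comm t P 1

/-- The commutator of ∂_s with a creation operator is that of ∂_s with multiplication by the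
variable, so Wick ordering respects derivatives. -/
theorem pd_wick (s : κ ⊕ κ) (P : ZPoly κ) : pd s (wick P) = wick (pd s P) := by
  induction P using zpoly_induction with
  | hC a => simp
  | hadd P Q hP hQ => simp only [map_add, hP, hQ]
  | hX t P hP =>
    rw [wick_X_mul, map_sub, pd_X_mul, pd_comm_apply, pd_X_mul, map_add, wick_X_mul, hP]
    split_ifs <;> (try simp) <;> ring

theorem pd_swap_comm (s t : κ ⊕ κ) : pd s.swap * pd t.swap = pd t.swap * pd s.swap :=
  pd_comm _ _

/-- The contraction of all the variables of `P` with `Q`: the differential operator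
`P(∂_{z̄}, ∂_z)` applied to `Q`. -/
def bracket : ZPoly κ →ₐ[ℂ] Module.End ℂ (ZPoly κ) :=
  substOp (fun t => pd t.swap) pd_swap_comm

theorem bracket_X_mul (t : κ ⊕ κ) (P Q : ZPoly κ) :
    bracket (X t * P) Q = bracket P (pd t.swap Q) := by
  rw [bracket, mul_comm, map_mul, substOp_X]; rfl

@[simp] theorem bracket_C (a : ℂ) (Q : ZPoly κ) : bracket (C a) Q = C a * Q := by
  rw [bracket, substOp_C, smul_eq_C_mul]

theorem bracket_mul (P Q R : ZPoly κ) : bracket (P * Q) R = bracket P (bracket Q R) := by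
  rw [map_mul]; rfl

/-- The bilinear form `⟨P, Q⟩ = P(∂_{z̄}, ∂_z) Q (0)`. -/
def pair (P Q : ZPoly κ) : ℂ := constantCoeff (bracket P Q)

theorem pair_add_left (P P' Q : ZPoly κ) : pair (P + P') Q = pair P Q + pair P' Q := by
  simp [pair]

theorem pair_add_right (P Q Q' : ZPoly κ) : pair P (Q + Q') = pair P Q + pair P Q' := by
  simp [pair]

theorem pair_smul_left (c : ℂ) (P Q : ZPoly κ) : pair (c • P) Q = c * pair P Q := by
  simp [pair]

theorem pair_smul_right (c : ℂ) (P Q : ZPoly κ) : pair P (c • Q) = c * pair P Q := by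
  simp [pair]

theorem pair_sum_left {α : Type*} (s : Finset α) (P : α → ZPoly κ) (Q : ZPoly κ) :
    pair (∑ i ∈ s, P i) Q = ∑ i ∈ s, pair (P i) Q := by
  simp [pair, LinearMap.sum_apply]

theorem pair_sum_right {α : Type*} (s : Finset α) (P : α → ZPoly κ) (Q : ZPoly κ) :
    pair Q (∑ i ∈ s, P i) = ∑ i ∈ s, pair Q (P i) := by
  simp [pair]

theorem pair_X_mul (t : κ ⊕ κ) (P Q : ZPoly κ) : pair (X t * P) Q = pair P (pd t.swap Q) := by
  rw [pair, bracket_X_mul]; rfl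

theorem pair_C_left (a : ℂ) (Q : ZPoly κ) : pair (C a) Q = a * constantCoeff Q := by
  simp [pair]

theorem pair_mul_left (P Q R : ZPoly κ) : pair (P * Q) R = pair P (bracket Q R) := by
  rw [pair, bracket_mul]; rfl

/-- The algebraic properties of the expectation `P ↦ E[P(Z, Z̄)]` for independent standard complex
Gaussian variables. -/
structure IsGaussianFunctional (E : ZPoly κ →ₗ[ℂ] ℂ) : Prop where
  map_one : E 1 = 1
  map_X_mul : ∀ t P, E (X t * P) = E (pd t.swap P)

namespace IsGaussianFunctional

variable {E : ZPoly κ →ₗ[ℂ] ℂ} (hE : IsGaussianFunctional E)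
include hE

/-- Integration by parts produces one term where the derivative hits :P:; the correction in the
creation operator cancels exactly this term. -/
theorem map_wick_X_mul (t : κ ⊕ κ) (P Q : ZPoly κ) :
    E (wick (X t * P) * Q) = E (wick P * pd t.swap Q) := by
  have h := hE.map_X_mul t (wick P * Q)
  rw [pd_mul, map_add] at h
  rw [wick_X_mul, sub_mul, mul_assoc, map_sub, h]
  ring

theorem map_C (a : ℂ) : E (C a) = a := by
  have : (C a : ZPoly κ) = a • (1 : ZPoly κ) := by rw [smul_eq_C_mul, mul_one]
  rw [this, map_smul, hE.map_one, smul_eq_mul, mul_one]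

omit hE in
theorem map_C_mul (a : ℂ) (P : ZPoly κ) : E (C a * P) = a * E P := by
  rw [← smul_eq_C_mul, map_smul, smul_eq_mul]

theorem map_wick (P : ZPoly κ) : E (wick P) = constantCoeff P := by
  induction P using zpoly_induction with
  | hC a => simp [hE.map_C]
  | hadd P Q hP hQ => simp only [map_add, hP, hQ]
  | hX t P hP => simpa using hE.map_wick_X_mul t P 1

/-- Wick isometry: the variables of P are moved one at a time onto Q, where they act as derivatives.
-/
theorem map_wick_mul_wick (P Q : ZPoly κ) : E (wick P * wick Q) = pair P Q := by
  induction P using zpoly_induction generalizing Q with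
  | hC a => rw [wick_C, map_C_mul, hE.map_wick, pair_C_left]
  | hadd P P' hP hP' => rw [map_add, add_mul, map_add, hP, hP', pair_add_left]
  | hX t P hP => rw [hE.map_wick_X_mul, pd_wick, hP, pair_X_mul]

/-- Read off from the commutative product inside the expectation, which avoids any computation with
differential operators. -/
theorem pair_comm (P Q : ZPoly κ) : pair P Q = pair Q P := by
  rw [← hE.map_wick_mul_wick, mul_comm, hE.map_wick_mul_wick]

end IsGaussianFunctional

/-! ### The product formula -/

section Tensor

variable {κ : Type*}

theorem mul'_map_mulLeft (P : ZPoly κ) (x : ZPoly κ ⊗[ℂ] ZPoly κ) :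
    LinearMap.mul' ℂ _ (TensorProduct.map (LinearMap.mulLeft ℂ P) LinearMap.id x) =
      P * LinearMap.mul' ℂ _ x := by
  induction x using TensorProduct.induction_on with
  | zero => simp
  | add x y hx hy => simp only [map_add, hx, hy, mul_add]
  | tmul P Q => simp [mul_assoc]

theorem map_pd_comm (s t s' t' : κ ⊕ κ) :
    Commute (TensorProduct.map (pd s) (pd t)) (TensorProduct.map (pd s') (pd t')) := by
  refine TensorProduct.ext' fun P Q => ?_
  simp [Module.End.mul_apply, pd_comm_apply s s', pd_comm_apply t t']

variable [Fintype κ]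

/-- The contraction operator `∑_k ∂_{s k} ⊗ ∂_{(s k)‾}`. -/
def lap (s : κ → κ ⊕ κ) : Module.End ℂ (ZPoly κ ⊗[ℂ] ZPoly κ) :=
  ∑ k, TensorProduct.map (pd (s k)) (pd (s k).swap)

theorem lap_tmul (s : κ → κ ⊕ κ) (P Q : ZPoly κ) :
    lap s (P ⊗ₜ Q) = ∑ k, pd (s k) P ⊗ₜ[ℂ] pd (s k).swap Q := by
  simp [lap, LinearMap.sum_apply]

/-- Contraction of one pair of variables. -/
def del : Module.End ℂ (ZPoly κ ⊗[ℂ] ZPoly κ) := lap Sum.inl + lap Sum.inr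

theorem del_tmul (P Q : ZPoly κ) :
    del (P ⊗ₜ Q) = ∑ t : κ ⊕ κ, pd t P ⊗ₜ[ℂ] pd t.swap Q := by
  simp [del, lap_tmul, Fintype.sum_sum_type]

theorem lap_comm (s s' : κ → κ ⊕ κ) : Commute (lap s) (lap s') :=
  Commute.sum_left _ _ _ fun _ _ => Commute.sum_right _ _ _ fun _ _ => map_pd_comm _ _ _ _

theorem del_pow_tmul_pd_right (t : κ ⊕ κ) (r : ℕ) (P Q : ZPoly κ) :
    (del ^ r) (P ⊗ₜ pd t Q) =
      TensorProduct.map LinearMap.id (pd t) ((del ^ r) (P ⊗ₜ[ℂ] Q)) := by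
  have hc : Commute (del (κ := κ)) (TensorProduct.map LinearMap.id (pd t)) := by
    refine TensorProduct.ext' fun P Q => ?_
    simp [Module.End.mul_apply, del_tmul, map_sum, pd_comm_apply t]
  have := congrArg (fun T => T (P ⊗ₜ[ℂ] Q)) (hc.pow_left r).eq
  simpa [Module.End.mul_apply] using this

theorem del_mulLeft (t : κ ⊕ κ) (x : ZPoly κ ⊗[ℂ] ZPoly κ) :
    del (TensorProduct.map (LinearMap.mulLeft ℂ (X t)) LinearMap.id x) =
      TensorProduct.map (LinearMap.mulLeft ℂ (X t)) LinearMap.id (del x) +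
        TensorProduct.map LinearMap.id (pd t.swap) x := by
  induction x using TensorProduct.induction_on with
  | zero => simp
  | add x y hx hy => simp only [map_add, hx, hy]; abel
  | tmul P Q =>
    simp only [map_tmul, del_tmul, LinearMap.mulLeft_apply, pd_X_mul, add_tmul, map_sum,
      Finset.sum_add_distrib, LinearMap.id_apply]
    rw [add_comm]
    congr 1
    rw [Finset.sum_eq_single t]
    · simp
    · intro s _ hs; simp [hs]
    · simp

/-- The commutator of `del` with multiplication by X_t on the left is ∂_{t̄} on the right, and this
commutes with `del`; a power of `del` therefore picks up its exponent, as when differentiating a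
power. -/
theorem del_pow_X_mul (t : κ ⊕ κ) (r : ℕ) (P Q : ZPoly κ) :
    (del ^ (r + 1)) ((X t * P) ⊗ₜ Q) =
      TensorProduct.map (LinearMap.mulLeft ℂ (X t)) LinearMap.id ((del ^ (r + 1)) (P ⊗ₜ[ℂ] Q)) +
        ((r + 1 : ℕ) : ℂ) • (del ^ r) (P ⊗ₜ pd t.swap Q) := by
  induction r with
  | zero =>
    have := del_mulLeft t (P ⊗ₜ[ℂ] Q)
    simpa using this
  | succ r ih =>
    have h (n : ℕ) (x : ZPoly κ ⊗[ℂ] ZPoly κ) : del ((del ^ n) x) = (del ^ (n + 1)) x := by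
      rw [pow_succ', Module.End.mul_apply]
    rw [← h, ih, map_add, del_mulLeft, map_smul, h, h, ← del_pow_tmul_pd_right, add_assoc]
    congr 1
    push_cast
    module

/-- The `r`-fold contraction of two polynomials. -/
def contr (r : ℕ) (P Q : ZPoly κ) : ZPoly κ := LinearMap.mul' ℂ _ ((del ^ r) (P ⊗ₜ[ℂ] Q))

theorem contr_def (r : ℕ) (P Q : ZPoly κ) :
    contr r P Q = LinearMap.mul' ℂ _ ((del ^ r) (P ⊗ₜ[ℂ] Q)) := rfl

@[simp] theorem contr_zero (P Q : ZPoly κ) : contr 0 P Q = P * Q := by simp [contr]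

theorem contr_add_left (r : ℕ) (P P' Q : ZPoly κ) :
    contr r (P + P') Q = contr r P Q + contr r P' Q := by
  simp [contr, add_tmul]

/-- Each contraction differentiates P, so exp(`del`) is a finite sum, of a length that depends on P
but not on Q. -/
theorem exists_del_pow_eq_zero (P : ZPoly κ) :
    ∃ N, ∀ r ≥ N, ∀ Q : ZPoly κ, (del ^ r) (P ⊗ₜ[ℂ] Q) = 0 := by
  induction P using zpoly_induction with
  | hC a =>
    refine ⟨1, fun r hr Q => ?_⟩
    obtain ⟨r, rfl⟩ := Nat.exists_eq_add_of_le' hr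
    rw [pow_succ, Module.End.mul_apply, del_tmul]
    simp
  | hadd P Q hP hQ =>
    obtain ⟨N, hN⟩ := hP
    obtain ⟨N', hN'⟩ := hQ
    refine ⟨max N N', fun r hr R => ?_⟩
    rw [add_tmul, map_add, hN r (le_of_max_le_left hr), hN' r (le_of_max_le_right hr), add_zero]
  | hX t P hP =>
    obtain ⟨N, hN⟩ := hP
    refine ⟨N + 1, fun r hr R => ?_⟩
    obtain ⟨r, rfl⟩ := Nat.exists_eq_add_of_le' (le_of_add_le_right hr)
    rw [del_pow_X_mul, hN _ (by omega), hN _ (by omega)]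
    simp

/-- The commutation rule exp(D) X_t = X_t exp(D) + exp(D)(1 ⊗ ∂_{t̄}) for D = `del`, in truncated
form; `hN` kills the boundary term of the truncation. The map Φ is left free so that both the Wick
product formula and the Leibniz rule can use it. -/
theorem sum_range_contr_X_mul {M : Type*} [AddCommGroup M] [Module ℂ M]
    (Φ : ZPoly κ ⊗[ℂ] ZPoly κ →ₗ[ℂ] M) (t : κ ⊕ κ) (P Q : ZPoly κ) {N : ℕ}
    (hN : (del ^ N) (P ⊗ₜ[ℂ] pd t.swap Q) = 0) :
    ∑ r ∈ Finset.range (N + 1), ((r.factorial : ℂ)⁻¹) • Φ ((del ^ r) ((X t * P) ⊗ₜ[ℂ] Q)) =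
      ∑ r ∈ Finset.range (N + 1), ((r.factorial : ℂ)⁻¹) •
          Φ (TensorProduct.map (LinearMap.mulLeft ℂ (X t)) LinearMap.id
            ((del ^ r) (P ⊗ₜ[ℂ] Q))) +
        ∑ r ∈ Finset.range (N + 1), ((r.factorial : ℂ)⁻¹) •
          Φ ((del ^ r) (P ⊗ₜ[ℂ] pd t.swap Q)) := by
  rw [Finset.sum_range_succ', Finset.sum_range_succ' (fun r => ((r.factorial : ℂ)⁻¹) •
    Φ (TensorProduct.map (LinearMap.mulLeft ℂ (X t)) LinearMap.id ((del ^ r) (P ⊗ₜ[ℂ] Q)))),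
    Finset.sum_range_succ (fun r => ((r.factorial : ℂ)⁻¹) • Φ ((del ^ r) (P ⊗ₜ[ℂ] pd t.swap Q))),
    hN, map_zero, smul_zero, add_zero, add_right_comm, ← Finset.sum_add_distrib]
  congr 1
  · refine Finset.sum_congr rfl fun r _ => ?_
    rw [del_pow_X_mul, map_add, map_smul, smul_add, smul_smul]
    congr 2
    rw [Nat.factorial_succ]
    push_cast
    have h1 : (r.factorial : ℂ) ≠ 0 := by exact_mod_cast r.factorial_ne_zero
    have h2 : (r : ℂ) + 1 ≠ 0 := by exact_mod_cast r.succ_ne_zero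
    field_simp

/-- Both sides obey the same recursion when a variable is added to P. The threshold must be uniform
in Q, since the induction also uses the formula for ∂_{t̄} Q. -/
theorem eventually_wick_mul_wick (P : ZPoly κ) : ∃ N₀, ∀ N ≥ N₀, ∀ Q : ZPoly κ,
    wick P * wick Q = ∑ r ∈ Finset.range N, ((r.factorial : ℂ)⁻¹) • wick (contr r P Q) := by
  induction P using zpoly_induction with
  | hC a =>
    refine ⟨1, fun N hN Q => ?_⟩
    obtain ⟨N, rfl⟩ := Nat.exists_eq_add_of_le' hN
    rw [Finset.sum_range_succ', Finset.sum_eq_zero]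
    · have (P : ZPoly κ) : C a * P = a • P := by rw [smul_eq_C_mul]
      simp [this]
    · intro r _
      rw [contr, pow_succ, Module.End.mul_apply, del_tmul]
      simp
  | hadd P Q hP hQ =>
    obtain ⟨N, hN⟩ := hP
    obtain ⟨N', hN'⟩ := hQ
    refine ⟨max N N', fun r hr R => ?_⟩
    simp only [contr_add_left, map_add, add_mul, smul_add, Finset.sum_add_distrib]
    rw [hN r (le_of_max_le_left hr), hN' r (le_of_max_le_right hr)]
  | hX t P hP =>
    obtain ⟨N, hN⟩ := hP
    obtain ⟨N', hN'⟩ := exists_del_pow_eq_zero P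
    refine ⟨max N N' + 1, fun r hr Q => ?_⟩
    obtain ⟨r, rfl⟩ := Nat.exists_eq_add_of_le' (le_of_add_le_right hr)
    have hr1 : r + 1 ≥ N := by omega
    have h := sum_range_contr_X_mul (wick ∘ₗ LinearMap.mul' ℂ _) t P Q (hN' r (by omega) _)
    simp only [LinearMap.comp_apply, mul'_map_mulLeft] at h
    simp only [← contr_def] at h
    rw [h, ← hN _ hr1]
    simp only [wick_X_mul, smul_sub, Finset.sum_sub_distrib, ← mul_smul_comm, ← Finset.mul_sum,
      ← map_smul (pd t.swap), ← map_sum (pd t.swap)]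
    rw [← hN _ hr1, pd_mul, pd_wick, pd_wick]
    ring

/-- The Leibniz rule for the differential operator attached to P: r of its derivatives fall on Q and
the others on R. The induction needs it for R and for ∂_{t̄} R. -/
theorem eventually_bracket_mul (P R : ZPoly κ) : ∃ N₀, ∀ N ≥ N₀, ∀ Q : ZPoly κ,
    bracket P (R * Q) = ∑ r ∈ Finset.range N, ((r.factorial : ℂ)⁻¹) •
      LinearMap.mul' ℂ _ (TensorProduct.map (bracket.toLinearMap.flip R) LinearMap.id
        ((del ^ r) (P ⊗ₜ[ℂ] Q))) := by
  induction P using zpoly_induction generalizing R with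
  | hC a =>
    refine ⟨1, fun N hN Q => ?_⟩
    obtain ⟨N, rfl⟩ := Nat.exists_eq_add_of_le' hN
    rw [Finset.sum_range_succ', Finset.sum_eq_zero]
    · simp
    · intro r _
      rw [pow_succ, Module.End.mul_apply, del_tmul]
      simp
  | hadd P Q hP hQ =>
    obtain ⟨N, hN⟩ := hP R
    obtain ⟨N', hN'⟩ := hQ R
    refine ⟨max N N', fun r hr S => ?_⟩
    simp only [add_tmul, map_add, LinearMap.add_apply, smul_add, Finset.sum_add_distrib]
    rw [hN r (le_of_max_le_left hr), hN' r (le_of_max_le_right hr)]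
  | hX t P hP =>
    obtain ⟨N, hN⟩ := hP R
    obtain ⟨N2, hN2⟩ := hP (pd t.swap R)
    obtain ⟨N', hN'⟩ := exists_del_pow_eq_zero P
    refine ⟨max (max N N2) N' + 1, fun r hr Q => ?_⟩
    obtain ⟨r, rfl⟩ := Nat.exists_eq_add_of_le' (le_of_add_le_right hr)
    have h := sum_range_contr_X_mul (LinearMap.mul' ℂ _ ∘ₗ
      TensorProduct.map (bracket.toLinearMap.flip R) LinearMap.id) t P Q (hN' r (by omega) _)
    simp only [LinearMap.comp_apply] at h
    rw [h, bracket_X_mul, pd_mul, map_add, hN (r + 1) (by omega), hN2 (r + 1) (by omega)]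
    congr 1
    refine Finset.sum_congr rfl fun r _ => ?_
    congr 2
    generalize (del ^ r) (P ⊗ₜ[ℂ] Q) = x
    induction x using TensorProduct.induction_on with
    | zero => simp
    | add x y hx hy => simp only [map_add, hx, hy]
    | tmul P Q => simp [bracket_X_mul, -map_mul]

end Tensor

/-! ### Homogeneous polynomials -/

section Homogeneous

variable {κ : Type*}

theorem pd_eq_zero_of_isHomogeneous_zero {P : ZPoly κ} (hP : P.IsHomogeneous 0) (t : κ ⊕ κ) :
    pd t P = 0 := by
  rw [totalDegree_eq_zero_iff_eq_C.1 (Nat.le_zero.1 hP.totalDegree_le), pd_C]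

theorem isHomogeneous_pd {P : ZPoly κ} {l : ℕ} (hP : P.IsHomogeneous l) (t : κ ⊕ κ) :
    (pd t P).IsHomogeneous (l - 1) := hP.pderiv

theorem eq_C_of_isHomogeneous_zero {P : ZPoly κ} (hP : P.IsHomogeneous 0) :
    P = C (constantCoeff P) := by
  have := totalDegree_eq_zero_iff_eq_C.1 (Nat.le_zero.1 hP.totalDegree_le)
  rw [this]; simp

theorem constantCoeff_eq_zero {P : ZPoly κ} {l : ℕ} (hP : P.IsHomogeneous l) (hl : l ≠ 0) :
    constantCoeff P = 0 := by
  rw [constantCoeff_eq]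
  exact hP.coeff_eq_zero (by simpa using hl.symm)

variable [Fintype κ]

theorem isHomogeneous_contr {P Q : ZPoly κ} {l l' : ℕ} (hP : P.IsHomogeneous l)
    (hQ : Q.IsHomogeneous l') (r : ℕ) : (contr r P Q).IsHomogeneous (l + l' - 2 * r) := by
  induction r generalizing P Q l l' with
  | zero => simpa using hP.mul hQ
  | succ r ih =>
    rw [contr, pow_succ, Module.End.mul_apply, del_tmul, map_sum, map_sum]
    simp only [← contr_def]
    refine IsHomogeneous.sum _ _ _ fun t _ => ?_
    rcases l with _ | l
    · rw [pd_eq_zero_of_isHomogeneous_zero hP]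
      simpa [contr] using isHomogeneous_zero _ _ _
    rcases l' with _ | l'
    · rw [pd_eq_zero_of_isHomogeneous_zero hQ]
      simpa [contr] using isHomogeneous_zero _ _ _
    convert ih (isHomogeneous_pd hP t) (isHomogeneous_pd hQ t.swap) using 1
    omega

theorem del_pow_eq_zero {P : ZPoly κ} {l : ℕ} (hP : P.IsHomogeneous l) (Q : ZPoly κ) {r : ℕ}
    (hr : l < r) : (del ^ r) (P ⊗ₜ[ℂ] Q) = 0 := by
  induction r generalizing P Q l with
  | zero => omega
  | succ r ih =>
    rw [pow_succ, Module.End.mul_apply, del_tmul, map_sum]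
    refine Finset.sum_eq_zero fun t _ => ?_
    rcases l with _ | l
    · rw [pd_eq_zero_of_isHomogeneous_zero hP]; simp
    · exact ih (isHomogeneous_pd hP t) _ (by omega)

theorem wick_mul_wick {P : ZPoly κ} {l : ℕ} (hP : P.IsHomogeneous l) (Q : ZPoly κ) :
    wick P * wick Q =
      ∑ r ∈ Finset.range (l + 1), ((r.factorial : ℂ)⁻¹) • wick (contr r P Q) := by
  obtain ⟨N, hN⟩ := eventually_wick_mul_wick P
  rw [hN (max N (l + 1)) (le_max_left _ _)]
  refine (Finset.sum_subset (by simp) fun r _ hr => ?_).symm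
  rw [contr, del_pow_eq_zero hP Q (by simpa using hr)]
  simp

theorem bracket_apply_mul {P : ZPoly κ} {l : ℕ} (hP : P.IsHomogeneous l) (R Q : ZPoly κ) :
    bracket P (R * Q) = ∑ r ∈ Finset.range (l + 1), ((r.factorial : ℂ)⁻¹) •
      LinearMap.mul' ℂ _ (TensorProduct.map (bracket.toLinearMap.flip R) LinearMap.id
        ((del ^ r) (P ⊗ₜ[ℂ] Q))) := by
  obtain ⟨N, hN⟩ := eventually_bracket_mul P R
  rw [hN (max N (l + 1)) (le_max_left _ _)]
  refine (Finset.sum_subset (by simp) fun r _ hr => ?_).symm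
  rw [del_pow_eq_zero hP Q (by simpa using hr)]
  simp

/-- The operator that multiplies a polynomial by its degree. -/
theorem sum_X_mul_pd {P : ZPoly κ} {l : ℕ} (hP : P.IsHomogeneous l) :
    ∑ t, X t * pd t P = (l : ℂ) • P := by
  rw [Nat.cast_smul_eq_nsmul]
  exact hP.sum_X_mul_pderiv

theorem contr_comm (r : ℕ) (P Q : ZPoly κ) : contr r P Q = contr r Q P := by
  induction r generalizing P Q with
  | zero => simp [mul_comm]
  | succ r ih =>
    simp only [contr, pow_succ, Module.End.mul_apply, del_tmul, map_sum]
    simp only [← contr_def]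
    rw [← (Equiv.sumComm κ κ).sum_comp]
    refine Finset.sum_congr rfl fun t _ => ?_
    rw [ih]
    simp

namespace IsGaussianFunctional

variable {E : ZPoly κ →ₗ[ℂ] ℂ} (hE : IsGaussianFunctional E)
include hE

/-- By Euler's identity on either side, l and l' times the pairing both equal ∑_t ⟨∂_t P, ∂_{t̄} Q⟩.
-/
theorem pair_eq_zero {P Q : ZPoly κ} {l l' : ℕ} (hP : P.IsHomogeneous l)
    (hQ : Q.IsHomogeneous l') (h : l ≠ l') : pair P Q = 0 := by
  have h1 : (l : ℂ) * pair P Q = ∑ t, pair (pd t P) (pd t.swap Q) := by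
    rw [← pair_smul_left, ← sum_X_mul_pd hP, pair_sum_left]
    simp only [pair_X_mul]
  have h2 : (l' : ℂ) * pair P Q = ∑ t, pair (pd t P) (pd t.swap Q) := by
    rw [hE.pair_comm, ← pair_smul_left, ← sum_X_mul_pd hQ, pair_sum_left]
    simp only [pair_X_mul]
    rw [← (Equiv.sumComm κ κ).sum_comp]
    refine Finset.sum_congr rfl fun t _ => ?_
    rw [hE.pair_comm]
    simp
  have h3 : ((l : ℂ) - l') * pair P Q = 0 := by rw [sub_mul, h1, h2, sub_self]
  refine (mul_eq_zero.1 h3).resolve_left ?_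
  exact sub_ne_zero.2 (by exact_mod_cast h)

/-- `E[:P: :Q:]` is the constant coming from the full contraction. -/
theorem map_wick_mul_wick_eq {P Q : ZPoly κ} {l : ℕ} (hP : P.IsHomogeneous l)
    (hQ : Q.IsHomogeneous l) :
    contr l P Q = C ((l.factorial : ℂ) * E (wick P * wick Q)) := by
  have h1 : (contr l P Q).IsHomogeneous 0 := by
    convert isHomogeneous_contr hP hQ l using 1; omega
  have h2 := wick_mul_wick hP Q
  rw [h2, map_sum, Finset.sum_eq_single l]
  · rw [map_smul, hE.map_wick, smul_eq_mul, mul_inv_cancel_left₀, ← eq_C_of_isHomogeneous_zero h1]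
    exact_mod_cast l.factorial_ne_zero
  · intro r hr hrl
    rw [map_smul, hE.map_wick, constantCoeff_eq_zero (isHomogeneous_contr hP hQ r), smul_zero]
    have := Finset.mem_range.1 hr
    omega
  · simp

/-- Each product of two factors is expanded by the product formula; different contraction orders
have different degrees and are orthogonal, so only the diagonal remains. -/
theorem map_wick_four {P₁ P₂ P₃ P₄ : ZPoly κ} {l : ℕ} (h₁ : P₁.IsHomogeneous l)
    (h₂ : P₂.IsHomogeneous l) (h₃ : P₃.IsHomogeneous l) (h₄ : P₄.IsHomogeneous l) :
    E (wick P₁ * wick P₂ * (wick P₃ * wick P₄)) =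
      ∑ r ∈ Finset.range (l + 1),
        ((r.factorial : ℂ)⁻¹) ^ 2 * pair (contr r P₁ P₂) (contr r P₃ P₄) := by
  rw [wick_mul_wick h₁, wick_mul_wick h₃, Finset.sum_mul_sum, map_sum]
  refine Finset.sum_congr rfl fun r hr => ?_
  rw [map_sum, Finset.sum_eq_single r]
  · rw [smul_mul_smul_comm, map_smul, hE.map_wick_mul_wick, smul_eq_mul, sq]
  · intro r' hr' hrr
    rw [smul_mul_smul_comm, map_smul, hE.map_wick_mul_wick,
      hE.pair_eq_zero (isHomogeneous_contr h₁ h₂ r) (isHomogeneous_contr h₃ h₄ r'), smul_zero]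
    have := Finset.mem_range.1 hr
    have := Finset.mem_range.1 hr'
    omega
  · exact fun h => absurd hr h

end IsGaussianFunctional

end Homogeneous

/-! ### Conjugation -/

section Conj

variable {κ : Type*}

/-- The complex conjugate of a polynomial in `z` and `z̄`. -/
def cj (P : ZPoly κ) : ZPoly κ := rename Sum.swap (map (starRingEnd ℂ) P)

@[simp] theorem cj_C (a : ℂ) : cj (C a : ZPoly κ) = C (conj a) := by simp [cj]
@[simp] theorem cj_X (t : κ ⊕ κ) : cj (X t : ZPoly κ) = X t.swap := by simp [cj]
@[simp] theorem cj_add (P Q : ZPoly κ) : cj (P + Q) = cj P + cj Q := by simp [cj]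
@[simp] theorem cj_mul (P Q : ZPoly κ) : cj (P * Q) = cj P * cj Q := by simp [cj]
@[simp] theorem cj_zero : cj (0 : ZPoly κ) = 0 := by simp [cj]
@[simp] theorem cj_sub (P Q : ZPoly κ) : cj (P - Q) = cj P - cj Q := by simp [cj]
@[simp] theorem cj_sum {α : Type*} (s : Finset α) (P : α → ZPoly κ) :
    cj (∑ i ∈ s, P i) = ∑ i ∈ s, cj (P i) := by simp [cj]
@[simp] theorem cj_prod {α : Type*} (s : Finset α) (P : α → ZPoly κ) :
    cj (∏ i ∈ s, P i) = ∏ i ∈ s, cj (P i) := by simp [cj]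
@[simp] theorem cj_smul (a : ℂ) (P : ZPoly κ) : cj (a • P) = conj a • cj P := by
  simp [smul_eq_C_mul]

@[simp] theorem cj_cj (P : ZPoly κ) : cj (cj P) = P := by
  induction P using zpoly_induction with
  | hC a => simp
  | hadd P Q hP hQ => simp [hP, hQ]
  | hX t P hP => simp [hP]

theorem constantCoeff_cj (P : ZPoly κ) : constantCoeff (cj P) = conj (constantCoeff P) := by
  induction P using zpoly_induction with
  | hC a => simp
  | hadd P Q hP hQ => simp [hP, hQ]
  | hX t P hP => simp [hP]

theorem pd_cj (t : κ ⊕ κ) (P : ZPoly κ) : pd t (cj P) = cj (pd t.swap P) := by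
  induction P using zpoly_induction with
  | hC a => simp
  | hadd P Q hP hQ => simp [hP, hQ]
  | hX s P hP =>
    simp only [cj_mul, cj_X, pd_X_mul, cj_add, hP]
    have : t = s.swap ↔ t.swap = s := by
      constructor <;> rintro rfl <;> simp
    by_cases h : t = s.swap
    · simp [h]
    · simp [h, mt this.2 h]

theorem isHomogeneous_cj {P : ZPoly κ} {l : ℕ} (hP : P.IsHomogeneous l) :
    (cj P).IsHomogeneous l := by
  unfold cj
  exact (hP.map _).rename_isHomogeneous

theorem wick_cj (P : ZPoly κ) : wick (cj P) = cj (wick P) := by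
  induction P using zpoly_induction with
  | hC a => simp
  | hadd P Q hP hQ => simp [hP, hQ]
  | hX s P hP => simp only [cj_mul, cj_X, wick_X_mul, hP, cj_sub, pd_cj, Sum.swap_swap]

theorem bracket_cj (P Q : ZPoly κ) : bracket (cj P) (cj Q) = cj (bracket P Q) := by
  induction P using zpoly_induction generalizing Q with
  | hC a => simp
  | hadd P P' hP hP' => simp [hP, hP']
  | hX s P hP => rw [cj_mul, cj_X, bracket_X_mul, bracket_X_mul, pd_cj, Sum.swap_swap, hP]

theorem pair_cj (P Q : ZPoly κ) : pair (cj P) (cj Q) = conj (pair P Q) := by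
  rw [pair, bracket_cj, constantCoeff_cj]; rfl

/-- The square of the norm of a polynomial, `E|:P:|²`. -/
def nsq (P : ZPoly κ) : ℝ := (pair P (cj P)).re

theorem nsq_smul (a : ℂ) (P : ZPoly κ) : nsq (a • P) = ‖a‖ ^ 2 * nsq P := by
  rw [nsq, cj_smul, pair_smul_left, pair_smul_right, ← mul_assoc, Complex.mul_conj,
    Complex.re_ofReal_mul, Complex.normSq_eq_norm_sq]
  rfl

theorem nsq_C (a : ℂ) : nsq (C a : ZPoly κ) = ‖a‖ ^ 2 := by
  rw [nsq, cj_C, pair_C_left, constantCoeff_C, Complex.mul_conj, Complex.ofReal_re,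
    Complex.normSq_eq_norm_sq]

theorem nsq_add_add_nsq_sub (P Q : ZPoly κ) : nsq (P + Q) + nsq (P - Q) = 2 * (nsq P + nsq Q) := by
  have h : P - Q = P + (-1 : ℂ) • Q := by simp [sub_eq_add_neg]
  simp only [h, nsq, cj_add, pair_add_left, pair_add_right, cj_smul, pair_smul_left,
    pair_smul_right, map_neg, map_one, Complex.add_re, neg_one_mul, Complex.neg_re]
  ring

@[simp] theorem nsq_zero : nsq (0 : ZPoly κ) = 0 := by simp [nsq, pair]

end Conj

/-! ### Conjugation and contractions -/

section ContrConj

variable {κ : Type*} [Fintype κ]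

theorem contr_cj (r : ℕ) (P Q : ZPoly κ) : contr r (cj P) (cj Q) = cj (contr r P Q) := by
  induction r generalizing P Q with
  | zero => simp
  | succ r ih =>
    simp only [contr, pow_succ, Module.End.mul_apply, del_tmul, map_sum]
    simp only [← contr_def, pd_cj, ih, ← cj_sum]
    rw [← (Equiv.sumComm κ κ).sum_comp]
    simp

end ContrConj

/-- A Gaussian functional that is positive on the polynomials `P P̄`. -/
structure IsPosGaussianFunctional {κ : Type*} (E : ZPoly κ →ₗ[ℂ] ℂ) : Prop
    extends IsGaussianFunctional E where
  nonneg : ∀ P, 0 ≤ (E (P * cj P)).re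

namespace IsPosGaussianFunctional

variable {κ : Type*} {E : ZPoly κ →ₗ[ℂ] ℂ} (hE : IsPosGaussianFunctional E)
include hE

theorem nsq_nonneg (P : ZPoly κ) : 0 ≤ nsq P := by
  rw [nsq, ← hE.map_wick_mul_wick, wick_cj]
  exact hE.nonneg _

theorem pair_self (P : ZPoly κ) : pair P (cj P) = (nsq P : ℂ) := by
  have h : conj (pair P (cj P)) = pair P (cj P) := by
    rw [← pair_cj, cj_cj, hE.pair_comm]
  rw [nsq]
  exact (Complex.conj_eq_iff_re.1 h).symm

theorem nsq_cj (P : ZPoly κ) : nsq (cj P) = nsq P := by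
  rw [nsq, nsq, cj_cj, hE.pair_comm]

theorem nsq_add_le (P Q : ZPoly κ) : nsq (P + Q) ≤ 2 * (nsq P + nsq Q) := by
  linarith [nsq_add_add_nsq_sub P Q, hE.nsq_nonneg (P - Q)]

/-- A crude constant suffices: only its independence of the polynomials matters. -/
theorem nsq_sum_le {α : Type*} (s : Finset α) (P : α → ZPoly κ) :
    nsq (∑ i ∈ s, P i) ≤ 2 ^ s.card * ∑ i ∈ s, nsq (P i) := by
  classical
  induction s using Finset.induction_on with
  | empty => simp
  | insert a s ha ih =>
    rw [Finset.sum_insert ha, Finset.sum_insert ha, Finset.card_insert_of_notMem ha, pow_succ]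
    have h1 := hE.nsq_add_le (P a) (∑ i ∈ s, P i)
    have h2 : (1 : ℝ) ≤ 2 ^ s.card := one_le_pow₀ (by norm_num)
    nlinarith [hE.nsq_nonneg (P a)]

/-- Expansion of the nonnegative quantities ‖P + Q‖² and ‖P - Q‖². -/
theorem two_re_pair_le (P Q : ZPoly κ) : 2 * |(pair P (cj Q)).re| ≤ nsq P + nsq Q := by
  have h : (pair Q (cj P)).re = (pair P (cj Q)).re := by
    rw [hE.pair_comm, ← Complex.conj_re, ← pair_cj, cj_cj]
  have key (R : ZPoly κ) (hR : R = P + Q ∨ R = P - Q) : 0 ≤ nsq R := hE.nsq_nonneg R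
  have h1 := key _ (Or.inl rfl)
  have h2 := key _ (Or.inr rfl)
  have h' : P - Q = P + (-1 : ℂ) • Q := by simp [sub_eq_add_neg]
  rw [h'] at h2
  simp only [nsq, cj_add, pair_add_left, pair_add_right, cj_smul, pair_smul_left,
    pair_smul_right, map_neg, map_one, Complex.add_re, neg_one_mul, Complex.neg_re, h] at h1 h2 ⊢
  rcases abs_cases (pair P (cj Q)).re with h3 | h3 <;> linarith

end IsPosGaussianFunctional

/-! ### Iterated derivatives -/

section Iterated

variable {κ : Type*}

/-- The iterated derivative `∂_{s (u 0)} ⋯ ∂_{s (u (i - 1))}`. -/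
def iterD (s : κ → κ ⊕ κ) : {i : ℕ} → (Fin i → κ) → Module.End ℂ (ZPoly κ)
  | 0, _ => 1
  | _ + 1, u => iterD s (Fin.tail u) * pd (s (u 0))

@[simp] theorem iterD_zero (s : κ → κ ⊕ κ) (u : Fin 0 → κ) (P : ZPoly κ) : iterD s u P = P := rfl

theorem iterD_succ (s : κ → κ ⊕ κ) {i : ℕ} (u : Fin (i + 1) → κ) (P : ZPoly κ) :
    iterD s u P = iterD s (Fin.tail u) (pd (s (u 0)) P) := rfl

theorem iterD_cons (s : κ → κ ⊕ κ) {i : ℕ} (k : κ) (u : Fin i → κ) (P : ZPoly κ) :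
    iterD s (Fin.cons k u : Fin (i + 1) → κ) P = iterD s u (pd (s k) P) := by
  rw [iterD_succ, Fin.tail_cons, Fin.cons_zero]

theorem isHomogeneous_iterD (s : κ → κ ⊕ κ) {i : ℕ} (u : Fin i → κ) {P : ZPoly κ} {l : ℕ}
    (hP : P.IsHomogeneous l) : (iterD s u P).IsHomogeneous (l - i) := by
  induction i generalizing P l with
  | zero => simpa using hP
  | succ i ih =>
    rw [iterD_succ]
    convert ih (Fin.tail u) (isHomogeneous_pd hP (s (u 0))) using 1
    omega

theorem iterD_cj (s : κ → κ ⊕ κ) {i : ℕ} (u : Fin i → κ) (P : ZPoly κ) :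
    iterD s u (cj P) = cj (iterD (fun k => (s k).swap) u P) := by
  induction i generalizing P with
  | zero => simp
  | succ i ih => rw [iterD_succ, pd_cj, ih, iterD_succ]

theorem iterD_inl_cj {i : ℕ} (u : Fin i → κ) (P : ZPoly κ) :
    iterD Sum.inl u (cj P) = cj (iterD Sum.inr u P) := iterD_cj _ _ _

theorem iterD_inr_cj {i : ℕ} (u : Fin i → κ) (P : ZPoly κ) :
    iterD Sum.inr u (cj P) = cj (iterD Sum.inl u P) := iterD_cj _ _ _

theorem sum_fin_succ {M : Type*} [AddCommMonoid M] [Fintype κ] {i : ℕ}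
    (φ : (Fin (i + 1) → κ) → M) : ∑ u, φ u = ∑ k, ∑ u : Fin i → κ, φ (Fin.cons k u) := by
  rw [← (Fin.consEquiv fun _ => κ).sum_comp, Fintype.sum_prod_type]
  rfl

variable [Fintype κ]

theorem lap_pow_tmul (s : κ → κ ⊕ κ) (i : ℕ) (P Q : ZPoly κ) :
    (lap s ^ i) (P ⊗ₜ[ℂ] Q) =
      ∑ u : Fin i → κ, iterD s u P ⊗ₜ[ℂ] iterD (fun k => (s k).swap) u Q := by
  induction i generalizing P Q with
  | zero => simp
  | succ i ih =>
    rw [pow_succ, Module.End.mul_apply, lap_tmul, map_sum, sum_fin_succ]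
    simp only [ih, iterD_cons]

theorem lap_pow_mul_lap_pow_tmul (i j : ℕ) (P Q : ZPoly κ) :
    (lap Sum.inl ^ i) ((lap Sum.inr ^ j) (P ⊗ₜ[ℂ] Q)) =
      ∑ u : Fin i → κ, ∑ v : Fin j → κ, iterD Sum.inl u (iterD Sum.inr v P) ⊗ₜ[ℂ]
        iterD Sum.inr u (iterD Sum.inl v Q) := by
  rw [lap_pow_tmul, map_sum, Finset.sum_comm]
  refine Finset.sum_congr rfl fun v _ => ?_
  rw [lap_pow_tmul]
  rfl

theorem del_pow (r : ℕ) : (del (κ := κ)) ^ r = ∑ i ∈ Finset.range (r + 1),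
    (r.choose i : ℂ) • (lap Sum.inl ^ i * lap Sum.inr ^ (r - i)) := by
  rw [del, (lap_comm _ _).add_pow]
  refine Finset.sum_congr rfl fun i _ => ?_
  rw [Nat.cast_smul_eq_nsmul, nsmul_eq_mul, Nat.cast_comm]

/-- The contraction of two polynomials through `i` pairs `(∂_z, ∂_{z̄})` and `j` pairs
`(∂_{z̄}, ∂_z)`. -/
def contr₂ (i j : ℕ) (P Q : ZPoly κ) : ZPoly κ :=
  LinearMap.mul' ℂ _ ((lap Sum.inl ^ i) ((lap Sum.inr ^ j) (P ⊗ₜ[ℂ] Q)))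

theorem contr₂_eq (i j : ℕ) (P Q : ZPoly κ) : contr₂ i j P Q =
    ∑ u : Fin i → κ, ∑ v : Fin j → κ,
      iterD Sum.inl u (iterD Sum.inr v P) * iterD Sum.inr u (iterD Sum.inl v Q) := by
  simp [contr₂, lap_pow_mul_lap_pow_tmul, map_sum]

theorem contr_eq_sum (r : ℕ) (P Q : ZPoly κ) : contr r P Q =
    ∑ i ∈ Finset.range (r + 1), (r.choose i : ℂ) • contr₂ i (r - i) P Q := by
  simp [contr, del_pow, contr₂, LinearMap.sum_apply]

/-- The contraction through `r + 1` pairs, the first one of which belongs to `s`. -/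
def contrFirst (s : κ → κ ⊕ κ) (r : ℕ) (P Q : ZPoly κ) : ZPoly κ :=
  LinearMap.mul' ℂ _ ((del ^ r) (lap s (P ⊗ₜ[ℂ] Q)))

theorem contrFirst_inl (r : ℕ) (P Q : ZPoly κ) : contrFirst Sum.inl r P Q =
    ∑ i ∈ Finset.range (r + 1), (r.choose i : ℂ) • contr₂ (i + 1) (r - i) P Q := by
  rw [contrFirst, del_pow, LinearMap.sum_apply, map_sum]
  refine Finset.sum_congr rfl fun i _ => ?_
  rw [LinearMap.smul_apply, map_smul, contr₂, ← Module.End.mul_apply, mul_assoc,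
    ((lap_comm Sum.inr Sum.inl).pow_left _).eq, ← mul_assoc, ← pow_succ, Module.End.mul_apply]

theorem contrFirst_inr (r : ℕ) (P Q : ZPoly κ) : contrFirst Sum.inr r P Q =
    ∑ i ∈ Finset.range (r + 1), (r.choose i : ℂ) • contr₂ i (r - i + 1) P Q := by
  rw [contrFirst, del_pow, LinearMap.sum_apply, map_sum]
  refine Finset.sum_congr rfl fun i _ => ?_
  rw [LinearMap.smul_apply, map_smul, contr₂, ← Module.End.mul_apply, mul_assoc, ← pow_succ,
    Module.End.mul_apply]

theorem contrFirst_eq_sum (s : κ → κ ⊕ κ) (r : ℕ) (P Q : ZPoly κ) : contrFirst s r P Q =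
    ∑ k, contr r (pd (s k) P) (pd (s k).swap Q) := by
  simp only [contrFirst, lap_tmul, map_sum, contr]

end Iterated

/-! ### The norm of a product of homogeneous polynomials -/

section Product

variable {κ : Type*} [Fintype κ]

/-- Euler's identity for P expresses the operator through the derivatives of P, which have lower
degree, acting on derivatives of Q. -/
theorem isHomogeneous_bracket {P Q : ZPoly κ} {l l' : ℕ} (hP : P.IsHomogeneous l)
    (hQ : Q.IsHomogeneous l') : (bracket P Q).IsHomogeneous (l' - l) := by
  induction l generalizing P Q l' with
  | zero =>
    rw [eq_C_of_isHomogeneous_zero hP, bracket_C]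
    simpa using (isHomogeneous_C _ _).mul hQ
  | succ l ih =>
    have h : ((l + 1 : ℕ) : ℂ) • bracket P Q = ∑ t, bracket (pd t P) (pd t.swap Q) := by
      rw [← LinearMap.smul_apply, ← map_smul, ← sum_X_mul_pd hP, map_sum, LinearMap.sum_apply]
      simp only [bracket_X_mul]
    have h' : bracket P Q = C (((l + 1 : ℕ) : ℂ)⁻¹) *
        ∑ t, bracket (pd t P) (pd t.swap Q) := by
      rw [← h, ← smul_eq_C_mul, inv_smul_smul₀ (by exact_mod_cast l.succ_ne_zero)]
    rw [h', ← zero_add (l' - (l + 1))]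
    refine (isHomogeneous_C _ _).mul (IsHomogeneous.sum _ _ _ fun t _ => ?_)
    convert ih (isHomogeneous_pd hP t) (isHomogeneous_pd hQ t.swap) using 1
    omega

theorem bracket_one {P : ZPoly κ} {l : ℕ} (hP : P.IsHomogeneous l) (hl : l ≠ 0) :
    bracket P (1 : ZPoly κ) = 0 := by
  have h : (l : ℂ) • bracket P 1 = 0 := by
    rw [← LinearMap.smul_apply, ← map_smul, ← sum_X_mul_pd hP, map_sum, LinearMap.sum_apply]
    simp [bracket_X_mul, -map_mul]
  exact (smul_eq_zero.1 h).resolve_left (by exact_mod_cast hl)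

/-- The part of `‖P Q̄‖²` that comes from `i` derivatives `∂_{z̄}` and `j` derivatives `∂_z`. -/
def prodPart (i j : ℕ) (P Q : ZPoly κ) : ℝ :=
  ∑ u : Fin i → κ, ∑ v : Fin j → κ, nsq (bracket (iterD Sum.inr u (iterD Sum.inl v Q)) P)

namespace IsPosGaussianFunctional

variable {E : ZPoly κ →ₗ[ℂ] ℂ} (hE : IsPosGaussianFunctional E)
include hE

theorem prodPart_nonneg (i j : ℕ) (P Q : ZPoly κ) : 0 ≤ prodPart i j P Q :=
  Finset.sum_nonneg fun _ _ => Finset.sum_nonneg fun _ _ => hE.nsq_nonneg _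

/-- The factor Q̄ is transposed into a differential operator and the Leibniz rule is applied to P̄
Q. In each term a derivative R of Q̄ acts on P̄ while its conjugate multiplies; transposing that
conjugate back makes the term a squared norm. -/
theorem nsq_mul_cj {P Q : ZPoly κ} {l : ℕ} (hQ : Q.IsHomogeneous l) :
    nsq (P * cj Q) = ∑ r ∈ Finset.range (l + 1), ((r.factorial : ℝ)⁻¹) *
      ∑ i ∈ Finset.range (r + 1), (r.choose i : ℝ) * prodPart i (r - i) P Q := by
  have key (R : ZPoly κ) : pair P (bracket R (cj P) * cj R) = (nsq (bracket (cj R) P) : ℂ) := by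
    rw [hE.pair_comm, pair_mul_left, hE.pair_comm, ← hE.pair_self, ← bracket_cj, cj_cj]
  have h : pair (P * cj Q) (cj (P * cj Q)) =
      ((∑ r ∈ Finset.range (l + 1), ((r.factorial : ℝ)⁻¹) *
      ∑ i ∈ Finset.range (r + 1), (r.choose i : ℝ) * prodPart i (r - i) P Q : ℝ) : ℂ) := by
    rw [pair_mul_left, cj_mul, bracket_apply_mul (isHomogeneous_cj hQ), pair_sum_right]
    push_cast
    refine Finset.sum_congr rfl fun r _ => ?_
    rw [pair_smul_right, del_pow, LinearMap.sum_apply, map_sum, map_sum, pair_sum_right]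
    congr 1
    refine Finset.sum_congr rfl fun i _ => ?_
    rw [LinearMap.smul_apply, map_smul, map_smul, pair_smul_right, Module.End.mul_apply,
      lap_pow_mul_lap_pow_tmul]
    congr 1
    simp only [map_sum, pair_sum_right, prodPart, Complex.ofReal_sum]
    refine Finset.sum_congr rfl fun u _ => Finset.sum_congr rfl fun v _ => ?_
    rw [map_tmul, LinearMap.mul'_apply, LinearMap.id_apply, LinearMap.flip_apply,
      AlgHom.toLinearMap_apply, cj_cj]
    have := key (iterD Sum.inl u (iterD Sum.inr v (cj Q)))
    rwa [show cj (iterD Sum.inl u (iterD Sum.inr v (cj Q))) = iterD Sum.inr u (iterD Sum.inl v Q) by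
      rw [iterD_inr_cj, iterD_inl_cj, cj_cj]] at this
  rw [nsq, h, Complex.ofReal_re]

/-- `‖P Q̄‖² = |⟨P, Q⟩|² + ‖P‖² ‖Q‖² + …` with the nonnegative mixed terms. -/
theorem nsq_mul_cj_eq {P Q : ZPoly κ} {l : ℕ} (hl : l ≠ 0) (hP : P.IsHomogeneous l)
    (hQ : Q.IsHomogeneous l) : nsq (P * cj Q) = ‖pair Q P‖ ^ 2 + nsq P * nsq Q +
      ∑ r ∈ Finset.Ioo 0 l, ((r.factorial : ℝ)⁻¹) *
        ∑ i ∈ Finset.range (r + 1), (r.choose i : ℝ) * prodPart i (r - i) P Q := by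
  have h0 : prodPart 0 0 P Q = ‖pair Q P‖ ^ 2 := by
    have : (bracket Q P).IsHomogeneous 0 := by
      convert isHomogeneous_bracket hQ hP using 1; omega
    simp only [prodPart, iterD_zero, Finset.univ_unique, Finset.sum_singleton]
    rw [eq_C_of_isHomogeneous_zero this, nsq_C]
    rfl
  have hD {i j : ℕ} (u : Fin i → κ) (v : Fin j → κ) :
      (iterD Sum.inr u (iterD Sum.inl v Q)).IsHomogeneous (l - j - i) :=
    isHomogeneous_iterD _ _ (isHomogeneous_iterD _ _ hQ)
  have hlow {r i : ℕ} (hrl : r < l) (hi : i ≤ r) : prodPart i (r - i) 1 Q = 0 :=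
    Finset.sum_eq_zero fun u _ => Finset.sum_eq_zero fun v _ => by
      rw [bracket_one (hD u v) (by omega), nsq_zero]
  have htop {i : ℕ} (hi : i ≤ l) : prodPart i (l - i) P Q = nsq P * prodPart i (l - i) 1 Q := by
    simp only [prodPart, Finset.mul_sum]
    refine Finset.sum_congr rfl fun u _ => Finset.sum_congr rfl fun v _ => ?_
    have : (iterD Sum.inr u (iterD Sum.inl v Q)).IsHomogeneous 0 := by
      convert hD u v using 1; omega
    rw [eq_C_of_isHomogeneous_zero this, bracket_C, bracket_C, ← smul_eq_C_mul, nsq_smul, mul_one,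
      nsq_C, mul_comm]
  -- The same expansion with P = 1: an operator of positive order kills 1, so the top order alone
  -- expresses ‖Q‖². Multiplied by ‖P‖² it is the top order for general P.
  have hQ1 : nsq Q = ((l.factorial : ℝ)⁻¹) *
      ∑ i ∈ Finset.range (l + 1), (l.choose i : ℝ) * prodPart i (l - i) 1 Q := by
    have := hE.nsq_mul_cj (P := 1) hQ
    rw [one_mul, hE.nsq_cj] at this
    rw [this, Finset.sum_range_succ, Finset.sum_eq_zero, zero_add]
    intro r hr
    rw [Finset.sum_eq_zero, mul_zero]
    intro i hi
    rw [hlow (Finset.mem_range.1 hr) (Nat.lt_succ_iff.1 (Finset.mem_range.1 hi)), mul_zero]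
  have hPQ : nsq P * nsq Q = ((l.factorial : ℝ)⁻¹) *
      ∑ i ∈ Finset.range (l + 1), (l.choose i : ℝ) * prodPart i (l - i) P Q := by
    rw [hQ1, mul_left_comm, Finset.mul_sum]
    congr 1
    refine Finset.sum_congr rfl fun i hi => ?_
    rw [htop (Nat.lt_succ_iff.1 (Finset.mem_range.1 hi))]
    ring
  have hset : Finset.range (l + 1) = insert 0 (insert l (Finset.Ioo 0 l)) := by
    ext x; simp; omega
  rw [hE.nsq_mul_cj hQ, hset, Finset.sum_insert (by simp; omega), Finset.sum_insert (by simp), hPQ]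
  simp [h0]
  ring

theorem mixed_nonneg (P Q : ZPoly κ) (r : ℕ) : 0 ≤ ((r.factorial : ℝ)⁻¹) *
    ∑ i ∈ Finset.range (r + 1), (r.choose i : ℝ) * prodPart i (r - i) P Q :=
  mul_nonneg (by positivity) (Finset.sum_nonneg fun i _ =>
    mul_nonneg (by positivity) (hE.prodPart_nonneg _ _ _ _))

theorem add_le_nsq_mul_cj {P Q : ZPoly κ} {l : ℕ} (hl : l ≠ 0) (hP : P.IsHomogeneous l)
    (hQ : Q.IsHomogeneous l) : ‖pair Q P‖ ^ 2 + nsq P * nsq Q ≤ nsq (P * cj Q) := by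
  rw [hE.nsq_mul_cj_eq hl hP hQ]
  exact le_add_of_nonneg_right (Finset.sum_nonneg fun r _ => hE.mixed_nonneg P Q r)

theorem le_nsq_mul_cj {P Q : ZPoly κ} {l : ℕ} (hP : P.IsHomogeneous l) (hQ : Q.IsHomogeneous l)
    {r i : ℕ} (hr : 0 < r) (hrl : r < l) (hi : i ≤ r) :
    ‖pair Q P‖ ^ 2 + nsq P * nsq Q + (r.factorial : ℝ)⁻¹ * prodPart i (r - i) P Q ≤
      nsq (P * cj Q) := by
  have hmid : (r.factorial : ℝ)⁻¹ * prodPart i (r - i) P Q ≤ ((r.factorial : ℝ)⁻¹) *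
      ∑ i ∈ Finset.range (r + 1), (r.choose i : ℝ) * prodPart i (r - i) P Q := by
    refine mul_le_mul_of_nonneg_left ?_ (by positivity)
    have h1 := Finset.single_le_sum (f := fun i => (r.choose i : ℝ) * prodPart i (r - i) P Q)
      (s := Finset.range (r + 1))
      (fun i _ => mul_nonneg (by positivity) (hE.prodPart_nonneg _ _ _ _))
      (Finset.mem_range.2 (Nat.lt_succ_iff.2 hi))
    refine le_trans ?_ h1
    have h2 : (1 : ℝ) ≤ (r.choose i : ℝ) := by exact_mod_cast Nat.choose_pos hi
    nlinarith [hE.prodPart_nonneg i (r - i) P Q]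
  rw [hE.nsq_mul_cj_eq (by omega) hP hQ]
  have h := Finset.single_le_sum (fun r _ => hE.mixed_nonneg P Q r)
    (Finset.mem_Ioo.2 ⟨hr, hrl⟩)
  linarith

end IsPosGaussianFunctional

end Product

/-! ### Fourth cumulants -/

theorem IsPosGaussianFunctional.nsq_sum_choose_le {κ : Type*} {E : ZPoly κ →ₗ[ℂ] ℂ}
    (hE : IsPosGaussianFunctional E) {r N : ℕ} (hN : r + 1 ≤ N) (R : ℕ → ZPoly κ) {S : ℝ}
    (hR : ∀ i ≤ r, nsq (R i) ≤ S) :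
    nsq (∑ i ∈ Finset.range (r + 1), (r.choose i : ℂ) • R i) ≤ 2 ^ N * (N * (4 ^ N * S)) := by
  have hS : 0 ≤ S := (hE.nsq_nonneg _).trans (hR 0 (Nat.zero_le _))
  refine (hE.nsq_sum_le _ _).trans ?_
  rw [Finset.card_range]
  have h1 : ∑ i ∈ Finset.range (r + 1), nsq ((r.choose i : ℂ) • R i) ≤ N * (4 ^ N * S) := by
    calc _ ≤ ∑ i ∈ Finset.range (r + 1), 4 ^ N * S := by
          refine Finset.sum_le_sum fun i hi => ?_
          rw [nsq_smul, Complex.norm_natCast]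
          have h2 : (r.choose i : ℝ) ≤ 2 ^ N := by
            have h3 : r.choose i ≤ 2 ^ N :=
              (Nat.choose_le_two_pow r i).trans (Nat.pow_le_pow_right (by norm_num) (by omega))
            exact_mod_cast h3
          have h4 : (r.choose i : ℝ) ^ 2 ≤ 4 ^ N := by
            calc (r.choose i : ℝ) ^ 2 ≤ (2 ^ N) ^ 2 := by gcongr
              _ = 4 ^ N := by rw [← pow_mul, mul_comm, pow_mul]; norm_num
          exact mul_le_mul h4 (hR i (Nat.lt_succ_iff.1 (Finset.mem_range.1 hi)))
            (hE.nsq_nonneg _) (by positivity)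
      _ = (r + 1 : ℕ) * (4 ^ N * S) := by simp
      _ ≤ N * (4 ^ N * S) := by gcongr
  refine mul_le_mul ?_ h1 (Finset.sum_nonneg fun _ _ => hE.nsq_nonneg _) (by positivity)
  exact pow_le_pow_right₀ (by norm_num) hN

section Cumulant

variable {κ : Type*} [Fintype κ]

/-- The fourth cumulant `E|F|⁴ - 2 (E|F|²)² - |E F²|²` of the Wick polynomial `F = :P:`. -/
def cum4 (E : ZPoly κ →ₗ[ℂ] ℂ) (P : ZPoly κ) : ℝ :=
  (E (wick P * wick P * (wick (cj P) * wick (cj P)))).re - 2 * nsq P ^ 2 - ‖pair P P‖ ^ 2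

/-- The sum of the squared norms of the contractions of order `0 < r < l`. -/
def sumContr (l : ℕ) (P Q : ZPoly κ) : ℝ :=
  ∑ r ∈ Finset.Ioo 0 l, ∑ i ∈ Finset.range (r + 1), nsq (contr₂ i (r - i) P Q)

theorem isHomogeneous_contrFirst (s : κ → κ ⊕ κ) {P Q : ZPoly κ} {l : ℕ}
    (hP : P.IsHomogeneous l) (hQ : Q.IsHomogeneous l) (r : ℕ) :
    (contrFirst s r P Q).IsHomogeneous (2 * l - 2 * (r + 1)) := by
  rw [contrFirst_eq_sum]
  refine IsHomogeneous.sum _ _ _ fun k _ => ?_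
  convert isHomogeneous_contr (isHomogeneous_pd hP (s k)) (isHomogeneous_pd hQ (s k).swap) r using 1
  omega

namespace IsPosGaussianFunctional

variable {E : ZPoly κ →ₗ[ℂ] ℂ} (hE : IsPosGaussianFunctional E)
include hE

/-- Grouping as (FF)(F̄F̄) makes every order a square; only r = 0 and r = l are kept. -/
theorem re_map_wick_four_left {P : ZPoly κ} {l : ℕ} (hl : l ≠ 0) (hP : P.IsHomogeneous l) :
    nsq (P * P) + ‖pair P P‖ ^ 2 ≤ (E (wick P * wick P * (wick (cj P) * wick (cj P)))).re := by
  have hsub : ({0, l} : Finset ℕ) ⊆ Finset.range (l + 1) := by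
    intro x; simp; omega
  rw [hE.map_wick_four hP hP (isHomogeneous_cj hP) (isHomogeneous_cj hP), Complex.re_sum]
  have h (r : ℕ) : (((r.factorial : ℂ)⁻¹) ^ 2 * pair (contr r P P) (contr r (cj P) (cj P))).re =
      ((r.factorial : ℝ)⁻¹) ^ 2 * nsq (contr r P P) := by
    rw [contr_cj, hE.pair_self, show ((r.factorial : ℂ)⁻¹) ^ 2 = (((r.factorial : ℝ)⁻¹ ^ 2 : ℝ) : ℂ)
      by push_cast; rfl, Complex.re_ofReal_mul, Complex.ofReal_re]
  simp only [h]
  refine le_trans ?_ (Finset.sum_le_sum_of_subset_of_nonneg hsub fun r _ _ =>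
    mul_nonneg (by positivity) (hE.nsq_nonneg _))
  rw [Finset.sum_pair hl.symm, hE.map_wick_mul_wick_eq hP hP, nsq_C, norm_mul, hE.map_wick_mul_wick,
    mul_pow, contr_zero, Complex.norm_natCast]
  have : (l.factorial : ℝ) ≠ 0 := by exact_mod_cast l.factorial_ne_zero
  field_simp
  simp

/-- Grouping as (FF̄)(FF̄): the contractions of P with P̄ equal their own conjugates, so every order
is again a square. The orders r = 0 and r = l are kept. -/
theorem re_map_wick_four_right {P : ZPoly κ} {l : ℕ} (hl : l ≠ 0) (hP : P.IsHomogeneous l) :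
    nsq (P * cj P) + nsq P ^ 2 ≤ (E (wick P * wick P * (wick (cj P) * wick (cj P)))).re := by
  have hsub : ({0, l} : Finset ℕ) ⊆ Finset.range (l + 1) := by
    intro x; simp; omega
  rw [mul_mul_mul_comm, hE.map_wick_four hP (isHomogeneous_cj hP) hP (isHomogeneous_cj hP),
    Complex.re_sum]
  have hc (r : ℕ) : contr r P (cj P) = cj (contr r P (cj P)) := by
    rw [← contr_cj, cj_cj, contr_comm]
  have h (r : ℕ) : (((r.factorial : ℂ)⁻¹) ^ 2 * pair (contr r P (cj P)) (contr r P (cj P))).re =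
      ((r.factorial : ℝ)⁻¹) ^ 2 * nsq (contr r P (cj P)) := by
    nth_rw 2 [hc]
    rw [hE.pair_self, show ((r.factorial : ℂ)⁻¹) ^ 2 = (((r.factorial : ℝ)⁻¹ ^ 2 : ℝ) : ℂ)
      by push_cast; rfl, Complex.re_ofReal_mul, Complex.ofReal_re]
  simp only [h]
  refine le_trans ?_ (Finset.sum_le_sum_of_subset_of_nonneg hsub fun r _ _ =>
    mul_nonneg (by positivity) (hE.nsq_nonneg _))
  rw [Finset.sum_pair hl.symm, hE.map_wick_mul_wick_eq hP (isHomogeneous_cj hP), nsq_C, norm_mul,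
    hE.map_wick_mul_wick, hE.pair_self, mul_pow, contr_zero, Complex.norm_natCast,
    Complex.norm_real, Real.norm_eq_abs, sq_abs]
  have : (l.factorial : ℝ) ≠ 0 := by exact_mod_cast l.factorial_ne_zero
  field_simp
  simp

theorem cum4_nonneg {P : ZPoly κ} {l : ℕ} (hl : l ≠ 0) (hP : P.IsHomogeneous l) :
    0 ≤ cum4 E P := by
  have h1 := hE.re_map_wick_four_right hl hP
  have h2 := hE.add_le_nsq_mul_cj hl hP hP
  rw [cum4]
  linarith

/-- With Q = P̄ the product is P² and its two leading terms add up to 2‖P‖⁴; the order l supplies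
|⟨P,P⟩|². Together they cancel what the cumulant subtracts. -/
theorem prodPart_cj_le_cum4 {P : ZPoly κ} {l r i : ℕ} (hP : P.IsHomogeneous l)
    (hr : 0 < r) (hrl : r < l) (hi : i ≤ r) :
    (r.factorial : ℝ)⁻¹ * prodPart i (r - i) P (cj P) ≤ cum4 E P := by
  have h1 := hE.re_map_wick_four_left (by omega) hP
  have h2 := hE.le_nsq_mul_cj hP (isHomogeneous_cj hP) hr hrl hi
  rw [hE.nsq_cj, hE.pair_comm, hE.pair_self, cj_cj, Complex.norm_real, Real.norm_eq_abs,
    sq_abs] at h2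
  rw [cum4]
  linarith

/-- With Q = P the leading terms are |⟨P,P⟩|² + ‖P‖⁴, and the order l supplies the second ‖P‖⁴. -/
theorem prodPart_le_cum4 {P : ZPoly κ} {l r i : ℕ} (hP : P.IsHomogeneous l)
    (hr : 0 < r) (hrl : r < l) (hi : i ≤ r) :
    (r.factorial : ℝ)⁻¹ * prodPart i (r - i) P P ≤ cum4 E P := by
  have h1 := hE.re_map_wick_four_right (by omega) hP
  have h2 := hE.le_nsq_mul_cj hP hP hr hrl hi
  rw [cum4]
  linarith

theorem sumContr_nonneg (l : ℕ) (P Q : ZPoly κ) : 0 ≤ sumContr l P Q :=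
  Finset.sum_nonneg fun _ _ => Finset.sum_nonneg fun _ _ => hE.nsq_nonneg _

theorem nsq_contr₂_le {l i j : ℕ} (P Q : ZPoly κ) (h0 : 0 < i + j) (hl : i + j < l) :
    nsq (contr₂ i j P Q) ≤ sumContr l P Q := by
  have h1 := Finset.single_le_sum
    (f := fun r => ∑ i ∈ Finset.range (r + 1), nsq (contr₂ i (r - i) P Q))
    (fun r _ => Finset.sum_nonneg fun _ _ => hE.nsq_nonneg _)
    (Finset.mem_Ioo.2 ⟨h0, hl⟩)
  have h2 := Finset.single_le_sum (f := fun i' => nsq (contr₂ i' (i + j - i') P Q))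
    (s := Finset.range (i + j + 1)) (fun r _ => hE.nsq_nonneg _)
    (Finset.mem_range.2 (show i < i + j + 1 by omega))
  simp only [Nat.add_sub_cancel_left] at h2
  exact h2.trans h1

theorem nsq_contr_le {l r : ℕ} (P Q : ZPoly κ) (h0 : 0 < r) (hl : r < l) :
    nsq (contr r P Q) ≤ 2 ^ l * (l * (4 ^ l * sumContr l P Q)) := by
  rw [contr_eq_sum]
  exact hE.nsq_sum_choose_le (by omega) _ fun i hi =>
    hE.nsq_contr₂_le P Q (by omega) (by omega)

theorem nsq_contrFirst_le {l r : ℕ} {s : κ → κ ⊕ κ} (hs : s = Sum.inl ∨ s = Sum.inr)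
    (P Q : ZPoly κ) (hl : r + 1 < l) :
    nsq (contrFirst s r P Q) ≤ 2 ^ l * (l * (4 ^ l * sumContr l P Q)) := by
  rcases hs with rfl | rfl
  · rw [contrFirst_inl]
    exact hE.nsq_sum_choose_le (by omega) _ fun i hi =>
      hE.nsq_contr₂_le P Q (by omega) (by omega)
  · rw [contrFirst_inr]
    exact hE.nsq_sum_choose_le (by omega) _ fun i hi =>
      hE.nsq_contr₂_le P Q (by omega) (by omega)

end IsPosGaussianFunctional

/-- The Wick polynomials `:P:` and `:Q:` contracted once through the variables `s`. -/
def wickGrad (s : κ → κ ⊕ κ) (P Q : ZPoly κ) : ZPoly κ :=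
  ∑ k, wick (pd (s k) P) * wick (pd (s k).swap Q)

theorem wickGrad_eq (s : κ → κ ⊕ κ) {P : ZPoly κ} {l : ℕ} (hP : P.IsHomogeneous (l + 1))
    (Q : ZPoly κ) : wickGrad s P Q =
      ∑ r ∈ Finset.range (l + 1), ((r.factorial : ℂ)⁻¹) • wick (contrFirst s r P Q) := by
  have (k : κ) : wick (pd (s k) P) * wick (pd (s k).swap Q) = ∑ r ∈ Finset.range (l + 1),
      ((r.factorial : ℂ)⁻¹) • wick (contr r (pd (s k) P) (pd (s k).swap Q)) :=
    wick_mul_wick (isHomogeneous_pd hP (s k)) _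
  simp only [wickGrad, this, contrFirst_eq_sum, map_sum, Finset.smul_sum]
  exact Finset.sum_comm

namespace IsGaussianFunctional

variable {E : ZPoly κ →ₗ[ℂ] ℂ} (hE : IsGaussianFunctional E)
include hE

/-- The hypothesis `hd` says that P has degree d in the variables selected by s; it lets a single
contraction through these variables recover d times the full one. -/
theorem map_wickGrad {s : κ → κ ⊕ κ} {P : ZPoly κ} {d : ℂ}
    (hd : ∑ k, X (s k) * pd (s k) P = d • P) (Q : ZPoly κ) :
    E (wickGrad s P Q) = d * E (wick P * wick Q) := by
  rw [← smul_eq_mul, ← map_smul, ← smul_mul_assoc, ← map_smul, ← hd, map_sum, Finset.sum_mul,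
    map_sum, wickGrad, map_sum]
  refine Finset.sum_congr rfl fun k _ => ?_
  rw [hE.map_wick_X_mul, pd_wick]

/-- P is replaced by its Euler sum over the selected variables; after integration by parts the
derivative falls on each of the other three factors in turn. -/
theorem map_wick_four_eq_wickGrad {s : κ → κ ⊕ κ} {P : ZPoly κ} {d : ℂ}
    (hd : ∑ k, X (s k) * pd (s k) P = d • P) (Q R S : ZPoly κ) :
    d * E (wick P * wick Q * (wick R * wick S)) =
      E (wickGrad s P Q * (wick R * wick S)) + E (wickGrad s P R * (wick Q * wick S)) +
        E (wickGrad s P S * (wick Q * wick R)) := by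
  rw [← smul_eq_mul, ← map_smul, mul_assoc, ← smul_mul_assoc, ← map_smul, ← hd, map_sum,
    Finset.sum_mul, map_sum]
  simp only [wickGrad, Finset.sum_mul, map_sum]
  rw [← Finset.sum_add_distrib, ← Finset.sum_add_distrib]
  refine Finset.sum_congr rfl fun k _ => ?_
  rw [hE.map_wick_X_mul, pd_mul, pd_mul, pd_wick, pd_wick, pd_wick, ← map_add, ← map_add]
  congr 1
  ring

/-- The order r = l is a full contraction and hence a constant; it contributes the product of second
moments. All other orders are genuine contractions. -/
theorem map_wickGrad_mul {s : κ → κ ⊕ κ} {P Q R S : ZPoly κ} {l : ℕ} {d : ℂ}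
    (hd : ∑ k, X (s k) * pd (s k) P = d • P) (hP : P.IsHomogeneous (l + 1))
    (hQ : Q.IsHomogeneous (l + 1)) (hR : R.IsHomogeneous (l + 1)) (hS : S.IsHomogeneous (l + 1)) :
    E (wickGrad s P Q * (wick R * wick S)) =
      d * E (wick P * wick Q) * E (wick R * wick S) + ∑ r ∈ Finset.range l,
        (((r.factorial : ℂ)⁻¹) * (((r + 1).factorial : ℂ)⁻¹)) *
          pair (contrFirst s r P Q) (contr (r + 1) R S) := by
  have hA (r : ℕ) := isHomogeneous_contrFirst s hP hQ r
  have hB (r : ℕ) := isHomogeneous_contr hR hS r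
  have h1 : E (wickGrad s P Q * (wick R * wick S)) = ∑ r ∈ Finset.range (l + 1),
        (((r.factorial : ℂ)⁻¹) * (((r + 1).factorial : ℂ)⁻¹)) *
          pair (contrFirst s r P Q) (contr (r + 1) R S) := by
    rw [wickGrad_eq s hP, wick_mul_wick hR, Finset.sum_mul_sum, map_sum]
    refine Finset.sum_congr rfl fun r hr => ?_
    have hr := Finset.mem_range.1 hr
    -- One pair has already been contracted by the gradient, so its order r has the degree of the
    -- order r + 1 of the other product.
    rw [map_sum, Finset.sum_eq_single (r + 1)]
    · rw [smul_mul_smul_comm, map_smul, hE.map_wick_mul_wick, smul_eq_mul]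
    · intro r' hr' hrr
      have hr' := Finset.mem_range.1 hr'
      rw [smul_mul_smul_comm, map_smul, hE.map_wick_mul_wick, hE.pair_eq_zero (hA r) (hB r'),
        smul_zero]
      omega
    · exact fun h => absurd (Finset.mem_range.2 (by omega)) h
  have h2 : (l.factorial : ℂ)⁻¹ * constantCoeff (contrFirst s l P Q) =
      d * E (wick P * wick Q) := by
    rw [← hE.map_wickGrad hd, wickGrad_eq s hP, map_sum, Finset.sum_eq_single l]
    · rw [map_smul, hE.map_wick, smul_eq_mul]
    · intro r hr hrl
      have hr := Finset.mem_range.1 hr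
      rw [map_smul, hE.map_wick, constantCoeff_eq_zero (hA r) (by omega), smul_zero]
    · simp
  have h3 : (contrFirst s l P Q).IsHomogeneous 0 := by
    convert hA l using 1; omega
  rw [h1, Finset.sum_range_succ, add_comm, hE.map_wick_mul_wick_eq hR hS,
    eq_C_of_isHomogeneous_zero h3, pair_C_left, constantCoeff_C, ← h2]
  congr 1
  have : ((l + 1).factorial : ℂ) ≠ 0 := by exact_mod_cast (l + 1).factorial_ne_zero
  field_simp

end IsGaussianFunctional

namespace IsPosGaussianFunctional

variable {E : ZPoly κ →ₗ[ℂ] ℂ} (hE : IsPosGaussianFunctional E)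
include hE

/-- The l remaining pairings involve contractions of orders strictly between 0 and l + 1; each is
bounded by half the sum of two squared norms. -/
theorem abs_re_map_wickGrad_sub_le {s : κ → κ ⊕ κ} (hs : s = Sum.inl ∨ s = Sum.inr)
    {P Q : ZPoly κ} {l : ℕ} {d : ℂ}
    (hd : ∑ k, X (s k) * pd (s k) P = d • P) (hP : P.IsHomogeneous (l + 1))
    (hQ : Q.IsHomogeneous (l + 1)) :
    |(E (wickGrad s P Q * (wick (cj P) * wick (cj Q))) -
      d * E (wick P * wick Q) * E (wick (cj P) * wick (cj Q))).re| ≤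
      l * (2 ^ (l + 1) * ((l + 1 : ℕ) * (4 ^ (l + 1) * sumContr (l + 1) P Q))) := by
  rw [hE.map_wickGrad_mul hd hP hQ (isHomogeneous_cj hP) (isHomogeneous_cj hQ),
    add_sub_cancel_left, Complex.re_sum]
  refine (Finset.abs_sum_le_sum_abs _ _).trans ?_
  refine (Finset.sum_le_card_nsmul _ _ _ fun r hr => ?_).trans_eq
    (by rw [Finset.card_range, nsmul_eq_mul])
  have hr := Finset.mem_range.1 hr
  have h1 : (((r.factorial : ℂ)⁻¹) * (((r + 1).factorial : ℂ)⁻¹)) =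
      (((r.factorial : ℝ)⁻¹ * ((r + 1).factorial : ℝ)⁻¹ : ℝ) : ℂ) := by push_cast; rfl
  rw [h1, Complex.re_ofReal_mul, abs_mul, contr_cj]
  have h2 := hE.two_re_pair_le (contrFirst s r P Q) (contr (r + 1) P Q)
  have h3 := hE.nsq_contrFirst_le hs P Q (show r + 1 < l + 1 by omega)
  have h4 := hE.nsq_contr_le P Q (Nat.succ_pos r) (show r + 1 < l + 1 by omega)
  have h5 : |(r.factorial : ℝ)⁻¹ * ((r + 1).factorial : ℝ)⁻¹| ≤ 1 := by
    rw [abs_of_nonneg (by positivity)]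
    refine mul_le_one₀ (inv_le_one_of_one_le₀ ?_) (by positivity) (inv_le_one_of_one_le₀ ?_)
    · exact_mod_cast r.factorial_pos
    · exact_mod_cast (r + 1).factorial_pos
  calc _ ≤ 1 * |(pair (contrFirst s r P Q) (cj (contr (r + 1) P Q))).re| := by gcongr
    _ ≤ _ := by linarith

end IsPosGaussianFunctional

/-- To be read with M = E|F|⁴, a = (E|F|²)², b = |E F²|²; x and y are the gradient terms of F with F
and of F with F̄, and T, S their error sums. The weight m ≥ 1 is divided out. -/
theorem le_of_weighted_eq {m M x y a b B S T : ℝ} (hm : 1 ≤ m) (hB : 0 ≤ B) (hS : 0 ≤ S)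
    (hT : 0 ≤ T) (h : m * M = x + 2 * y) (hx : |x - m * b| ≤ B * T) (hy : |y - m * a| ≤ B * S) :
    M - 2 * a - b ≤ 4 * B * (S + T) := by
  have hx := (abs_le.1 hx).2
  have hy := (abs_le.1 hy).2
  have h1 : 0 ≤ B * S := mul_nonneg hB hS
  have h2 : 0 ≤ B * T := mul_nonneg hB hT
  have h3 : 4 * B * (S + T) ≤ m * (4 * B * (S + T)) :=
    le_mul_of_one_le_left (by positivity) hm
  have h4 : m * (M - 2 * a - b) ≤ m * (4 * B * (S + T)) := by linarith
  exact le_of_mul_le_mul_left h4 (by linarith)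

/-- The difference of the identities for the two degrees m and n, from which the gradient term of F
with F has disappeared; each of the two errors enters twice. -/
theorem le_of_weighted_sub_eq {m n M y z a B S : ℝ} (hmn : 1 ≤ |m - n|)
    (h : (m - n) * M = 2 * (y - z)) (hy : |y - m * a| ≤ B * S) (hz : |z - n * a| ≤ B * S) :
    M - 2 * a ≤ 4 * B * S := by
  have hy := abs_le.1 hy
  have hz := abs_le.1 hz
  have h7 : |(m - n) * (M - 2 * a)| ≤ 4 * B * S := by
    rw [abs_le]
    constructor <;> linarith [hy.1, hy.2, hz.1, hz.2]
  rw [abs_mul] at h7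
  exact (le_abs_self _).trans ((le_mul_of_one_le_left (abs_nonneg _) hmn).trans h7)

/-- The constant in the upper bound for the fourth cumulant. -/
def cumConst (l : ℕ) : ℝ := l * (2 ^ (l + 1) * ((l + 1 : ℕ) * 4 ^ (l + 1)))

theorem cumConst_nonneg (l : ℕ) : 0 ≤ cumConst l := by unfold cumConst; positivity

namespace IsPosGaussianFunctional

variable {E : ZPoly κ →ₗ[ℂ] ℂ} (hE : IsPosGaussianFunctional E)
include hE

theorem abs_re_map_wickGrad_self_sub_le {s : κ → κ ⊕ κ} (hs : s = Sum.inl ∨ s = Sum.inr)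
    {P : ZPoly κ} {l d : ℕ}
    (hd : ∑ k, X (s k) * pd (s k) P = (d : ℂ) • P) (hP : P.IsHomogeneous (l + 1)) :
    |(E (wickGrad s P P * (wick (cj P) * wick (cj P)))).re - d * ‖pair P P‖ ^ 2| ≤
      cumConst l * sumContr (l + 1) P P := by
  have h := hE.abs_re_map_wickGrad_sub_le hs hd hP hP
  rw [hE.map_wick_mul_wick, hE.map_wick_mul_wick, pair_cj, mul_assoc, Complex.mul_conj,
    Complex.normSq_eq_norm_sq, Complex.sub_re, ← Complex.ofReal_natCast, Complex.re_ofReal_mul,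
    Complex.ofReal_re] at h
  rw [cumConst]
  exact h.trans_eq (by ring)

theorem abs_re_map_wickGrad_cj_sub_le {s : κ → κ ⊕ κ} (hs : s = Sum.inl ∨ s = Sum.inr)
    {P : ZPoly κ} {l d : ℕ}
    (hd : ∑ k, X (s k) * pd (s k) P = (d : ℂ) • P) (hP : P.IsHomogeneous (l + 1)) :
    |(E (wickGrad s P (cj P) * (wick (cj P) * wick P))).re - d * nsq P ^ 2| ≤
      cumConst l * sumContr (l + 1) P (cj P) := by
  have h := hE.abs_re_map_wickGrad_sub_le hs hd hP (isHomogeneous_cj hP)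
  rw [cj_cj, mul_comm (wick (cj P)) (wick P), hE.map_wick_mul_wick, hE.pair_self, mul_assoc,
    ← Complex.ofReal_mul, Complex.sub_re, ← Complex.ofReal_natCast,
    Complex.re_ofReal_mul, Complex.ofReal_re, ← sq] at h
  rw [cumConst, mul_comm (wick (cj P)) (wick P)]
  exact h.trans_eq (by ring)

theorem natCast_mul_re_map_wick_four {s : κ → κ ⊕ κ} {P : ZPoly κ} {d : ℕ}
    (hd : ∑ k, X (s k) * pd (s k) P = (d : ℂ) • P) :
    (d : ℝ) * (E (wick P * wick P * (wick (cj P) * wick (cj P)))).re =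
      (E (wickGrad s P P * (wick (cj P) * wick (cj P)))).re +
        2 * (E (wickGrad s P (cj P) * (wick (cj P) * wick P))).re := by
  have h := congrArg Complex.re (hE.map_wick_four_eq_wickGrad hd P (cj P) (cj P))
  rw [mul_comm (wick P) (wick (cj P)), ← Complex.ofReal_natCast, Complex.re_ofReal_mul,
    Complex.add_re, Complex.add_re] at h
  rw [h]
  ring

/-- Counts the holomorphic variables only. Self-contractions of all orders below l + 1 enter, which
is acceptable for kernels with equal degrees, where l' = l. -/
theorem cum4_le_of_eq {m l : ℕ} (hm1 : 1 ≤ m) {P : ZPoly κ} (hP : P.IsHomogeneous (l + 1))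
    (hm : ∑ k, X (Sum.inl k) * pd (Sum.inl k) P = (m : ℂ) • P) :
    cum4 E P ≤ 4 * cumConst l * (sumContr (l + 1) P (cj P) + sumContr (l + 1) P P) :=
  le_of_weighted_eq (by exact_mod_cast hm1) (cumConst_nonneg l) (hE.sumContr_nonneg _ _ _)
    (hE.sumContr_nonneg _ _ _) (hE.natCast_mul_re_map_wick_four hm)
    (hE.abs_re_map_wickGrad_self_sub_le (Or.inl rfl) hm hP)
    (hE.abs_re_map_wickGrad_cj_sub_le (Or.inl rfl) hm hP)

/-- The gradient of F with F is the same for the holomorphic and the antiholomorphic variables,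
because exchanging the two factors exchanges the variables. Subtracting the two identities removes
it. The same comparison gives m⟨P,P⟩ = n⟨P,P⟩, so E F² = 0. -/
theorem cum4_le_of_ne {m n l : ℕ} (hmn : m ≠ n) {P : ZPoly κ} (hP : P.IsHomogeneous (l + 1))
    (hm : ∑ k, X (Sum.inl k) * pd (Sum.inl k) P = (m : ℂ) • P)
    (hn : ∑ k, X (Sum.inr k) * pd (Sum.inr k) P = (n : ℂ) • P) :
    cum4 E P ≤ 4 * cumConst l * sumContr (l + 1) P (cj P) := by
  have hg : wickGrad Sum.inl P P = wickGrad Sum.inr P P := by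
    refine Finset.sum_congr rfl fun k _ => ?_
    rw [mul_comm]; rfl
  have h0 : pair P P = 0 := by
    have h2 := hE.map_wickGrad hm P
    rw [hg, hE.map_wickGrad hn, hE.map_wick_mul_wick] at h2
    have h3 : ((n : ℂ) - m) * pair P P = 0 := by rw [sub_mul, h2, sub_self]
    refine (mul_eq_zero.1 h3).resolve_left (sub_ne_zero.2 ?_)
    exact_mod_cast Ne.symm hmn
  have h1 : 1 ≤ |(m : ℝ) - n| := by
    have h1 : (1 : ℤ) ≤ |(m : ℤ) - n| := Int.one_le_abs (by omega)
    exact_mod_cast h1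
  have h2 := hE.natCast_mul_re_map_wick_four hm
  have h3 := hE.natCast_mul_re_map_wick_four hn
  rw [hg] at h2
  have h4 := le_of_weighted_sub_eq h1 (by rw [sub_mul, h2, h3]; ring)
    (hE.abs_re_map_wickGrad_cj_sub_le (Or.inl rfl) hm hP)
    (hE.abs_re_map_wickGrad_cj_sub_le (Or.inr rfl) hn hP)
  rw [cum4, h0]
  simpa using h4

end IsPosGaussianFunctional

end Cumulant

/-! ### Symmetric functions of tuples -/

section SymmFun

variable {κ : Type*}

/-- Invariance of a function of tuples under permutations of the indices. -/
def SymmFun {M : Type*} {a : ℕ} (c : (Fin a → κ) → M) : Prop :=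
  ∀ (π : Equiv.Perm (Fin a)) (α : Fin a → κ), c (α ∘ π) = c α

theorem SymmFun.cons {M : Type*} {a : ℕ} {c : (Fin (a + 1) → κ) → M} (hc : SymmFun c) (k : κ) :
    SymmFun fun α : Fin a → κ => c (Fin.cons k α) := by
  intro π α
  -- The permutation that fixes the first position and acts by π on the others.
  refine Eq.trans ?_ (hc (Equiv.Perm.decomposeFin.symm (0, π)) (Fin.cons k α))
  refine congrArg c (funext fun x => ?_)
  refine Fin.cases ?_ (fun x => ?_) x <;> simp

theorem SymmFun.cons_cons {M : Type*} {a : ℕ} {c : (Fin (a + 2) → κ) → M} (hc : SymmFun c)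
    (k l : κ) (α : Fin a → κ) :
    c (Fin.cons k (Fin.cons l α : Fin (a + 1) → κ)) =
      c (Fin.cons l (Fin.cons k α : Fin (a + 1) → κ)) := by
  rw [← hc (Equiv.swap 0 1) (Fin.cons l _)]
  congr 1
  funext x
  refine Fin.cases (by simp) (fun x => Fin.cases (by simp) (fun x => ?_) x) x
  rw [Function.comp_apply, Equiv.swap_apply_of_ne_of_ne (by simp [Fin.ext_iff])
    (by simp [Fin.ext_iff])]
  simp

/-- How the free and the contracted indices are interleaved is irrelevant to a symmetric function;
this reconciles the different conventions for concatenation. -/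
theorem SymmFun.elim_comp {M : Type*} {a a' i : ℕ} {c : (Fin a → κ) → M} (hc : SymmFun c)
    (e e' : Fin a ≃ Fin a' ⊕ Fin i) (t : Fin a' → κ) (u : Fin i → κ) :
    c (Sum.elim t u ∘ e) = c (Sum.elim t u ∘ e') := by
  rw [← hc (e.trans e'.symm) (Sum.elim t u ∘ e')]
  congr 1
  funext x
  simp

theorem append_eq_elim {a i : ℕ} (t : Fin a → κ) (u : Fin i → κ) :
    Fin.append t u = Sum.elim t u ∘ finSumFinEquiv.symm := by
  funext x
  refine Fin.addCases (fun y => ?_) (fun y => ?_) x <;> simp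

theorem join_eq_elim {a i : ℕ} (hi : i ≤ a) (t : Fin (a - i) → κ) (u : Fin i → κ) :
    join hi t u = Sum.elim t u ∘
      (finSumFinEquiv.trans (finCongr (Nat.sub_add_cancel hi))).symm := by
  rw [join, append_eq_elim]; rfl

theorem append_comp_cast_eq_elim {a a' i : ℕ} (h : i + a' = a) (t : Fin a' → κ)
    (u : Fin i → κ) : Fin.append u t ∘ Fin.cast h.symm = Sum.elim t u ∘
      ((Equiv.sumComm _ _).trans (finSumFinEquiv.trans (finCongr h))).symm := by
  subst h
  rw [append_eq_elim]
  funext x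
  refine Fin.addCases (fun y => ?_) (fun y => ?_) x <;> simp

theorem SymmFun.append_eq_join {M : Type*} {a i : ℕ} {c : (Fin a → κ) → M} (hc : SymmFun c)
    (hi : i ≤ a) (h : i + (a - i) = a) (t : Fin (a - i) → κ) (u : Fin i → κ) :
    c (Fin.append u t ∘ Fin.cast h.symm) = c (join hi t u) := by
  rw [append_comp_cast_eq_elim h, join_eq_elim]
  exact hc.elim_comp _ _ _ _

theorem SymmFun.join_left {M : Type*} {a i : ℕ} {c : (Fin a → κ) → M} (hc : SymmFun c)
    (hi : i ≤ a) (u : Fin i → κ) : SymmFun fun t => c (join hi t u) := by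
  intro π t
  have : Sum.elim (t ∘ π) u = Sum.elim t u ∘ (Equiv.sumCongr π (Equiv.refl _)) := by
    funext x; cases x <;> rfl
  simp only [join_eq_elim, this, Function.comp_assoc, ← Equiv.coe_trans]
  exact hc.elim_comp _ _ _ _

theorem SymmFun.join_right {M : Type*} {a i : ℕ} {c : (Fin a → κ) → M} (hc : SymmFun c)
    (hi : i ≤ a) (t : Fin (a - i) → κ) : SymmFun fun u => c (join hi t u) := by
  intro π u
  have : Sum.elim t (u ∘ π) = Sum.elim t u ∘ (Equiv.sumCongr (Equiv.refl _) π) := by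
    funext x; cases x <;> rfl
  simp only [join_eq_elim, this, Function.comp_assoc, ← Equiv.coe_trans]
  exact hc.elim_comp _ _ _ _

end SymmFun

/-! ### The polynomial of a kernel -/

section KernelPolynomial

variable {κ : Type*}

/-- The product of the variables `X (s (α p))`. -/
def mon (s : κ → κ ⊕ κ) {a : ℕ} (α : Fin a → κ) : ZPoly κ := ∏ p, X (s (α p))

theorem mon_cons (s : κ → κ ⊕ κ) {a : ℕ} (k : κ) (α : Fin a → κ) :
    mon s (Fin.cons k α : Fin (a + 1) → κ) = X (s k) * mon s α := by
  simp [mon, Fin.prod_univ_succ]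

theorem mon_append (s : κ → κ ⊕ κ) {a b : ℕ} (α : Fin a → κ) (β : Fin b → κ) :
    mon s (Fin.append α β) = mon s α * mon s β := by
  simp [mon, Fin.prod_univ_add]

theorem mon_comp_perm (s : κ → κ ⊕ κ) {a : ℕ} (α : Fin a → κ) (π : Equiv.Perm (Fin a)) :
    mon s (α ∘ π) = mon s α :=
  Equiv.prod_comp π fun p => (X (s (α p)) : ZPoly κ)

theorem isHomogeneous_mon (s : κ → κ ⊕ κ) {a : ℕ} (α : Fin a → κ) :
    (mon s α).IsHomogeneous a := by
  have := IsHomogeneous.prod Finset.univ (fun p => (X (s (α p)) : ZPoly κ)) (fun _ => 1)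
    fun p _ => isHomogeneous_X _ _
  simpa [mon] using this

theorem cj_mon (s : κ → κ ⊕ κ) {a : ℕ} (α : Fin a → κ) :
    cj (mon s α) = mon (fun k => (s k).swap) α := by
  simp [mon]

theorem pd_mon_of_ne {s s' : κ → κ ⊕ κ} (h : ∀ k l, s k ≠ s' l) (k : κ) {a : ℕ} (α : Fin a → κ) :
    pd (s k) (mon s' α) = 0 := by
  induction a with
  | zero => simp [mon]
  | succ a ih =>
    rw [← Fin.cons_self_tail α, mon_cons, pd_X_mul, ih, if_neg (h _ _)]
    simp

theorem bracket_mon {s s' : κ → κ ⊕ κ} (h : ∀ k, (s k).swap = s' k) {a : ℕ} (α : Fin a → κ)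
    (Q : ZPoly κ) : bracket (mon s α) Q = iterD s' α Q := by
  induction a generalizing Q with
  | zero => simp [mon]
  | succ a ih =>
    rw [iterD_succ, ← ih, ← h, ← bracket_X_mul, ← mon_cons, Fin.cons_self_tail]

/-- Symmetry in both groups of indices. -/
def SymmFun₂ {a b : ℕ} (φ : (Fin a → κ) → (Fin b → κ) → ℂ) : Prop :=
  ∀ (π : Equiv.Perm (Fin a)) (σ : Equiv.Perm (Fin b)) α β, φ (α ∘ π) (β ∘ σ) = φ α β

theorem SymmFun₂.left {a b : ℕ} {φ : (Fin a → κ) → (Fin b → κ) → ℂ} (hφ : SymmFun₂ φ)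
    (β : Fin b → κ) : SymmFun fun α => φ α β := fun π α => hφ π 1 α β

theorem SymmFun₂.right {a b : ℕ} {φ : (Fin a → κ) → (Fin b → κ) → ℂ} (hφ : SymmFun₂ φ)
    (α : Fin a → κ) : SymmFun fun β => φ α β := fun σ β => hφ 1 σ α β

theorem SymmFun₂.join_right {a b : ℕ} {φ : (Fin a → κ) → (Fin b → κ) → ℂ} (hφ : SymmFun₂ φ)
    {j : ℕ} (hj : j ≤ b) (v : Fin j → κ) : SymmFun₂ fun α β => φ α (join hj β v) :=
  fun π σ α β => (hφ.left _ π α).trans ((hφ.right α).join_left hj v σ β)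

theorem SymmFun₂.join_left {a b : ℕ} {φ : (Fin a → κ) → (Fin b → κ) → ℂ} (hφ : SymmFun₂ φ)
    {i : ℕ} (hi : i ≤ a) (u : Fin i → κ) : SymmFun₂ fun α β => φ (join hi α u) β :=
  fun π σ α β => (hφ.right _ σ β).trans ((hφ.left β).join_left hi u π α)

variable [Fintype κ]

/-- The polynomial `∑_α c(α) ∏_p X (s (α p))`. -/
def monSum (s : κ → κ ⊕ κ) {a : ℕ} (c : (Fin a → κ) → ZPoly κ) : ZPoly κ :=
  ∑ α, c α * mon s α

theorem monSum_succ (s : κ → κ ⊕ κ) {a : ℕ} (c : (Fin (a + 1) → κ) → ZPoly κ) :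
    monSum s c = ∑ k, X (s k) * monSum s fun α : Fin a → κ => c (Fin.cons k α) := by
  rw [monSum, sum_fin_succ]
  simp only [monSum, mon_cons, Finset.mul_sum]
  refine Finset.sum_congr rfl fun k _ => Finset.sum_congr rfl fun α _ => ?_
  ring

-- By symmetry all a + 1 positions contribute the same term, the one where the first index is k.
open Classical in
theorem pd_monSum {s : κ → κ ⊕ κ} (hs : Function.Injective s) {a : ℕ}
    {c : (Fin (a + 1) → κ) → ZPoly κ} (hc : SymmFun c) (k : κ) (h : ∀ α, pd (s k) (c α) = 0) :
    pd (s k) (monSum s c) =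
      ((a + 1 : ℕ) : ℂ) • monSum s fun α : Fin a → κ => c (Fin.cons k α) := by
  induction a with
  | zero =>
    rw [monSum_succ, map_sum, Finset.sum_eq_single k]
    · simp [monSum, pd_X_mul, mon, h]
    · intro l _ hl
      have : s k ≠ s l := fun h => hl (hs h).symm
      simp [monSum, pd_X_mul, mon, h, this]
    · simp
  | succ a ih =>
    have key : ∀ l, pd (s k) (X (s l) * monSum s fun α : Fin (a + 1) → κ => c (Fin.cons l α)) =
        (if l = k then monSum s fun α : Fin (a + 1) → κ => c (Fin.cons l α) else 0) +
        ((a + 1 : ℕ) : ℂ) • (X (s l) * monSum s fun α : Fin a → κ =>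
          c (Fin.cons k (Fin.cons l α : Fin (a + 1) → κ))) := by
      intro l
      rw [pd_X_mul, ih (hc.cons l) fun α => h _, mul_smul_comm]
      simp only [hc.cons_cons l k, hs.eq_iff, eq_comm]
    rw [monSum_succ, map_sum]
    simp only [key, Finset.sum_add_distrib, ← Finset.smul_sum]
    rw [← monSum_succ s fun α : Fin (a + 1) → κ => c (Fin.cons k α)]
    simp only [Finset.sum_ite_eq', Finset.mem_univ, if_true]
    push_cast
    module

/-- Successive derivatives contribute the factors a, a - 1, …, whence the descending factorial. -/
theorem iterD_monSum {s : κ → κ ⊕ κ} (hs : Function.Injective s) {a i a' : ℕ} (hi : i + a' = a)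
    {c : (Fin a → κ) → ZPoly κ} (hc : SymmFun c) (h : ∀ k α, pd (s k) (c α) = 0)
    (u : Fin i → κ) : iterD s u (monSum s c) = (a.descFactorial i : ℂ) •
      monSum s fun α : Fin a' → κ => c (Fin.append u α ∘ Fin.cast hi.symm) := by
  induction i generalizing a with
  | zero =>
    obtain rfl : a' = a := by omega
    simp only [iterD_zero, Nat.descFactorial_zero, Nat.cast_one, one_smul]
    congr 1
    funext α
    congr 1
    funext x
    have : Fin.cast hi.symm x = Fin.natAdd 0 x := by ext; simp
    rw [Function.comp_apply, this, Fin.append_right]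
  | succ i ih =>
    obtain ⟨a, rfl⟩ : ∃ a₁, a = a₁ + 1 := ⟨i + a', by omega⟩
    have hi' : i + a' = a := by omega
    rw [iterD_succ, pd_monSum hs hc _ fun α => h _ α, map_smul,
      ih hi' (hc.cons _) fun k α => h _ _, smul_smul, Nat.succ_descFactorial_succ]
    push_cast
    congr 2
    funext α
    congr 1
    subst hi'
    conv_rhs => rw [← Fin.cons_self_tail u]
    rw [Fin.append_cons]
    rfl

theorem iterD_monSum_eq_zero {s : κ → κ ⊕ κ} (hs : Function.Injective s) {a i : ℕ} (hi : a < i)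
    {c : (Fin a → κ) → ZPoly κ} (hc : SymmFun c) (h : ∀ k α, pd (s k) (c α) = 0)
    (u : Fin i → κ) : iterD s u (monSum s c) = 0 := by
  induction i generalizing a with
  | zero => omega
  | succ i ih =>
    rw [iterD_succ]
    rcases a with _ | a
    · simp [monSum, mon, h]
    · rw [pd_monSum hs hc _ fun α => h _ α, map_smul, ih (by omega) (hc.cons _) fun k α => h _ _,
        smul_zero]

theorem sum_X_mul_pd_monSum {s : κ → κ ⊕ κ} (hs : Function.Injective s) {a : ℕ}
    {c : (Fin a → κ) → ZPoly κ} (hc : SymmFun c) (h : ∀ k α, pd (s k) (c α) = 0) :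
    ∑ k, X (s k) * pd (s k) (monSum s c) = (a : ℂ) • monSum s c := by
  rcases a with _ | a
  · simp [monSum, mon, h]
  · rw [monSum_succ s c, Finset.smul_sum]
    refine Finset.sum_congr rfl fun k _ => ?_
    rw [← monSum_succ, pd_monSum hs hc k fun α => h k α, mul_smul_comm]

/-- The polynomial `∑_{α, β} φ(α, β) z_α z̄_β`. -/
def kerPoly {a b : ℕ} (φ : (Fin a → κ) → (Fin b → κ) → ℂ) : ZPoly κ :=
  ∑ α, ∑ β, φ α β • (mon Sum.inl α * mon Sum.inr β)

section

variable {a b : ℕ}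

theorem kerPoly_eq_inl (φ : (Fin a → κ) → (Fin b → κ) → ℂ) :
    kerPoly φ = monSum Sum.inl fun α => ∑ β, φ α β • mon Sum.inr β := by
  simp only [kerPoly, monSum, Finset.sum_mul, smul_mul_assoc, mul_comm (mon Sum.inl _)]

theorem kerPoly_eq_inr (φ : (Fin a → κ) → (Fin b → κ) → ℂ) :
    kerPoly φ = monSum Sum.inr fun β => ∑ α, φ α β • mon Sum.inl α := by
  rw [kerPoly, Finset.sum_comm]
  simp only [monSum, Finset.sum_mul, smul_mul_assoc]

theorem isHomogeneous_kerPoly (φ : (Fin a → κ) → (Fin b → κ) → ℂ) :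
    (kerPoly φ).IsHomogeneous (a + b) := by
  refine IsHomogeneous.sum _ _ _ fun α _ => IsHomogeneous.sum _ _ _ fun β _ => ?_
  rw [smul_eq_C_mul, ← zero_add (a + b)]
  exact (isHomogeneous_C _ _).mul ((isHomogeneous_mon _ α).mul (isHomogeneous_mon _ β))

theorem kerPoly_smul (x : ℂ) (φ : (Fin a → κ) → (Fin b → κ) → ℂ) :
    kerPoly (fun α β => x * φ α β) = x • kerPoly φ := by
  simp only [kerPoly, Finset.smul_sum, smul_smul]

theorem kerPoly_sum {ν : Type*} (s : Finset ν) (φ : ν → (Fin a → κ) → (Fin b → κ) → ℂ) :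
    kerPoly (fun α β => ∑ x ∈ s, φ x α β) = ∑ x ∈ s, kerPoly (φ x) := by
  simp only [kerPoly, Finset.sum_smul]
  rw [Finset.sum_comm' (t' := Finset.univ) (s' := fun _ => s) (by simp)]
  refine Finset.sum_congr rfl fun α _ => ?_
  rw [Finset.sum_comm]

theorem cj_kerPoly (φ : (Fin a → κ) → (Fin b → κ) → ℂ) :
    cj (kerPoly φ) = kerPoly fun β α => conj (φ α β) := by
  simp only [kerPoly, cj_sum, cj_smul, cj_mul, cj_mon]
  rw [Finset.sum_comm]
  refine Finset.sum_congr rfl fun β _ => Finset.sum_congr rfl fun α _ => ?_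
  rw [mul_comm]
  rfl

theorem kerPoly_comp_perm (φ : (Fin a → κ) → (Fin b → κ) → ℂ) (π : Equiv.Perm (Fin a))
    (σ : Equiv.Perm (Fin b)) : kerPoly (fun α β => φ (α ∘ π) (β ∘ σ)) = kerPoly φ := by
  unfold kerPoly
  refine Fintype.sum_equiv (π.arrowCongr (Equiv.refl κ)).symm _ _ fun α => ?_
  refine Fintype.sum_equiv (σ.arrowCongr (Equiv.refl κ)).symm _ _ fun β => ?_
  have h1 : (π.arrowCongr (Equiv.refl κ)).symm α = α ∘ π := rfl
  have h2 : (σ.arrowCongr (Equiv.refl κ)).symm β = β ∘ σ := rfl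
  rw [h1, h2, mon_comp_perm, mon_comp_perm]

variable {φ : (Fin a → κ) → (Fin b → κ) → ℂ} (hφ : SymmFun₂ φ)
include hφ

theorem SymmFun₂.coeff_left : SymmFun fun α => ∑ β, φ α β • (mon Sum.inr β : ZPoly κ) :=
  fun π α => Finset.sum_congr rfl fun β _ => by rw [show φ (α ∘ π) β = φ α β from hφ.left β π α]

theorem SymmFun₂.coeff_right : SymmFun fun β => ∑ α, φ α β • (mon Sum.inl α : ZPoly κ) :=
  fun π α => Finset.sum_congr rfl fun β _ => by
    rw [show φ β (α ∘ π) = φ β α from hφ.right β π α]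

omit hφ in
theorem pd_coeff_left (k : κ) (α : Fin a → κ) :
    pd (Sum.inl k) (∑ β, φ α β • (mon Sum.inr β : ZPoly κ)) = 0 := by
  rw [map_sum]
  refine Finset.sum_eq_zero fun β _ => ?_
  rw [map_smul, pd_mon_of_ne (by simp), smul_zero]

omit hφ in
theorem pd_coeff_right (k : κ) (β : Fin b → κ) :
    pd (Sum.inr k) (∑ α, φ α β • (mon Sum.inl α : ZPoly κ)) = 0 := by
  rw [map_sum]
  refine Finset.sum_eq_zero fun α _ => ?_
  rw [map_smul, pd_mon_of_ne (by simp), smul_zero]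

theorem sum_X_inl_mul_pd_kerPoly :
    ∑ k, X (Sum.inl k) * pd (Sum.inl k) (kerPoly φ) = (a : ℂ) • kerPoly φ := by
  rw [kerPoly_eq_inl]
  exact sum_X_mul_pd_monSum Sum.inl_injective hφ.coeff_left pd_coeff_left

theorem sum_X_inr_mul_pd_kerPoly :
    ∑ k, X (Sum.inr k) * pd (Sum.inr k) (kerPoly φ) = (b : ℂ) • kerPoly φ := by
  rw [kerPoly_eq_inr]
  exact sum_X_mul_pd_monSum Sum.inr_injective hφ.coeff_right pd_coeff_right

theorem iterD_inl_kerPoly_append {i a' : ℕ} (hi : i + a' = a) (u : Fin i → κ) :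
    iterD Sum.inl u (kerPoly φ) = (a.descFactorial i : ℂ) •
      kerPoly fun (α : Fin a' → κ) β => φ (Fin.append u α ∘ Fin.cast hi.symm) β := by
  rw [kerPoly_eq_inl, kerPoly_eq_inl,
    iterD_monSum Sum.inl_injective hi hφ.coeff_left pd_coeff_left]

theorem iterD_inr_kerPoly_append {j b' : ℕ} (hj : j + b' = b) (v : Fin j → κ) :
    iterD Sum.inr v (kerPoly φ) = (b.descFactorial j : ℂ) •
      kerPoly fun α (β : Fin b' → κ) => φ α (Fin.append v β ∘ Fin.cast hj.symm) := by
  rw [kerPoly_eq_inr, kerPoly_eq_inr,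
    iterD_monSum Sum.inr_injective hj hφ.coeff_right pd_coeff_right]

theorem iterD_inl_kerPoly {i : ℕ} (hi : i ≤ a) (u : Fin i → κ) :
    iterD Sum.inl u (kerPoly φ) = (a.descFactorial i : ℂ) •
      kerPoly fun α β => φ (join hi α u) β := by
  rw [iterD_inl_kerPoly_append hφ (Nat.add_sub_of_le hi)]
  congr 2
  funext α β
  exact (hφ.left β).append_eq_join hi (Nat.add_sub_of_le hi) α u

theorem iterD_inr_kerPoly {j : ℕ} (hj : j ≤ b) (v : Fin j → κ) :
    iterD Sum.inr v (kerPoly φ) = (b.descFactorial j : ℂ) •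
      kerPoly fun α β => φ α (join hj β v) := by
  rw [iterD_inr_kerPoly_append hφ (Nat.add_sub_of_le hj)]
  congr 2
  funext α β
  exact (hφ.right α).append_eq_join hj (Nat.add_sub_of_le hj) β v

theorem iterD_kerPoly {i j : ℕ} (hi : i ≤ a) (hj : j ≤ b) (u : Fin i → κ) (v : Fin j → κ) :
    iterD Sum.inl u (iterD Sum.inr v (kerPoly φ)) =
      ((a.descFactorial i : ℂ) * b.descFactorial j) •
        kerPoly fun α β => φ (join hi α u) (join hj β v) := by
  rw [iterD_inr_kerPoly hφ hj, map_smul, iterD_inl_kerPoly (hφ.join_right hj v) hi, smul_smul,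
    mul_comm]

theorem iterD_kerPoly' {i j : ℕ} (hi : i ≤ a) (hj : j ≤ b) (u : Fin i → κ) (v : Fin j → κ) :
    iterD Sum.inr v (iterD Sum.inl u (kerPoly φ)) =
      ((a.descFactorial i : ℂ) * b.descFactorial j) •
        kerPoly fun α β => φ (join hi α u) (join hj β v) := by
  rw [iterD_inl_kerPoly hφ hi, map_smul, iterD_inr_kerPoly (hφ.join_left hi u) hj, smul_smul]

theorem iterD_inl_kerPoly_eq_zero {i : ℕ} (hi : a < i) (u : Fin i → κ) :
    iterD Sum.inl u (kerPoly φ) = 0 := by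
  rw [kerPoly_eq_inl]
  exact iterD_monSum_eq_zero Sum.inl_injective hi hφ.coeff_left pd_coeff_left u

theorem iterD_inr_kerPoly_eq_zero {j : ℕ} (hj : b < j) (v : Fin j → κ) :
    iterD Sum.inr v (kerPoly φ) = 0 := by
  rw [kerPoly_eq_inr]
  exact iterD_monSum_eq_zero Sum.inr_injective hj hφ.coeff_right pd_coeff_right v

end

end KernelPolynomial

/-! ### Norms of kernels and of their polynomials -/

section KernelNorm

variable {κ : Type*} {a b c d : ℕ}

theorem Kernel.IsSymm.symmFun₂ {f : Kernel κ a b} (hf : f.IsSymm) :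
    SymmFun₂ fun α β => f (α, β) := hf

theorem Kernel.norm_sq_eq_tsum (f : Kernel κ a b) : ‖f‖ ^ 2 = ∑' p, ‖f p‖ ^ 2 := by
  have := lp.norm_rpow_eq_tsum (p := 2) (by norm_num) f
  simpa using this

theorem Kernel.IsSymm.revConj {f : Kernel κ a b} (hf : f.IsSymm) : f.revConj.IsSymm :=
  fun π σ α β => congrArg conj (hf σ π β α)

@[simp] theorem Kernel.revConj_apply (f : Kernel κ a b) (p) :
    f.revConj p = conj (f (p.2, p.1)) := rfl

theorem Kernel.symmetrize_apply (f : Kernel κ a b) (p) : f.symmetrize p =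
    ((a.factorial : ℂ) * (b.factorial : ℂ))⁻¹ *
      ∑ π : Equiv.Perm (Fin a), ∑ σ : Equiv.Perm (Fin b), f (p.1 ∘ π, p.2 ∘ σ) := by
  rw [Kernel.symmetrize, lp.coeFn_smul, Pi.smul_apply, smul_eq_mul, lp.coeFn_sum,
    Finset.sum_apply]
  congr 1
  refine Finset.sum_congr rfl fun π _ => ?_
  rw [lp.coeFn_sum, Finset.sum_apply]
  rfl

theorem Kernel.isSymm_symmetrize (f : Kernel κ a b) : f.symmetrize.IsSymm := by
  intro π σ α β
  rw [symmetrize_apply, symmetrize_apply]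
  congr 1
  refine Fintype.sum_equiv (Equiv.mulLeft π) _ _ fun π' => ?_
  refine Fintype.sum_equiv (Equiv.mulLeft σ) _ _ fun σ' => ?_
  rfl

theorem Kernel.norm_permute (π : Equiv.Perm (Fin a)) (σ : Equiv.Perm (Fin b)) (f : Kernel κ a b) :
    ‖Kernel.permute π σ f‖ = ‖f‖ := by
  refine (sq_eq_sq₀ (norm_nonneg _) (norm_nonneg _)).1 ?_
  rw [norm_sq_eq_tsum, norm_sq_eq_tsum]
  exact ((π.arrowCongr (Equiv.refl κ)).symm.prodCongr
    (σ.arrowCongr (Equiv.refl κ)).symm).tsum_eq fun p => ‖f p‖ ^ 2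

theorem Kernel.norm_symmetrize_le (f : Kernel κ a b) : ‖f.symmetrize‖ ≤ ‖f‖ := by
  rw [Kernel.symmetrize, norm_smul]
  have h : ‖∑ π : Equiv.Perm (Fin a), ∑ σ : Equiv.Perm (Fin b), Kernel.permute π σ f‖ ≤
      (a.factorial * b.factorial) * ‖f‖ := by
    refine (norm_sum_le _ _).trans ?_
    refine (Finset.sum_le_sum fun π _ => norm_sum_le _ _).trans ?_
    simp [norm_permute, Fintype.card_perm, mul_assoc]
  have h0 : (0 : ℝ) < a.factorial * b.factorial := by
    have := a.factorial_pos; have := b.factorial_pos; positivity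
  rw [norm_inv, norm_mul, Complex.norm_natCast, Complex.norm_natCast]
  rw [inv_mul_le_iff₀ h0]
  exact h

variable [Fintype κ]

theorem sum_fin_add {M : Type*} [AddCommMonoid M] {m n : ℕ} (φ : (Fin (m + n) → κ) → M) :
    ∑ T, φ T = ∑ t : Fin m → κ, ∑ t' : Fin n → κ, φ (Fin.append t t') := by
  rw [← (Fin.appendEquiv m n).sum_comp, Fintype.sum_prod_type]
  rfl

/-- The polynomial of a kernel over a finite index set. -/
def Kernel.poly (f : Kernel κ a b) : ZPoly κ := kerPoly fun α β => f (α, β)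

theorem Kernel.isHomogeneous_poly (f : Kernel κ a b) : f.poly.IsHomogeneous (a + b) :=
  isHomogeneous_kerPoly _

theorem Kernel.cj_poly (f : Kernel κ a b) : cj f.poly = f.revConj.poly :=
  cj_kerPoly _

theorem Kernel.poly_symmetrize (f : Kernel κ a b) : f.symmetrize.poly = f.poly := by
  simp only [poly, symmetrize_apply, kerPoly_smul, kerPoly_sum]
  have (π : Equiv.Perm (Fin a)) (σ : Equiv.Perm (Fin b)) :
      kerPoly (fun α β => f (α ∘ π, β ∘ σ)) = kerPoly fun α β => f (α, β) :=
    kerPoly_comp_perm (fun α β => f (α, β)) π σ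
  simp only [this, Finset.sum_const, Finset.card_univ, Fintype.card_perm, Fintype.card_fin,
    ← Nat.cast_smul_eq_nsmul ℂ, smul_smul]
  have h1 : (a.factorial : ℂ) ≠ 0 := by exact_mod_cast a.factorial_ne_zero
  have h2 : (b.factorial : ℂ) ≠ 0 := by exact_mod_cast b.factorial_ne_zero
  field_simp
  rw [one_smul]

/-- Differentiating along all indices of a monomial extracts a! b! times the matching coefficient;
only the differentiated kernel has to be symmetric. -/
theorem pair_kerPoly (g : (Fin a → κ) → (Fin b → κ) → ℂ) {f : (Fin b → κ) → (Fin a → κ) → ℂ}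
    (hf : SymmFun₂ f) : pair (kerPoly g) (kerPoly f) =
      (a.factorial * b.factorial : ℂ) * ∑ α, ∑ β, g α β * f β α := by
  have h (α : Fin a → κ) (β : Fin b → κ) :
      pair (mon Sum.inl α * mon Sum.inr β) (kerPoly f) =
        (a.factorial * b.factorial : ℂ) * f β α := by
    rw [pair, bracket_mul, bracket_mon (s' := Sum.inr) (fun _ => rfl),
      bracket_mon (s' := Sum.inl) (fun _ => rfl), iterD_kerPoly' hf le_rfl le_rfl]
    have hj {n : ℕ} (t : Fin (n - n) → κ) (u : Fin n → κ) : join le_rfl t u = u := by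
      funext x
      have h1 : Fin.cast (Nat.sub_add_cancel le_rfl).symm x = Fin.natAdd (n - n) x := by
        ext; simp
      rw [join, Function.comp_apply, h1, Fin.append_right]
    have hm {n : ℕ} (s : κ → κ ⊕ κ) (t : Fin (n - n) → κ) : mon s t = 1 := by
      have : IsEmpty (Fin (n - n)) := by rw [Nat.sub_self]; infer_instance
      simp [mon]
    simp only [kerPoly, hj, hm, Nat.descFactorial_self, mul_one]
    have (n : ℕ) : IsEmpty (Fin (n - n)) := by rw [Nat.sub_self]; infer_instance
    simp [smul_eq_C_mul]
    exact Or.inl (mul_comm _ _)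
  simp only [kerPoly, pair_sum_left, pair_smul_left, Finset.mul_sum]
  refine Finset.sum_congr rfl fun α _ => Finset.sum_congr rfl fun β _ => ?_
  have := h α β
  rw [kerPoly] at this
  rw [this]
  ring

theorem nsq_kerPoly {f : (Fin a → κ) → (Fin b → κ) → ℂ} (hf : SymmFun₂ f) :
    nsq (kerPoly f) = a.factorial * b.factorial * ∑ α, ∑ β, ‖f α β‖ ^ 2 := by
  have hf' : SymmFun₂ fun β α => conj (f α β) := fun π σ α β => congrArg conj (hf σ π β α)
  rw [nsq, cj_kerPoly, pair_kerPoly _ hf']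
  simp only [Complex.mul_conj, Complex.normSq_eq_norm_sq]
  norm_cast

theorem Kernel.norm_sq_eq_sum (f : Kernel κ a b) : ‖f‖ ^ 2 = ∑ α, ∑ β, ‖f (α, β)‖ ^ 2 := by
  rw [norm_sq_eq_tsum, tsum_fintype, Fintype.sum_prod_type]

/-- The variables commute, so a polynomial only sees the symmetrization of its kernel. This is how
symmetrized contractions enter the upper bound. -/
theorem Kernel.nsq_poly (f : Kernel κ a b) :
    nsq f.poly = a.factorial * b.factorial * ‖f.symmetrize‖ ^ 2 := by
  rw [← poly_symmetrize, norm_sq_eq_sum]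
  exact nsq_kerPoly f.isSymm_symmetrize

theorem kerPoly_mul (f : (Fin a → κ) → (Fin b → κ) → ℂ) (g : (Fin c → κ) → (Fin d → κ) → ℂ) :
    kerPoly f * kerPoly g = kerPoly fun (T : Fin (a + c) → κ) (S : Fin (b + d) → κ) =>
      f (T ∘ Fin.castAdd c) (S ∘ Fin.castAdd d) * g (T ∘ Fin.natAdd a) (S ∘ Fin.natAdd b) := by
  unfold kerPoly
  rw [sum_fin_add, Finset.sum_mul_sum]
  refine Finset.sum_congr rfl fun t _ => Finset.sum_congr rfl fun t' _ => ?_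
  rw [sum_fin_add, Finset.sum_mul_sum]
  refine Finset.sum_congr rfl fun s _ => Finset.sum_congr rfl fun s' _ => ?_
  have h1 {m n : ℕ} (t : Fin m → κ) (t' : Fin n → κ) :
      Fin.append t t' ∘ Fin.castAdd n = t := by funext x; simp
  have h2 {m n : ℕ} (t : Fin m → κ) (t' : Fin n → κ) :
      Fin.append t t' ∘ Fin.natAdd m = t' := by funext x; simp
  simp only [h1, h2]
  rw [smul_mul_smul_comm, mon_append, mon_append]
  congr 1
  ring

theorem Kernel.contract_apply {i j : ℕ} (f : Kernel κ a b) (g : Kernel κ c d) (hia : i ≤ a)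
    (hjb : j ≤ b) (hjc : j ≤ c) (hid : i ≤ d) (p) : f.contract g i j hia hjb hjc hid p =
    ∑ u : Fin i → κ, ∑ v : Fin j → κ,
      f (join hia (p.1 ∘ Fin.castAdd (c - j)) u, join hjb (p.2 ∘ Fin.castAdd (d - i)) v) *
      g (join hjc (p.1 ∘ Fin.natAdd (a - i)) v, join hid (p.2 ∘ Fin.natAdd (b - j)) u) := by
  rw [← Fintype.sum_prod_type', ← tsum_fintype (L := .unconditional _)]
  rfl

/-- Derivatives fix the contracted indices at the cost of descending factorials, and the product of
the two polynomials concatenates the free indices. -/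
theorem Kernel.contr₂_poly {f : Kernel κ a b} {g : Kernel κ c d} (hf : f.IsSymm) (hg : g.IsSymm)
    {i j : ℕ} (hia : i ≤ a) (hjb : j ≤ b) (hjc : j ≤ c) (hid : i ≤ d) :
    contr₂ i j f.poly g.poly = ((a.descFactorial i * b.descFactorial j : ℂ) *
      (c.descFactorial j * d.descFactorial i)) • (f.contract g i j hia hjb hjc hid).poly := by
  simp only [contr₂_eq, poly, contract_apply, kerPoly_sum, Finset.smul_sum]
  refine Finset.sum_congr rfl fun u _ => Finset.sum_congr rfl fun v _ => ?_
  rw [iterD_kerPoly hf.symmFun₂ hia hjb, iterD_kerPoly' hg.symmFun₂ hjc hid, smul_mul_smul_comm,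
    kerPoly_mul]

theorem Kernel.contr₂_poly_eq_zero {f : Kernel κ a b} (hf : f.IsSymm) {i j : ℕ}
    (h : ¬ (i ≤ a ∧ j ≤ b)) (Q : ZPoly κ) : contr₂ i j f.poly Q = 0 := by
  rw [contr₂_eq]
  refine Finset.sum_eq_zero fun u _ => Finset.sum_eq_zero fun v _ => ?_
  by_cases hj : j ≤ b
  · rw [poly, iterD_inr_kerPoly hf.symmFun₂ hj, map_smul,
      iterD_inl_kerPoly_eq_zero (hf.symmFun₂.join_right hj v) (by omega)]
    simp
  · rw [poly, iterD_inr_kerPoly_eq_zero hf.symmFun₂ (by omega)]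
    simp

theorem bracket_kerPoly (g : (Fin a → κ) → (Fin b → κ) → ℂ) (Q : ZPoly κ) :
    bracket (kerPoly g) Q = ∑ α, ∑ β, g α β • iterD Sum.inr α (iterD Sum.inl β Q) := by
  simp only [kerPoly, map_sum, map_smul, LinearMap.sum_apply, LinearMap.smul_apply, bracket_mul]
  refine Finset.sum_congr rfl fun α _ => Finset.sum_congr rfl fun β _ => ?_
  rw [bracket_mon (s' := Sum.inr) (fun _ => rfl), bracket_mon (s' := Sum.inl) (fun _ => rfl)]

/-- The d - i and c - j derivatives are taken along the free indices s', t' of g, so the remaining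
operator contracts exactly i and j indices with f. For fixed t' and s' the contraction is symmetric
in the free indices of f, and the norm of its polynomial is a multiple of its ℓ² norm without any
symmetrization. -/
theorem Kernel.norm_sq_contract_le_prodPart {f : Kernel κ a b} {g : Kernel κ c d} (hf : f.IsSymm)
    (hg : g.IsSymm) {i j : ℕ} (hia : i ≤ a) (hjb : j ≤ b) (hjc : j ≤ c) (hid : i ≤ d) :
    ‖f.contract g i j hia hjb hjc hid‖ ^ 2 ≤ prodPart (d - i) (c - j) f.poly g.poly := by
  rw [norm_sq_eq_sum, sum_fin_add]
  simp only [sum_fin_add (n := d - i)]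
  rw [prodPart, Finset.sum_comm (s := (Finset.univ : Finset (Fin (d - i) → κ)))]
  have hswap (φ : (Fin (a - i) → κ) → (Fin (c - j) → κ) → (Fin (b - j) → κ) →
      (Fin (d - i) → κ) → ℝ) : ∑ t, ∑ t', ∑ s, ∑ s', φ t t' s s' =
      ∑ t', ∑ s', ∑ t, ∑ s, φ t t' s s' := by
    rw [Finset.sum_comm]
    refine Finset.sum_congr rfl fun t' _ => ?_
    rw [Finset.sum_comm' (t' := Finset.univ) (s' := fun _ => Finset.univ) (by simp)]
    simp_rw [Finset.sum_comm (s := (Finset.univ : Finset (Fin (a - i) → κ)))]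
    rw [Finset.sum_comm]
  rw [hswap]
  refine Finset.sum_le_sum fun t' _ => Finset.sum_le_sum fun s' _ => ?_
  have hD : iterD Sum.inr s' (iterD Sum.inl t' g.poly) =
      (c.descFactorial (c - j) * d.descFactorial (d - i) : ℂ) • kerPoly fun v u =>
        g (join hjc t' v, join hid s' u) := by
    have hs : SymmFun₂ fun (v : Fin j → κ) β => g (join hjc t' v, β) := fun π σ v β =>
      ((hg.symmFun₂.right _ σ β)).trans ((hg.symmFun₂.left β).join_right hjc t' π v)
    rw [poly, iterD_inl_kerPoly_append hg.symmFun₂ (Nat.sub_add_cancel hjc), map_smul]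
    erw [iterD_inr_kerPoly_append hs (Nat.sub_add_cancel hid)]
    rw [smul_smul]
    rfl
  have hB : bracket (iterD Sum.inr s' (iterD Sum.inl t' g.poly)) f.poly =
      ((c.descFactorial (c - j) * d.descFactorial (d - i) : ℕ) *
        (a.descFactorial i * b.descFactorial j : ℕ) : ℂ) • kerPoly fun t s =>
          f.contract g i j hia hjb hjc hid (Fin.append t t', Fin.append s s') := by
    have h1 {m n : ℕ} (t : Fin m → κ) (t' : Fin n → κ) :
        Fin.append t t' ∘ Fin.castAdd n = t := by funext x; simp
    have h2 {m n : ℕ} (t : Fin m → κ) (t' : Fin n → κ) :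
        Fin.append t t' ∘ Fin.natAdd m = t' := by funext x; simp
    simp only [contract_apply, h1, h2, kerPoly_sum]
    rw [hD, map_smul, LinearMap.smul_apply, bracket_kerPoly]
    push_cast
    conv_rhs => rw [mul_smul]
    congr 1
    rw [Finset.sum_comm, Finset.smul_sum]
    refine Finset.sum_congr rfl fun u _ => ?_
    rw [Finset.smul_sum]
    refine Finset.sum_congr rfl fun v _ => ?_
    rw [poly, iterD_kerPoly' hf.symmFun₂ hia hjb, smul_comm]
    congr 1
    rw [← kerPoly_smul]
    congr 1
    funext t s
    ring
  have hS : SymmFun₂ fun t s =>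
      f.contract g i j hia hjb hjc hid (Fin.append t t', Fin.append s s') := by
    intro π σ t s
    have h1 {m n : ℕ} (t : Fin m → κ) (t' : Fin n → κ) :
        Fin.append t t' ∘ Fin.castAdd n = t := by funext x; simp
    have h2 {m n : ℕ} (t : Fin m → κ) (t' : Fin n → κ) :
        Fin.append t t' ∘ Fin.natAdd m = t' := by funext x; simp
    simp only [contract_apply, h1, h2]
    refine Finset.sum_congr rfl fun u _ => Finset.sum_congr rfl fun v _ => ?_
    congr 1
    exact ((hf.symmFun₂.join_left hia u).right _ |>.join_left hjb v σ s).trans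
      ((hf.symmFun₂.left _).join_left hia u π t)
  rw [hB, nsq_smul, nsq_kerPoly hS, ← mul_assoc]
  refine le_mul_of_one_le_left (Finset.sum_nonneg fun _ _ => Finset.sum_nonneg fun _ _ =>
    sq_nonneg _) ?_
  rw [← Nat.cast_mul, Complex.norm_natCast]
  -- The accumulated factor is a positive integer, hence at least 1.
  have : 0 < (c.descFactorial (c - j) * d.descFactorial (d - i) *
      (a.descFactorial i * b.descFactorial j)) ^ 2 *
      ((a - i).factorial * (b - j).factorial) := by
    have h1 := Nat.pos_of_ne_zero (mt Nat.descFactorial_eq_zero_iff_lt.1 (Nat.sub_le c j).not_gt)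
    have h2 := Nat.pos_of_ne_zero (mt Nat.descFactorial_eq_zero_iff_lt.1 (Nat.sub_le d i).not_gt)
    have h3 := Nat.pos_of_ne_zero (mt Nat.descFactorial_eq_zero_iff_lt.1 hia.not_gt)
    have h4 := Nat.pos_of_ne_zero (mt Nat.descFactorial_eq_zero_iff_lt.1 hjb.not_gt)
    have h5 := (a - i).factorial_pos
    have h6 := (b - j).factorial_pos
    positivity
  exact_mod_cast this

end KernelNorm

/-! ### The fourth moment bounds for kernels over a finite index set -/

section FiniteKernel

theorem term_le_sum_sum_ite {M N : ℕ} {p : ℕ → ℕ → Prop} [∀ i j, Decidable (p i j)]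
    {φ : Fin M → Fin N → ℝ} (hφ : ∀ i j, 0 ≤ φ i j) (i : Fin M) (j : Fin N) (hp : p i j) :
    φ i j ≤ ∑ i : Fin M, ∑ j : Fin N, if p i j then φ i j else 0 := by
  have h (i : Fin M) (j : Fin N) : 0 ≤ if p i j then φ i j else 0 := by
    split_ifs
    exacts [hφ i j, le_rfl]
  calc φ i j = if p i j then φ i j else 0 := (if_pos hp).symm
    _ ≤ ∑ j : Fin N, if p i j then φ i j else 0 :=
      Finset.single_le_sum (fun j _ => h i j) (Finset.mem_univ j)
    _ ≤ _ := Finset.single_le_sum (f := fun i : Fin M => ∑ j : Fin N, if p i j then φ i j else 0)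
      (fun i _ => Finset.sum_nonneg fun j _ => h i j) (Finset.mem_univ i)

theorem sum_sum_ite_le {M N : ℕ} {p : ℕ → ℕ → Prop} [∀ i j, Decidable (p i j)]
    {φ : Fin M → Fin N → ℝ} {B : ℝ} (hB : 0 ≤ B)
    (hφ : ∀ (i : Fin M) (j : Fin N), p i j → φ i j ≤ B) :
    ∑ i : Fin M, ∑ j : Fin N, (if p i j then φ i j else 0) ≤ M * (N * B) := by
  calc _ ≤ ∑ i : Fin M, ∑ j : Fin N, B := by
        refine Finset.sum_le_sum fun i _ => Finset.sum_le_sum fun j _ => ?_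
        split_ifs with h
        exacts [hφ i j h, hB]
    _ = _ := by simp

theorem descFactorial_le_factorial {n k : ℕ} (h : k ≤ n) : n.descFactorial k ≤ n.factorial := by
  rw [← Nat.factorial_mul_descFactorial h]
  exact Nat.le_mul_of_pos_left _ (Nat.factorial_pos _)

variable {κ : Type*} [Fintype κ] {m n : ℕ}

/-- The constant that compares Wick contractions with symmetrized contractions. -/
def contrConst (a b c d : ℕ) : ℝ :=
  ((a.factorial * b.factorial * (c.factorial * d.factorial) : ℕ) : ℝ) ^ 2 *
    ((a + c).factorial * (b + d).factorial)

theorem Kernel.nsq_contr₂_poly_le {a b c d : ℕ} {f : Kernel κ a b} {g : Kernel κ c d}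
    (hf : f.IsSymm) (hg : g.IsSymm)
    {i j : ℕ} (hia : i ≤ a) (hjb : j ≤ b) (hjc : j ≤ c) (hid : i ≤ d) :
    nsq (contr₂ i j f.poly g.poly) ≤
      contrConst a b c d * ‖(f.contract g i j hia hjb hjc hid).symmetrize‖ ^ 2 := by
  rw [contr₂_poly hf hg hia hjb hjc hid, nsq_smul, nsq_poly, ← mul_assoc, contrConst]
  refine mul_le_mul_of_nonneg_right ?_ (sq_nonneg _)
  have h1 := descFactorial_le_factorial hia
  have h2 := descFactorial_le_factorial hjb
  have h3 := descFactorial_le_factorial hjc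
  have h4 := descFactorial_le_factorial hid
  have h5 : (a - i + (c - j)).factorial ≤ (a + c).factorial := Nat.factorial_le (by omega)
  have h6 : (b - j + (d - i)).factorial ≤ (b + d).factorial := Nat.factorial_le (by omega)
  rw [show ((a.descFactorial i * b.descFactorial j : ℂ) * (c.descFactorial j * d.descFactorial i)) =
    ((a.descFactorial i * b.descFactorial j * (c.descFactorial j * d.descFactorial i) : ℕ) : ℂ) by
      push_cast; rfl, Complex.norm_natCast]
  exact_mod_cast Nat.mul_le_mul (Nat.pow_le_pow_left
    (Nat.mul_le_mul (Nat.mul_le_mul h1 h2) (Nat.mul_le_mul h3 h4)) 2) (Nat.mul_le_mul h5 h6)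

theorem contrConst_nonneg (a b c d : ℕ) : 0 ≤ contrConst a b c d := by
  unfold contrConst; positivity

theorem sumContr_le {l : ℕ} {P Q : ZPoly κ} {B : ℝ} (hB : 0 ≤ B)
    (h : ∀ i j, 0 < i + j → i + j < l → nsq (contr₂ i j P Q) ≤ B) :
    sumContr l P Q ≤ l * (l * B) := by
  calc sumContr l P Q ≤ ∑ r ∈ Finset.Ioo 0 l, ∑ i ∈ Finset.range (r + 1), B := by
        refine Finset.sum_le_sum fun r hr => Finset.sum_le_sum fun i hi => ?_
        rw [Finset.mem_Ioo] at hr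
        rw [Finset.mem_range] at hi
        exact h _ _ (by omega) (by omega)
    _ ≤ ∑ r ∈ Finset.Ioo 0 l, l * B := by
        refine Finset.sum_le_sum fun r hr => ?_
        rw [Finset.mem_Ioo] at hr
        rw [Finset.sum_const, Finset.card_range, nsmul_eq_mul]
        gcongr
        omega
    _ ≤ l * (l * B) := by
        rw [Finset.sum_const, Nat.card_Ioo, nsmul_eq_mul]
        gcongr
        omega

theorem Kernel.sumContr_revConj_le {f : Kernel κ m n} (hf : f.IsSymm) :
    sumContr (m + n) f.poly f.revConj.poly ≤
      ((m + n : ℕ) : ℝ) * ((m + n : ℕ) *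
        (contrConst m n n m * f.sumSymmContractRevConj)) := by
  have h0 : 0 ≤ f.sumSymmContractRevConj := Finset.sum_nonneg fun _ _ =>
    Finset.sum_nonneg fun _ _ => by split_ifs <;> positivity
  refine sumContr_le (mul_nonneg (contrConst_nonneg _ _ _ _) h0) fun i j hij hl => ?_
  by_cases h : i ≤ m ∧ j ≤ n
  · refine (nsq_contr₂_poly_le hf hf.revConj h.1 h.2 h.2 h.1).trans ?_
    refine mul_le_mul_of_nonneg_left ?_ (contrConst_nonneg _ _ _ _)
    exact term_le_sum_sum_ite (p := fun i j => 0 < i + j ∧ i + j < m + n)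
      (φ := fun (i : Fin (m + 1)) (j : Fin (n + 1)) =>
        ‖(f.contract f.revConj i j i.is_le j.is_le j.is_le i.is_le).symmetrize‖ ^ 2)
      (fun _ _ => sq_nonneg _) ⟨i, by omega⟩ ⟨j, by omega⟩ ⟨hij, hl⟩
  · rw [contr₂_poly_eq_zero hf h, nsq_zero]
    exact mul_nonneg (contrConst_nonneg _ _ _ _) h0

theorem Kernel.sumContr_self_le {f : Kernel κ m m} (hf : f.IsSymm) :
    sumContr (m + m) f.poly f.poly ≤
      ((m + m : ℕ) : ℝ) * ((m + m : ℕ) *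
        (contrConst m m m m * f.sumSymmContractSelf)) := by
  have h0 : 0 ≤ f.sumSymmContractSelf := Finset.sum_nonneg fun _ _ =>
    Finset.sum_nonneg fun _ _ => by split_ifs <;> positivity
  refine sumContr_le (mul_nonneg (contrConst_nonneg _ _ _ _) h0) fun i j hij hl => ?_
  by_cases h : i ≤ m ∧ j ≤ m
  · refine (nsq_contr₂_poly_le hf hf h.1 h.2 h.2 h.1).trans ?_
    refine mul_le_mul_of_nonneg_left ?_ (contrConst_nonneg _ _ _ _)
    have hmin : min m m = m := min_self m
    exact term_le_sum_sum_ite (p := fun i j => 0 < i + j ∧ i + j < 2 * min m m)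
      (φ := fun (i : Fin (min m m + 1)) (j : Fin (min m m + 1)) =>
        ‖(f.contract f i j (i.is_le.trans (min_le_left m m)) (j.is_le.trans (min_le_right m m))
        (j.is_le.trans (min_le_left m m)) (i.is_le.trans (min_le_right m m))).symmetrize‖ ^ 2)
      (fun _ _ => sq_nonneg _) ⟨i, by omega⟩ ⟨j, by omega⟩ ⟨hij, show i + j < 2 * min m m by omega⟩
  · rw [contr₂_poly_eq_zero hf h, nsq_zero]
    exact mul_nonneg (contrConst_nonneg _ _ _ _) h0

theorem Kernel.sumSymmContractRevConj_nonneg {ι : Type*} (f : Kernel ι m n) :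
    0 ≤ f.sumSymmContractRevConj :=
  Finset.sum_nonneg fun _ _ => Finset.sum_nonneg fun _ _ => by split_ifs <;> positivity

theorem Kernel.sumSymmContractSelf_nonneg {ι : Type*} (f : Kernel ι m n) :
    0 ≤ f.sumSymmContractSelf :=
  Finset.sum_nonneg fun _ _ => Finset.sum_nonneg fun _ _ => by split_ifs <;> positivity

/-- The constant of the upper bound for the fourth cumulant. -/
def upperConst (m n : ℕ) : ℝ :=
  4 * cumConst (m + n - 1) * ((m + n : ℕ) * ((m + n : ℕ) *
    (contrConst m n n m + contrConst m m m m))) + 1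

/-- The summand 1 is what gives positivity when m + n = 1, since `cumConst 0` vanishes: there are
then no intermediate contractions. -/
theorem upperConst_pos (m n : ℕ) : 0 < upperConst m n := by
  have h1 := cumConst_nonneg (m + n - 1)
  have h2 := contrConst_nonneg m n n m
  have h3 := contrConst_nonneg m m m m
  unfold upperConst
  positivity

/-- The constant of the lower bound for the fourth cumulant. -/
def lowerConst (m n : ℕ) : ℝ := (2 * ((m + 1 : ℕ) * ((n + 1 : ℕ) * (m + n).factorial)))⁻¹

theorem lowerConst_pos (m n : ℕ) : 0 < lowerConst m n := by
  have := (m + n).factorial_pos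
  unfold lowerConst
  positivity

variable {E : ZPoly κ →ₗ[ℂ] ℂ}

theorem IsPosGaussianFunctional.cum4_poly_le (hE : IsPosGaussianFunctional E) (hmn : 1 ≤ m + n)
    {f : Kernel κ m n} (hf : f.IsSymm) : cum4 E f.poly ≤
      upperConst m n * (f.sumSymmContractRevConj + f.sumSymmContractSelf) := by
  have h1 := f.sumSymmContractRevConj_nonneg
  have h2 := f.sumSymmContractSelf_nonneg
  obtain ⟨l, hl⟩ : ∃ l, m + n = l + 1 := ⟨m + n - 1, by omega⟩
  have hP : f.poly.IsHomogeneous (l + 1) := hl ▸ f.isHomogeneous_poly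
  have hC := cumConst_nonneg l
  have hc1 := contrConst_nonneg m n n m
  have hc2 := contrConst_nonneg m m m m
  have hr := f.sumContr_revConj_le hf
  rw [← f.cj_poly] at hr
  unfold upperConst
  rw [hl] at hr ⊢
  rw [Nat.add_sub_cancel]
  set N : ℝ := ((l + 1 : ℕ) : ℝ) with hN
  have hN0 : 0 ≤ N := Nat.cast_nonneg _
  -- In the second case the self-contractions of f are not needed; their sum is added only because
  -- it is nonnegative.
  rcases eq_or_ne m n with rfl | hne
  · have hs := f.sumContr_self_le hf
    rw [hl, ← hN] at hs
    refine (hE.cum4_le_of_eq (by omega) hP (sum_X_inl_mul_pd_kerPoly hf.symmFun₂)).trans ?_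
    calc _ ≤ 4 * cumConst l * (N * (N * (contrConst m m m m * f.sumSymmContractRevConj)) +
          N * (N * (contrConst m m m m * f.sumSymmContractSelf))) := by gcongr
      _ ≤ _ := by
        rw [← sub_nonneg]
        ring_nf
        positivity
  · refine (hE.cum4_le_of_ne hne hP (sum_X_inl_mul_pd_kerPoly hf.symmFun₂)
      (sum_X_inr_mul_pd_kerPoly hf.symmFun₂)).trans ?_
    calc _ ≤ 4 * cumConst l * (N * (N * (contrConst m n n m * f.sumSymmContractRevConj))) := by
          gcongr
      _ ≤ _ := by
        rw [← sub_nonneg]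
        ring_nf
        positivity

theorem IsPosGaussianFunctional.le_cum4_poly (hE : IsPosGaussianFunctional E) (hmn : 1 ≤ m + n)
    {f : Kernel κ m n} (hf : f.IsSymm) :
    lowerConst m n * (f.sumContractRevConj + f.sumContractSelf) ≤ cum4 E f.poly := by
  have h0 : 0 ≤ cum4 E f.poly := hE.cum4_nonneg (by omega) f.isHomogeneous_poly
  have hB : 0 ≤ ((m + n).factorial : ℝ) * cum4 E f.poly := by positivity
  have key {r : ℕ} (hr : r < m + n) {x : ℝ} (hx : 0 ≤ x)
      (h : (r.factorial : ℝ)⁻¹ * x ≤ cum4 E f.poly) :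
      x ≤ ((m + n).factorial : ℝ) * cum4 E f.poly := by
    have hr0 : (0 : ℝ) < r.factorial := by exact_mod_cast r.factorial_pos
    rw [inv_mul_le_iff₀ hr0] at h
    refine h.trans (mul_le_mul_of_nonneg_right ?_ h0)
    exact_mod_cast Nat.factorial_le hr.le
  have h1 : f.sumContractRevConj ≤
      ((m + 1 : ℕ) : ℝ) * ((n + 1 : ℕ) * (((m + n).factorial : ℝ) * cum4 E f.poly)) := by
    refine sum_sum_ite_le (p := fun i j => 0 < i + j ∧ i + j < m + n)
      (φ := fun (i : Fin (m + 1)) (j : Fin (n + 1)) =>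
        ‖f.contract f.revConj i j i.is_le j.is_le j.is_le i.is_le‖ ^ 2) hB fun i j hij => ?_
    have hi := i.is_le
    have hj := j.is_le
    refine (Kernel.norm_sq_contract_le_prodPart hf hf.revConj _ _ _ _).trans ?_
    -- The number of derivatives is complementary to i + j, and lies strictly between 0 and m + n
    -- exactly when i + j does.
    refine key (r := (m - i) + (n - j)) (by omega) (hE.prodPart_nonneg _ _ _ _) ?_
    have := hE.prodPart_cj_le_cum4 (r := (m - i) + (n - j)) (i := m - i) f.isHomogeneous_poly
      (by omega) (by omega) (by omega)
    rwa [Nat.add_sub_cancel_left, f.cj_poly] at this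
  have h2 : f.sumContractSelf ≤ ((min m n + 1 : ℕ) : ℝ) * ((min m n + 1 : ℕ) *
      (((m + n).factorial : ℝ) * cum4 E f.poly)) := by
    refine sum_sum_ite_le (p := fun i j => 0 < i + j ∧ i + j < 2 * min m n)
      (φ := fun (i : Fin (min m n + 1)) (j : Fin (min m n + 1)) =>
        ‖f.contract f i j (i.is_le.trans (min_le_left m n)) (j.is_le.trans (min_le_right m n))
        (j.is_le.trans (min_le_left m n)) (i.is_le.trans (min_le_right m n))‖ ^ 2) hB
      fun i j hij => ?_
    have hi := i.is_le
    have hj := j.is_le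
    refine (Kernel.norm_sq_contract_le_prodPart hf hf _ _ _ _).trans ?_
    -- Here i + j < 2 (m ∧ n) ≤ m + n is what makes the complementary order positive.
    refine key (r := (n - i) + (m - j)) (by omega) (hE.prodPart_nonneg _ _ _ _) ?_
    have := hE.prodPart_le_cum4 (r := (n - i) + (m - j)) (i := n - i) f.isHomogeneous_poly
      (by omega) (by omega) (by omega)
    rwa [Nat.add_sub_cancel_left] at this
  have h3 : f.sumContractSelf ≤
      ((m + 1 : ℕ) : ℝ) * ((n + 1 : ℕ) * (((m + n).factorial : ℝ) * cum4 E f.poly)) := by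
    refine h2.trans ?_
    gcongr
    · exact min_le_left _ _
    · exact min_le_right _ _
  -- The constant counts two sums of at most (m + 1)(n + 1) terms, each term at most (m + n)! times
  -- the cumulant.
  have hpos := lowerConst_pos m n
  rw [lowerConst, inv_mul_le_iff₀ (by have := (m + n).factorial_pos; positivity)]
  linarith

end FiniteKernel

/-! ### Gaussian moments -/

section GaussianMoments

open scoped NNReal

theorem integrable_pow_mul_gaussianPDFReal {v : ℝ≥0} (hv : v ≠ 0) (n : ℕ) :
    Integrable fun x : ℝ => x ^ n * gaussianPDFReal 0 v x := by
  have hb : 0 < (2 * (v : ℝ))⁻¹ := by positivity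
  have h := (integrable_rpow_mul_exp_neg_mul_sq hb (s := n)
    (by linarith [(Nat.cast_nonneg n : (0 : ℝ) ≤ n)])).const_mul (√(2 * Real.pi * v))⁻¹
  refine h.congr (ae_of_all _ fun x => ?_)
  simp only [gaussianPDFReal, Real.rpow_natCast, sub_zero]
  rw [mul_left_comm]
  congr 3
  field_simp

theorem hasDerivAt_gaussianPDFReal {v : ℝ≥0} (hv : v ≠ 0) (x : ℝ) :
    HasDerivAt (gaussianPDFReal 0 v) (-((v : ℝ)⁻¹ * (x * gaussianPDFReal 0 v x))) x := by
  have h : HasDerivAt (fun x : ℝ => -(x - 0) ^ 2 / (2 * v)) (-(2 * x) / (2 * v)) x := by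
    simpa using (((hasDerivAt_id x).pow 2).neg.div_const (2 * (v : ℝ)))
  have hv' : (v : ℝ) ≠ 0 := by exact_mod_cast hv
  refine (h.exp.const_mul (√(2 * Real.pi * v))⁻¹).congr_deriv ?_
  simp only [gaussianPDFReal]
  field_simp

/-- Integration by parts against the density p, which satisfies p' = -x p / v. For n = 0 the
truncated exponent n - 1 is harmless because its coefficient is 0. -/
theorem integral_pow_succ_gaussianReal {v : ℝ≥0} (hv : v ≠ 0) (n : ℕ) :
    ∫ x, x ^ (n + 1) ∂gaussianReal 0 v = v * (n * ∫ x, x ^ (n - 1) ∂gaussianReal 0 v) := by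
  rw [integral_gaussianReal_eq_integral_smul hv, integral_gaussianReal_eq_integral_smul hv]
  have hv' : (v : ℝ) ≠ 0 := by exact_mod_cast hv
  have h := integral_mul_deriv_eq_deriv_mul_of_integrable (u := fun x : ℝ => x ^ n)
    (u' := fun x : ℝ => n * x ^ (n - 1)) (v := gaussianPDFReal 0 v)
    (v' := fun x => -((v : ℝ)⁻¹ * (x * gaussianPDFReal 0 v x)))
    (fun x _ => hasDerivAt_pow n x) (fun x _ => hasDerivAt_gaussianPDFReal hv x) (by
      refine ((integrable_pow_mul_gaussianPDFReal hv (n + 1)).const_mul (-(v : ℝ)⁻¹)).congr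
        (ae_of_all _ fun x => ?_)
      simp only [Pi.mul_apply]; ring) (by
      refine ((integrable_pow_mul_gaussianPDFReal hv (n - 1)).const_mul (n : ℝ)).congr
        (ae_of_all _ fun x => ?_)
      simp only [Pi.mul_apply]; ring) (integrable_pow_mul_gaussianPDFReal hv n)
  have h1 : ∫ x, gaussianPDFReal 0 v x • x ^ (n + 1) =
      -v * ∫ x, x ^ n * -((v : ℝ)⁻¹ * (x * gaussianPDFReal 0 v x)) := by
    rw [← integral_const_mul]
    congr 1
    funext x
    rw [smul_eq_mul, pow_succ]
    field_simp
  rw [h1, h, neg_mul_neg, ← integral_const_mul (n : ℝ)]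
  congr 2
  funext x
  rw [smul_eq_mul]
  ring

end GaussianMoments

/-! ### Expectations of polynomials in independent Gaussian variables -/

section Expectation

variable {Ω τ : Type*} [MeasurableSpace Ω] {P : Measure Ω} [IsProbabilityMeasure P]

theorem memLp_aeval {X : τ → Ω → ℂ} (hX : ∀ t, ∀ p : ENNReal, p ≠ ⊤ → MemLp (X t) p P)
    (Q : MvPolynomial τ ℂ) : ∀ p : ENNReal, p ≠ ⊤ →
      MemLp (fun ω => aeval (fun t => X t ω) Q) p P := by
  induction Q using MvPolynomial.induction_on with
  | C a => intro p _; simpa using memLp_const a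
  | add Q R hQ hR =>
    intro p hp
    simp only [map_add]
    exact (hQ p hp).add (hR p hp)
  | mul_X Q t hQ => simpa using memLp_mul hQ (hX t)

/-- The expectation of a polynomial in random variables with moments of all orders. -/
def polyExpect (P : Measure Ω) [IsProbabilityMeasure P] (X : τ → Ω → ℂ)
    (hX : ∀ t, ∀ p : ENNReal, p ≠ ⊤ → MemLp (X t) p P) :
    MvPolynomial τ ℂ →ₗ[ℂ] ℂ where
  toFun Q := ∫ ω, aeval (fun t => X t ω) Q ∂P
  map_add' Q R := by
    simp only [map_add]
    exact integral_add (memLp_one_iff_integrable.1 (memLp_aeval hX Q 1 (by simp)))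
      (memLp_one_iff_integrable.1 (memLp_aeval hX R 1 (by simp)))
  map_smul' a Q := by
    simp only [map_smul]
    exact integral_smul a _

theorem polyExpect_apply {X : τ → Ω → ℂ}
    (hX : ∀ t, ∀ p : ENNReal, p ≠ ⊤ → MemLp (X t) p P) (Q : MvPolynomial τ ℂ) :
    polyExpect P X hX Q = ∫ ω, aeval (fun t => X t ω) Q ∂P := rfl

-- Independence factorizes the moments of monomials, and the one-dimensional recursion is applied in
-- the coordinate t.
open scoped NNReal in
theorem polyExpect_X_mul [Fintype τ] {Y : τ → Ω → ℝ} {v : ℝ≥0} (hv : v ≠ 0)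
    (hind : iIndepFun Y P) (hm : ∀ t, AEMeasurable (Y t) P)
    (hlaw : ∀ t, P.map (Y t) = gaussianReal 0 v)
    (hY : ∀ t, ∀ p : ENNReal, p ≠ ⊤ → MemLp (fun ω => (Y t ω : ℂ)) p P)
    (t : τ) (Q : MvPolynomial τ ℂ) :
    polyExpect P (fun t ω => (Y t ω : ℂ)) hY (X t * Q) =
      v * polyExpect P (fun t ω => (Y t ω : ℂ)) hY (pderiv t Q) := by
  classical
  have hmono (d : τ →₀ ℕ) (a : ℂ) : polyExpect P (fun t ω => (Y t ω : ℂ)) hY (monomial d a) =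
      a * ∏ s, ((∫ x, x ^ d s ∂gaussianReal 0 v : ℝ) : ℂ) := by
    rw [polyExpect_apply]
    have h1 (ω : Ω) : aeval (fun t => (Y t ω : ℂ)) (monomial d a) =
        a * ((∏ s, (Y s ω) ^ d s : ℝ) : ℂ) := by
      rw [aeval_monomial, Finsupp.prod_fintype _ _ (by simp)]
      simp
    simp only [h1]
    rw [integral_const_mul, integral_complex_ofReal, hind.integral_fun_prod_comp
      (f := fun s x => x ^ d s) hm (fun s => by fun_prop), Complex.ofReal_prod]
    congr 2
    funext s
    rw [← hlaw s, integral_map (hm s) (by fun_prop)]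
  induction Q using MvPolynomial.induction_on' with
  | monomial d a =>
    rw [X, monomial_mul, one_mul, pderiv_monomial, hmono, hmono,
      Fintype.prod_eq_mul_prod_compl t, Fintype.prod_eq_mul_prod_compl t]
    have h2 : ∏ s ∈ {t}ᶜ, ((∫ x, x ^ ((Finsupp.single t 1 + d : τ →₀ ℕ) s) ∂gaussianReal 0 v : ℝ) : ℂ) =
        ∏ s ∈ {t}ᶜ, ((∫ x, x ^ ((d - Finsupp.single t 1 : τ →₀ ℕ) s) ∂gaussianReal 0 v : ℝ) : ℂ) := by
      refine Finset.prod_congr rfl fun s hs => ?_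
      have : t ≠ s := by simpa [eq_comm] using hs
      simp [this]
    rw [h2]
    simp only [Finsupp.add_apply, Finsupp.single_eq_same, Finsupp.tsub_apply]
    rw [add_comm 1, integral_pow_succ_gaussianReal hv]
    push_cast
    ring
  | add Q R hQ hR => rw [mul_add, map_add, hQ, hR, map_add, map_add, mul_add]

end Expectation

/-! ### Polynomials in standard complex Gaussian variables -/

section ComplexGaussian

variable {κ : Type*}

/-- The real coordinates `x_k = X (inl k)`, `y_k = X (inr k)` of `z_k = x_k + i y_k`. -/
def realCoord : ZPoly κ →ₐ[ℂ] MvPolynomial (κ ⊕ κ) ℂ :=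
  aeval (Sum.elim (fun k => X (Sum.inl k) + C Complex.I * X (Sum.inr k))
    (fun k => X (Sum.inl k) - C Complex.I * X (Sum.inr k)))

theorem realCoord_X_inl (k : κ) :
    realCoord (X (Sum.inl k)) = X (Sum.inl k) + C Complex.I * X (Sum.inr k) := by
  simp [realCoord]

theorem realCoord_X_inr (k : κ) :
    realCoord (X (Sum.inr k)) = X (Sum.inl k) - C Complex.I * X (Sum.inr k) := by
  simp [realCoord]

theorem pderiv_inl_realCoord (k : κ) (P : ZPoly κ) : pderiv (Sum.inl k) (realCoord P) =
    realCoord (pd (Sum.inl k) P) + realCoord (pd (Sum.inr k) P) := by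
  classical
  induction P using zpoly_induction with
  | hC a => simp [realCoord]
  | hadd P Q hP hQ =>
    simp only [map_add, hP, hQ]
    ring
  | hX t P hP =>
    rw [map_mul, pderiv_mul, hP, pd_X_mul, pd_X_mul]
    rcases t with j | j
    · rw [realCoord_X_inl]
      by_cases h : k = j
      · subst h; simp [pderiv_X, realCoord_X_inl]; ring
      · have h' : j ≠ k := fun e => h e.symm
        simp [pderiv_X, h, h', realCoord_X_inl]; ring
    · rw [realCoord_X_inr]
      by_cases h : k = j
      · subst h; simp [pderiv_X, realCoord_X_inr]; ring
      · have h' : j ≠ k := fun e => h e.symm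
        simp [pderiv_X, h, h', realCoord_X_inr]; ring

theorem pderiv_inr_realCoord (k : κ) (P : ZPoly κ) : pderiv (Sum.inr k) (realCoord P) =
    C Complex.I * (realCoord (pd (Sum.inl k) P) - realCoord (pd (Sum.inr k) P)) := by
  classical
  induction P using zpoly_induction with
  | hC a => simp [realCoord]
  | hadd P Q hP hQ =>
    simp only [map_add, hP, hQ]
    ring
  | hX t P hP =>
    rw [map_mul, pderiv_mul, hP, pd_X_mul, pd_X_mul]
    rcases t with j | j
    · rw [realCoord_X_inl]
      by_cases h : k = j
      · subst h; simp [pderiv_X, realCoord_X_inl]; ring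
      · have h' : j ≠ k := fun e => h e.symm
        simp [pderiv_X, h, h', realCoord_X_inl]; ring
    · rw [realCoord_X_inr]
      by_cases h : k = j
      · subst h; simp [pderiv_X, realCoord_X_inr]; ring
      · have h' : j ≠ k := fun e => h e.symm
        simp [pderiv_X, h, h', realCoord_X_inr]; ring

/-- The values of the variables `z_k` and `z̄_k`. -/
def zVal (z : κ → ℂ) : κ ⊕ κ → ℂ := Sum.elim z fun k => conj (z k)

theorem zVal_swap (z : κ → ℂ) (t : κ ⊕ κ) : zVal z t.swap = conj (zVal z t) := by
  rcases t with k | k <;> simp [zVal]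

theorem aeval_cj (z : κ → ℂ) (P : ZPoly κ) :
    aeval (zVal z) (cj P) = conj (aeval (zVal z) P) := by
  induction P using zpoly_induction with
  | hC a => simp
  | hadd P Q hP hQ => simp only [cj_add, map_add, hP, hQ]
  | hX t P hP =>
    rw [cj_mul, cj_X, map_mul, map_mul, hP, aeval_X, aeval_X, zVal_swap, map_mul]

theorem aeval_realCoord (z : κ → ℂ) (P : ZPoly κ) :
    aeval (fun t => ((Sum.elim (fun k => (z k).re) (fun k => (z k).im) t : ℝ) : ℂ)) (realCoord P) =
      aeval (zVal z) P := by
  rw [← AlgHom.comp_apply]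
  congr 1
  refine algHom_ext fun t => ?_
  rw [AlgHom.comp_apply, aeval_X]
  rcases t with k | k
  · rw [realCoord_X_inl]
    simp [zVal, mul_comm Complex.I, Complex.re_add_im]
  · rw [realCoord_X_inr]
    simp only [map_sub, map_mul, aeval_X, aeval_C, zVal, Sum.elim_inl, Sum.elim_inr]
    apply Complex.ext <;> simp

variable {Ω : Type*} [MeasurableSpace Ω] {P : Measure Ω}

theorem memLp_zVal {Z : κ → Ω → ℂ} (hZ : ∀ k, ∀ p : ENNReal, p ≠ ⊤ → MemLp (Z k) p P)
    (t : κ ⊕ κ) : ∀ p : ENNReal, p ≠ ⊤ → MemLp (fun ω => zVal (fun k => Z k ω) t) p P := by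
  intro p hp
  rcases t with k | k
  exacts [hZ k p hp, (hZ k p hp).star]

/-- The expectation functional on polynomials in `z_k`, `z̄_k`. -/
def zExpect (P : Measure Ω) [IsProbabilityMeasure P] (Z : κ → Ω → ℂ)
    (hZ : ∀ k, ∀ p : ENNReal, p ≠ ⊤ → MemLp (Z k) p P) : ZPoly κ →ₗ[ℂ] ℂ :=
  polyExpect P (fun t ω => zVal (fun k => Z k ω) t) (memLp_zVal hZ)

theorem zExpect_apply [IsProbabilityMeasure P] {Z : κ → Ω → ℂ} (hZ : ∀ k, ∀ p : ENNReal, p ≠ ⊤ → MemLp (Z k) p P)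
    (Q : ZPoly κ) : zExpect P Z hZ Q = ∫ ω, aeval (zVal fun k => Z k ω) Q ∂P := rfl

open Classical in
/-- A family of independent standard complex Gaussian variables. -/
structure IsStandardGaussian (P : Measure Ω) (Z : κ → Ω → ℂ) : Prop where
  gaussian : HasGaussianLaw (fun ω => (Z · ω)) P
  centered : ∀ k, ∫ ω, Z k ω ∂P = 0
  mul_eq_zero : ∀ k l, ∫ ω, Z k ω * Z l ω ∂P = 0
  mul_conj : ∀ k l, ∫ ω, Z k ω * conj (Z l ω) ∂P = if k = l then 1 else 0

namespace IsStandardGaussian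

variable {Z : κ → Ω → ℂ} (hZ : IsStandardGaussian P Z)
include hZ

theorem memLp (k : κ) (p : ENNReal) (hp : p ≠ ⊤) : MemLp (Z k) p P :=
  (hZ.gaussian.eval k).memLp hp

theorem integrable_mul (k l : κ) : Integrable (fun ω => Z k ω * Z l ω) P :=
  memLp_one_iff_integrable.1 (memLp_mul (fun p hp => (hZ.gaussian.eval k).memLp hp)
    (fun p hp => (hZ.gaussian.eval l).memLp hp) 1 (by simp))

theorem integrable_mul_conj (k l : κ) : Integrable (fun ω => Z k ω * conj (Z l ω)) P :=
  memLp_one_iff_integrable.1 (memLp_mul (fun p hp => (hZ.gaussian.eval k).memLp hp)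
    (fun p hp => ((hZ.gaussian.eval l).memLp hp).star) 1 (by simp))

/-- The real and imaginary parts. -/
def _root_.ComplexWiener.realParts (Z : κ → Ω → ℂ) (t : κ ⊕ κ) (ω : Ω) : ℝ :=
  Sum.elim (fun k => (Z k ω).re) (fun k => (Z k ω).im) t

theorem gaussian_realParts [Fintype κ] : HasGaussianLaw (fun ω => (realParts Z · ω)) P := by
  let L : (κ → ℂ) →L[ℝ] κ ⊕ κ → ℝ := ContinuousLinearMap.pi fun t : κ ⊕ κ => Sum.elim
    (fun k => Complex.reCLM ∘L ContinuousLinearMap.proj (R := ℝ) (φ := fun _ : κ => ℂ) k)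
    (fun k => Complex.imCLM ∘L ContinuousLinearMap.proj (R := ℝ) (φ := fun _ : κ => ℂ) k) t
  have he : L ∘ (fun ω => (Z · ω)) = fun ω => (realParts Z · ω) := by
    funext ω t
    rcases t with k | k <;> rfl
  have h := hZ.gaussian.map L
  rw [he] at h
  exact h

theorem integral_realParts (t : κ ⊕ κ) : ∫ ω, realParts Z t ω ∂P = 0 := by
  rcases t with k | k
  · exact (integral_re (𝕜 := ℂ) (hZ.gaussian.eval k).integrable).trans (by simp [hZ.centered k])
  · exact (integral_im (𝕜 := ℂ) (hZ.gaussian.eval k).integrable).trans (by simp [hZ.centered k])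

-- Products of real and imaginary parts are half-sums or half-differences of the real or imaginary
-- parts of Z_k Z_l and Z_k Z̄_l; the first has mean 0. Hence the variance 1/2 of each coordinate.
open Classical in
theorem integral_realParts_mul (s t : κ ⊕ κ) :
    ∫ ω, realParts Z s ω * realParts Z t ω ∂P = if s = t then 1 / 2 else 0 := by
  have h1 (k l : κ) (a b : ℝ) : ∫ ω, (a * (Z k ω * Z l ω).re + b * (Z k ω * conj (Z l ω)).re) ∂P =
      b * if k = l then 1 else 0 := by
    have i1 : Integrable (fun ω => (Z k ω * Z l ω).re) P := (hZ.integrable_mul k l).re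
    have i2 : Integrable (fun ω => (Z k ω * conj (Z l ω)).re) P := (hZ.integrable_mul_conj k l).re
    rw [integral_add (i1.const_mul a) (i2.const_mul b), integral_const_mul, integral_const_mul]
    have e1 := integral_re (𝕜 := ℂ) (hZ.integrable_mul k l)
    have e2 := integral_re (𝕜 := ℂ) (hZ.integrable_mul_conj k l)
    rw [hZ.mul_eq_zero] at e1
    rw [hZ.mul_conj] at e2
    simp only [RCLike.re_eq_complex_re] at e1 e2
    rw [e1, e2]
    split_ifs <;> simp
  have h2 (k l : κ) (a b : ℝ) : ∫ ω, (a * (Z k ω * Z l ω).im + b * (Z k ω * conj (Z l ω)).im) ∂P =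
      0 := by
    have i1 : Integrable (fun ω => (Z k ω * Z l ω).im) P := (hZ.integrable_mul k l).im
    have i2 : Integrable (fun ω => (Z k ω * conj (Z l ω)).im) P := (hZ.integrable_mul_conj k l).im
    rw [integral_add (i1.const_mul a) (i2.const_mul b), integral_const_mul, integral_const_mul]
    have e1 := integral_im (𝕜 := ℂ) (hZ.integrable_mul k l)
    have e2 := integral_im (𝕜 := ℂ) (hZ.integrable_mul_conj k l)
    rw [hZ.mul_eq_zero] at e1
    rw [hZ.mul_conj] at e2
    simp only [RCLike.im_eq_complex_im] at e1 e2
    rw [e1, e2]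
    split_ifs <;> simp
  rcases s with k | k <;> rcases t with l | l
  · convert h1 k l (1 / 2) (1 / 2) using 1
    · congr 1; funext ω; simp [realParts]; ring
    · simp
  · convert h2 k l (1 / 2) (-1 / 2) using 1
    · congr 1; funext ω; simp [realParts]; ring
    · simp
  · convert h2 k l (1 / 2) (1 / 2) using 1
    · congr 1; funext ω; simp [realParts]; ring
    · simp
  · convert h1 k l (-1 / 2) (1 / 2) using 1
    · congr 1; funext ω; simp [realParts]; ring
    · simp

variable [Fintype κ]

theorem memLp_realParts (t : κ ⊕ κ) (p : ENNReal) (hp : p ≠ ⊤) :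
    MemLp (fun ω => (realParts Z t ω : ℂ)) p P :=
  ((hZ.gaussian_realParts.eval t).memLp hp).ofReal

variable [IsProbabilityMeasure P]

open Classical in
theorem covariance_realParts (s t : κ ⊕ κ) :
    cov[realParts Z s, realParts Z t; P] = if s = t then 1 / 2 else 0 := by
  have h := hZ.gaussian_realParts
  rw [covariance_eq_sub (h.eval s).memLp_two (h.eval t).memLp_two, hZ.integral_realParts s,
    zero_mul, sub_zero]
  exact hZ.integral_realParts_mul s t

theorem iIndepFun_realParts : iIndepFun (realParts Z) P :=
  hZ.gaussian_realParts.iIndepFun_of_covariance_eq_zero fun s t hst => by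
    rw [hZ.covariance_realParts, if_neg hst]

open scoped NNReal in
theorem map_realParts (t : κ ⊕ κ) : P.map (realParts Z t) = gaussianReal 0 (1 / 2) := by
  have h := hZ.gaussian_realParts.eval t
  rw [h.map_eq_gaussianReal, hZ.integral_realParts, ← covariance_self h.aemeasurable,
    hZ.covariance_realParts, if_pos rfl]
  congr 1
  ext
  norm_num

theorem zExpect_eq (Q : ZPoly κ) : zExpect P Z hZ.memLp Q =
    polyExpect P (fun t ω => (realParts Z t ω : ℂ)) hZ.memLp_realParts (realCoord Q) := by
  rw [zExpect_apply, polyExpect_apply]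
  congr 1
  funext ω
  exact (aeval_realCoord _ Q).symm

theorem isPosGaussianFunctional : IsPosGaussianFunctional (zExpect P Z hZ.memLp) where
  map_one := by simp [zExpect_apply]
  map_X_mul t Q := by
    have key (t : κ ⊕ κ) (Q : MvPolynomial (κ ⊕ κ) ℂ) := polyExpect_X_mul (by norm_num)
      hZ.iIndepFun_realParts (fun t => (hZ.gaussian_realParts.eval t).aemeasurable)
      hZ.map_realParts hZ.memLp_realParts t Q
    rw [hZ.zExpect_eq, hZ.zExpect_eq, map_mul]
    -- With variance 1/2, real integration by parts turns z_k = x_k + i y_k into (∂_x + i ∂_y)/2 =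
    -- ∂_{z̄}, and z̄_k into the conjugate operator.
    rcases t with k | k
    · rw [realCoord_X_inl, add_mul, mul_assoc, ← smul_eq_C_mul, map_add, map_smul, key, key,
        pderiv_inl_realCoord, pderiv_inr_realCoord, ← smul_eq_C_mul, map_smul, map_add, map_sub,
        smul_eq_mul, smul_eq_mul, Sum.swap_inl]
      linear_combination (norm := (push_cast; ring_nf)) ((1 / 2 : ℂ) *
        (polyExpect P (fun t ω => (realParts Z t ω : ℂ)) hZ.memLp_realParts
          (realCoord (pd (Sum.inl k) Q)) - polyExpect P (fun t ω => (realParts Z t ω : ℂ))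
          hZ.memLp_realParts (realCoord (pd (Sum.inr k) Q)))) * Complex.I_sq
    · rw [realCoord_X_inr, sub_mul, mul_assoc, ← smul_eq_C_mul, map_sub, map_smul, key, key,
        pderiv_inl_realCoord, pderiv_inr_realCoord, ← smul_eq_C_mul, map_smul, map_add, map_sub,
        smul_eq_mul, smul_eq_mul, Sum.swap_inr]
      linear_combination (norm := (push_cast; ring_nf)) (-(1 / 2 : ℂ) *
        (polyExpect P (fun t ω => (realParts Z t ω : ℂ)) hZ.memLp_realParts
          (realCoord (pd (Sum.inl k) Q)) - polyExpect P (fun t ω => (realParts Z t ω : ℂ))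
          hZ.memLp_realParts (realCoord (pd (Sum.inr k) Q)))) * Complex.I_sq
  nonneg Q := by
    rw [zExpect_apply]
    have (ω : Ω) : aeval (zVal fun k => Z k ω) (Q * cj Q) =
        ((‖aeval (zVal fun k => Z k ω) Q‖ ^ 2 : ℝ) : ℂ) := by
      rw [map_mul, aeval_cj, Complex.mul_conj, Complex.normSq_eq_norm_sq]
    simp only [this]
    rw [integral_complex_ofReal, Complex.ofReal_re]
    exact integral_nonneg fun _ => sq_nonneg _

end IsStandardGaussian

/-! ### Isonormal processes -/

variable {H : Type*} [NormedAddCommGroup H] [InnerProductSpace ℂ H] {Z : H → Ω → ℂ}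

namespace IsIsonormal

variable (hZ : IsIsonormal P Z)
include hZ

theorem memLp (h : H) (p : ENNReal) (hp : p ≠ ⊤) : MemLp (Z h) p P :=
  (hZ.gaussian.hasGaussianLaw_eval h).memLp hp

theorem integrable_mul_conj (g h : H) : Integrable (fun ω => Z g ω * conj (Z h ω)) P :=
  memLp_one_iff_integrable.1 (memLp_mul (hZ.memLp g) (fun p hp => (hZ.memLp h p hp).star) 1
    (by simp))

theorem integrable_mul (g h : H) : Integrable (fun ω => Z g ω * Z h ω) P :=
  memLp_one_iff_integrable.1 (memLp_mul (hZ.memLp g) (hZ.memLp h) 1 (by simp))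

/-- Additivity is not assumed: the covariance alone gives E|Z(g+h) - Z(g) - Z(h)|² = 0. It is needed
to polarize the condition E[Z(h)²] = 0. -/
theorem map_add_ae (g h : H) : Z (g + h) =ᵐ[P] fun ω => Z g ω + Z h ω := by
  have hi := hZ.integrable_mul_conj
  have h0 : ∫ ω, ‖Z (g + h) ω - (Z g ω + Z h ω)‖ ^ 2 ∂P = 0 := by
    have e : ∫ ω, ((‖Z (g + h) ω - (Z g ω + Z h ω)‖ ^ 2 : ℝ) : ℂ) ∂P = 0 := by
      have e1 (ω : Ω) : ((‖Z (g + h) ω - (Z g ω + Z h ω)‖ ^ 2 : ℝ) : ℂ) =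
          (Z (g + h) ω * conj (Z (g + h) ω) - Z (g + h) ω * conj (Z g ω) -
            Z (g + h) ω * conj (Z h ω)) -
          (Z g ω * conj (Z (g + h) ω) - Z g ω * conj (Z g ω) - Z g ω * conj (Z h ω)) -
          (Z h ω * conj (Z (g + h) ω) - Z h ω * conj (Z g ω) - Z h ω * conj (Z h ω)) := by
        rw [← Complex.normSq_eq_norm_sq, ← Complex.mul_conj]
        simp only [map_sub, map_add]
        ring
      simp only [e1]
      have hj (a : H) : Integrable (fun ω => Z a ω * conj (Z (g + h) ω) - Z a ω * conj (Z g ω) -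
          Z a ω * conj (Z h ω)) P := ((hi _ _).sub (hi _ _)).sub (hi _ _)
      have hk (a : H) : ∫ ω, (Z a ω * conj (Z (g + h) ω) - Z a ω * conj (Z g ω) -
          Z a ω * conj (Z h ω)) ∂P = 0 := by
        have h2 : Integrable (fun ω => Z a ω * conj (Z (g + h) ω) - Z a ω * conj (Z g ω)) P :=
          (hi _ _).sub (hi _ _)
        rw [integral_sub h2 (hi _ _), integral_sub (hi _ _) (hi _ _)]
        simp only [hZ.covariance, inner_add_left]
        ring
      have h3 : Integrable (fun ω =>
          (Z (g + h) ω * conj (Z (g + h) ω) - Z (g + h) ω * conj (Z g ω) -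
            Z (g + h) ω * conj (Z h ω)) -
          (Z g ω * conj (Z (g + h) ω) - Z g ω * conj (Z g ω) - Z g ω * conj (Z h ω))) P :=
        (hj _).sub (hj _)
      rw [integral_sub h3 (hj _), integral_sub (hj _) (hj _), hk, hk, hk]
      simp
    rw [integral_complex_ofReal] at e
    exact_mod_cast e
  have hint : Integrable (fun ω => ‖Z (g + h) ω - (Z g ω + Z h ω)‖ ^ 2) P :=
    (((hZ.memLp _ 2 (by simp)).sub ((hZ.memLp _ 2 (by simp)).add
      (hZ.memLp _ 2 (by simp))))).integrable_norm_pow (by norm_num)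
  rw [integral_eq_zero_iff_of_nonneg (fun _ => sq_nonneg _) hint] at h0
  filter_upwards [h0] with ω hω
  simpa [sub_eq_zero] using hω

/-- Polarization: expand E[Z(g+h)²] = 0. -/
theorem mul_eq_zero (g h : H) : ∫ ω, Z g ω * Z h ω ∂P = 0 := by
  have h1 := hZ.sq_eq_zero (g + h)
  have h2 : ∫ ω, Z (g + h) ω ^ 2 ∂P =
      ∫ ω, (Z g ω ^ 2 + Z h ω ^ 2 + 2 * (Z g ω * Z h ω)) ∂P := by
    refine integral_congr_ae ?_
    filter_upwards [hZ.map_add_ae g h] with ω hω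
    rw [hω]
    ring
  have hsq (a : H) : Integrable (fun ω => Z a ω ^ 2) P := by
    simpa only [sq] using hZ.integrable_mul a a
  have h3 : Integrable (fun ω => Z g ω ^ 2 + Z h ω ^ 2) P := (hsq g).add (hsq h)
  rw [h2, integral_add h3 ((hZ.integrable_mul g h).const_mul 2),
    integral_add (hsq g) (hsq h), hZ.sq_eq_zero, hZ.sq_eq_zero, integral_const_mul] at h1
  simpa using h1

theorem isStandardGaussian {e : κ → H} (he : Orthonormal ℂ e) [Finite κ] :
    IsStandardGaussian P fun k => Z (e k) where
  gaussian := by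
    classical
    have := Fintype.ofFinite κ
    have h := (hZ.gaussian.comp_right e).hasGaussianLaw Finset.univ
    exact h.map (ContinuousLinearMap.pi fun k : κ =>
      ContinuousLinearMap.proj (R := ℝ) (φ := fun _ : (Finset.univ : Finset κ) => ℂ)
        ⟨k, Finset.mem_univ k⟩)
  centered k := hZ.centered _
  mul_eq_zero k l := hZ.mul_eq_zero _ _
  mul_conj k l := by
    classical
    rw [hZ.covariance, orthonormal_iff_ite.1 he l k]
    simp only [eq_comm]

end IsIsonormal

end ComplexGaussian

/-! ### Complex Hermite polynomials as Wick powers -/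

section Hermite

theorem hermite_eq_sum {a b N : ℕ} (hN : min a b < N) (z : ℂ) (ρ : ℝ) : hermite a b z ρ =
    ∑ r ∈ Finset.range N, (-1) ^ r * (r.factorial : ℂ) * (a.choose r : ℂ) * (b.choose r : ℂ) *
      z ^ (a - r) * (conj z) ^ (b - r) * (ρ : ℂ) ^ r := by
  refine Finset.sum_subset (Finset.range_subset_range.2 hN) fun r _ hr => ?_
  rw [Finset.mem_range, not_lt] at hr
  rcases min_lt_iff.1 (Nat.lt_of_succ_le hr) with h | h <;> simp [Nat.choose_eq_zero_of_lt h]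

theorem hermite_zero_left (b : ℕ) (z : ℂ) (ρ : ℝ) : hermite 0 b z ρ = conj z ^ b := by
  simp [hermite]

/-- Pascal's rule in the first binomial coefficient. For ρ = 1 this is the action of the creation
operator of z, which identifies Hermite polynomials with Wick powers. -/
theorem hermite_succ_left (a b : ℕ) (z : ℂ) (ρ : ℝ) : hermite (a + 1) b z ρ =
    z * hermite a b z ρ - ρ * b * hermite a (b - 1) z ρ := by
  -- For r > a the truncated exponents do not match, but the binomial coefficient vanishes.
  have hz (r : ℕ) : (a.choose r : ℂ) * z ^ (a + 1 - r) = a.choose r * (z * z ^ (a - r)) := by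
    rcases le_or_gt r a with h | h
    · rw [Nat.succ_sub h, pow_succ']
    · simp [Nat.choose_eq_zero_of_lt h]
  rw [hermite_eq_sum (N := a + b + 2) (by omega), hermite_eq_sum (N := a + b + 2) (by omega),
    hermite_eq_sum (N := a + b + 1) (by omega), Finset.sum_range_succ' _ (a + b + 1),
    Finset.sum_range_succ' _ (a + b + 1), mul_add, Finset.mul_sum, Finset.mul_sum, add_sub_right_comm, ← Finset.sum_sub_distrib]
  congr 1
  · refine Finset.sum_congr rfl fun r _ => ?_
    have hb : ((r + 1).factorial : ℂ) * (b.choose (r + 1) : ℂ) =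
        r.factorial * (b * (b - 1).choose r) := by
      rcases b with _ | b
      · simp
      · have := Nat.add_one_mul_choose_eq b r
        rw [Nat.factorial_succ, Nat.add_sub_cancel]
        push_cast
        have h2 : ((b : ℂ) + 1) * b.choose r = (b + 1).choose (r + 1) * (r + 1) := by
          exact_mod_cast this
        rw [h2]
        ring
    have h1 : a + 1 - (r + 1) = a - r := by omega
    have h2 : b - 1 - r = b - (r + 1) := by omega
    have h3 := hz (r + 1)
    rw [h1] at h3
    rw [Nat.choose_succ_succ, h1, h2]
    push_cast
    linear_combination ((-1) ^ (r + 1) * ρ ^ (r + 1) * conj z ^ (b - (r + 1)) *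
        (r.factorial * (b * (b - 1).choose r))) * h3 +
      ((-1) ^ (r + 1) * ρ ^ (r + 1) * conj z ^ (b - (r + 1)) *
        (a.choose r * z ^ (a - r) + a.choose (r + 1) * z ^ (a - r) -
          a.choose (r + 1) * (z * z ^ (a - (r + 1))))) * hb
  · simp [pow_succ']
    ring

/-- Homogeneity: scaling z by √2 and ρ by 2 multiplies every term by √2 ^ (a + b). The normalization
in the definition of the integral is thus Wick ordering for E|Z|² = 1. -/
theorem hermite_scale (a b : ℕ) (z : ℂ) :
    ((√(2 ^ (a + b)) : ℝ) : ℂ)⁻¹ * hermite a b ((√2 : ℝ) * z) 2 = hermite a b z 1 := by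
  have h0 : ((√2 : ℝ) : ℂ) ≠ 0 := by
    have : (0 : ℝ) < √2 := by positivity
    exact_mod_cast this.ne'
  have h1 : ((√(2 ^ (a + b)) : ℝ) : ℂ) = ((√2 : ℝ) : ℂ) ^ (a + b) := by
    have h : (2 : ℝ) ^ (a + b) = (√2 ^ (a + b)) ^ 2 := by
      rw [← pow_mul, mul_comm, pow_mul, Real.sq_sqrt (by norm_num)]
    rw [← Complex.ofReal_pow, h, Real.sqrt_sq (by positivity)]
  rw [hermite, hermite, Finset.mul_sum]
  refine Finset.sum_congr rfl fun r hr => ?_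
  have hr' : r ≤ min a b := Nat.lt_succ_iff.1 (Finset.mem_range.1 hr)
  have ha := hr'.trans (min_le_left _ _)
  have hb := hr'.trans (min_le_right _ _)
  have h2 : ((2 : ℝ) : ℂ) = ((√2 : ℝ) : ℂ) ^ 2 := by
    rw [← Complex.ofReal_pow, Real.sq_sqrt (by norm_num)]
  rw [h1, h2, inv_mul_eq_iff_eq_mul₀ (pow_ne_zero _ h0), map_mul, Complex.conj_ofReal, mul_pow,
    mul_pow, ← pow_mul, show a + b = (a - r) + (b - r) + 2 * r by omega, pow_add, pow_add]
  simp only [Complex.ofReal_one, one_pow]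
  ring

variable {κ : Type*}

theorem pd_pow_mul (t : κ ⊕ κ) (b : ℕ) {R : ZPoly κ} (hR : pd t R = 0) :
    pd t (X t ^ b * R) = (b : ℂ) • (X t ^ (b - 1) * R) := by
  rw [pd_mul, hR, mul_zero, add_zero, pd_apply, pderiv_pow, pderiv_X_self, mul_one, smul_eq_C_mul,
    mul_assoc]
  simp

theorem pd_pow_mul_of_ne {s t : κ ⊕ κ} (h : t ≠ s) (b : ℕ) (R : ZPoly κ) :
    pd s (X t ^ b * R) = X t ^ b * pd s R := by
  classical
  rw [pd_mul, pd_apply, pderiv_pow, pderiv_X_of_ne h]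
  simp

/-- R does not involve the k-th pair of variables, so the recursion in a and b runs in that pair
alone; this factorizes Wick monomials over the indices. -/
theorem aeval_wick_pow_mul_pow (z : κ → ℂ) (k : κ) {R : ZPoly κ} (h : pd (Sum.inl k) R = 0)
    (h' : pd (Sum.inr k) R = 0) (a b : ℕ) :
    aeval (zVal z) (wick (X (Sum.inl k) ^ a * (X (Sum.inr k) ^ b * R))) =
      hermite a b (z k) 1 * aeval (zVal z) (wick R) := by
  induction a generalizing b with
  | zero =>
    rw [hermite_zero_left, pow_zero, one_mul]
    induction b with
    | zero => simp
    | succ b ih =>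
      rw [pow_succ', mul_assoc, wick_X_mul, pd_wick, Sum.swap_inr,
        pd_pow_mul_of_ne (by simp), h, mul_zero, map_zero, sub_zero, map_mul, ih, aeval_X, pow_succ',
        mul_assoc]
      rfl
  | succ a ih =>
    rw [pow_succ', mul_assoc, wick_X_mul, pd_wick, Sum.swap_inl,
      pd_pow_mul_of_ne (by simp), pd_pow_mul _ _ h', mul_smul_comm, map_smul, map_sub, map_mul,
      map_smul, ih, ih, aeval_X, hermite_succ_left]
    simp only [zVal, Sum.elim_inl, smul_eq_mul, Complex.ofReal_one]
    ring

theorem pd_prod_eq_zero {s : Finset κ} (a b : κ → ℕ) {k : κ} (hk : k ∉ s) {t : κ ⊕ κ}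
    (ht : t = Sum.inl k ∨ t = Sum.inr k) :
    pd t (∏ j ∈ s, (X (Sum.inl j) ^ a j * X (Sum.inr j) ^ b j) : ZPoly κ) = 0 := by
  classical
  induction s using Finset.induction_on with
  | empty => simp
  | insert j s hj ih =>
    rw [Finset.mem_insert, not_or] at hk
    have hne : j ≠ k := fun h => hk.1 h.symm
    rw [Finset.prod_insert hj, mul_assoc, pd_pow_mul_of_ne, pd_pow_mul_of_ne, ih hk.2]
    · simp
    · rcases ht with rfl | rfl <;> simp [hne]
    · rcases ht with rfl | rfl <;> simp [hne]

theorem aeval_wick_prod (z : κ → ℂ) (s : Finset κ) (a b : κ → ℕ) :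
    aeval (zVal z) (wick (∏ k ∈ s, (X (Sum.inl k) ^ a k * X (Sum.inr k) ^ b k))) =
      ∏ k ∈ s, hermite (a k) (b k) (z k) 1 := by
  classical
  induction s using Finset.induction_on with
  | empty => simp [wick_one]
  | insert k s hk ih =>
    rw [Finset.prod_insert hk, Finset.prod_insert hk, mul_assoc, aeval_wick_pow_mul_pow, ih]
    · exact pd_prod_eq_zero a b hk (Or.inl rfl)
    · exact pd_prod_eq_zero a b hk (Or.inr rfl)

theorem mon_eq_prod (s : κ → κ ⊕ κ) {a : ℕ} (α : Fin a → κ) {S : Finset κ} (hS : ∀ p, α p ∈ S) :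
    mon s α = ∏ k ∈ S, X (s k) ^ multiplicity α k := by
  classical
  rw [mon, ← Finset.prod_fiberwise_of_maps_to (fun p _ => hS p)]
  refine Finset.prod_congr rfl fun k _ => ?_
  rw [Finset.prod_congr rfl (g := fun _ => X (s k)) (fun p hp => by
    rw [(Finset.mem_filter.1 hp).2]), Finset.prod_const, multiplicity, Nat.card_eq_fintype_card,
    Fintype.card_subtype]

theorem aeval_wick_mon (z : κ → ℂ) {m n : ℕ} (α : Fin m → κ) (β : Fin n → κ) :
    aeval (zVal z) (wick (mon Sum.inl α * mon Sum.inr β)) = ∏ k ∈ occurring α β,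
      ((√(2 ^ (multiplicity α k + multiplicity β k)) : ℝ) : ℂ)⁻¹ *
      hermite (multiplicity α k) (multiplicity β k) ((√2 : ℝ) * z k) 2 := by
  classical
  rw [mon_eq_prod Sum.inl α (S := occurring α β) (fun p => by simp [occurring]),
    mon_eq_prod Sum.inr β (S := occurring α β) (fun p => by simp [occurring]),
    ← Finset.prod_mul_distrib, aeval_wick_prod]
  exact Finset.prod_congr rfl fun k _ => (hermite_scale _ _ _).symm

end Hermite

/-! ### Continuity of contractions -/

section Continuity

variable {ι : Type*} {a b c d : ℕ}

theorem norm_tsum_mul_sq_le {K : Type*} {F G : K → ℂ} (hF : Summable fun k => ‖F k‖ ^ 2)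
    (hG : Summable fun k => ‖G k‖ ^ 2) : Summable (fun k => F k * G k) ∧
      ‖∑' k, F k * G k‖ ^ 2 ≤ (∑' k, ‖F k‖ ^ 2) * ∑' k, ‖G k‖ ^ 2 := by
  have key := Real.inner_le_Lp_mul_Lq_tsum_of_nonneg (p := 2) (q := 2)
    (f := fun k => ‖F k‖) (g := fun k => ‖G k‖)
    (by constructor <;> norm_num) (fun _ => norm_nonneg _) (fun _ => norm_nonneg _)
    (by simpa using hF) (by simpa using hG)
  have hs := Real.summable_mul_of_Lp_Lq_of_nonneg (p := 2) (q := 2)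
    (f := fun k => ‖F k‖) (g := fun k => ‖G k‖)
    (by constructor <;> norm_num) (fun _ => norm_nonneg _) (fun _ => norm_nonneg _)
    (by simpa using hF) (by simpa using hG)
  simp only [← norm_mul] at hs key
  refine ⟨hs.of_norm, ?_⟩
  have h2 := (norm_tsum_le_tsum_norm hs).trans key
  simp only [Real.rpow_two, ← Real.sqrt_eq_rpow] at h2
  calc ‖∑' k, F k * G k‖ ^ 2
      ≤ (√(∑' k, ‖F k‖ ^ 2) * √(∑' k, ‖G k‖ ^ 2)) ^ 2 := by gcongr
    _ = _ := by
      rw [mul_pow, Real.sq_sqrt (tsum_nonneg fun _ => sq_nonneg _),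
        Real.sq_sqrt (tsum_nonneg fun _ => sq_nonneg _)]

theorem tsum_norm_tsum_mul_sq_le {A B K : Type*} {F : A × K → ℂ} {G : B × K → ℂ}
    (hF : Summable fun x => ‖F x‖ ^ 2) (hG : Summable fun x => ‖G x‖ ^ 2) :
    ∑' x : A × B, ‖∑' k, F (x.1, k) * G (x.2, k)‖ ^ 2 ≤ (∑' x, ‖F x‖ ^ 2) * ∑' x, ‖G x‖ ^ 2 := by
  have h := hF.prod.mul_of_nonneg hG.prod (fun _ => tsum_nonneg fun _ => sq_nonneg _)
    (fun _ => tsum_nonneg fun _ => sq_nonneg _)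
  rw [hF.tsum_prod, hG.tsum_prod, hF.prod.tsum_mul_tsum hG.prod h]
  exact (summable_sq_tsum_mul hF hG).tsum_le_tsum
    (fun x => (norm_tsum_mul_sq_le (hF.prod_factor x.1) (hG.prod_factor x.2)).2) h

namespace Kernel

/-- The pairs of index lists that occur in the first factor of a contraction. -/
def contractLeft {i j : ℕ} (hia : i ≤ a) (hjb : j ≤ b)
    (x : ((Fin (a - i) → ι) × (Fin (b - j) → ι)) × ((Fin i → ι) × (Fin j → ι))) :
    (Fin a → ι) × (Fin b → ι) := (join hia x.1.1 x.2.1, join hjb x.1.2 x.2.2)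

/-- The pairs of index lists that occur in the second factor of a contraction. -/
def contractRight {i j : ℕ} (hjc : j ≤ c) (hid : i ≤ d)
    (x : ((Fin (c - j) → ι) × (Fin (d - i) → ι)) × ((Fin i → ι) × (Fin j → ι))) :
    (Fin c → ι) × (Fin d → ι) := (join hjc x.1.1 x.2.2, join hid x.1.2 x.2.1)

theorem contractLeft_injective {i j : ℕ} (hia : i ≤ a) (hjb : j ≤ b) :
    Function.Injective (contractLeft (ι := ι) hia hjb) := by
  rintro ⟨⟨t, s⟩, u, v⟩ ⟨⟨t', s'⟩, u', v'⟩ h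
  simp only [contractLeft, Prod.mk.injEq] at h
  obtain ⟨rfl, rfl⟩ := join_injective hia h.1
  obtain ⟨rfl, rfl⟩ := join_injective hjb h.2
  rfl

theorem contractRight_injective {i j : ℕ} (hjc : j ≤ c) (hid : i ≤ d) :
    Function.Injective (contractRight (ι := ι) hjc hid) := by
  rintro ⟨⟨t, s⟩, u, v⟩ ⟨⟨t', s'⟩, u', v'⟩ h
  simp only [contractRight, Prod.mk.injEq] at h
  obtain ⟨rfl, rfl⟩ := join_injective hjc h.1
  obtain ⟨rfl, rfl⟩ := join_injective hid h.2
  rfl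

/-- The free indices of the two factors of a contraction. -/
def freeIndices (i j : ℕ) (p : (Fin ((a - i) + (c - j)) → ι) × (Fin ((b - j) + (d - i)) → ι)) :
    ((Fin (a - i) → ι) × (Fin (b - j) → ι)) × ((Fin (c - j) → ι) × (Fin (d - i) → ι)) :=
  ((p.1 ∘ Fin.castAdd (c - j), p.2 ∘ Fin.castAdd (d - i)),
    (p.1 ∘ Fin.natAdd (a - i), p.2 ∘ Fin.natAdd (b - j)))

theorem freeIndices_injective (i j : ℕ) :
    Function.Injective (freeIndices (ι := ι) (a := a) (b := b) (c := c) (d := d) i j) := by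
  rintro ⟨T, S⟩ ⟨T', S'⟩ hp
  simp only [freeIndices, Prod.mk.injEq] at hp
  obtain ⟨⟨h1, h2⟩, h3, h4⟩ := hp
  refine Prod.ext (funext fun x => ?_) (funext fun x => ?_)
  · exact Fin.addCases (fun y => congrFun h1 y) (fun y => congrFun h3 y) x
  · exact Fin.addCases (fun y => congrFun h2 y) (fun y => congrFun h4 y) x

variable {i j : ℕ} (hia : i ≤ a) (hjb : j ≤ b) (hjc : j ≤ c) (hid : i ≤ d)

theorem contract_eq_tsum (f : Kernel ι a b) (g : Kernel ι c d) (p) :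
    f.contract g i j hia hjb hjc hid p = ∑' k,
      f (contractLeft hia hjb ((freeIndices i j p).1, k)) *
      g (contractRight hjc hid ((freeIndices i j p).2, k)) := rfl

theorem summable_contract (f : Kernel ι a b) (g : Kernel ι c d)
    (p : (Fin ((a - i) + (c - j)) → ι) × (Fin ((b - j) + (d - i)) → ι)) :
    Summable fun k => f (contractLeft hia hjb ((freeIndices i j p).1, k)) *
      g (contractRight hjc hid ((freeIndices i j p).2, k)) :=
  (norm_tsum_mul_sq_le
    ((f.summable_sq.comp_injective (contractLeft_injective hia hjb)).prod_factor _)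
    ((g.summable_sq.comp_injective (contractRight_injective hjc hid)).prod_factor _)).1

theorem norm_contract_le (f : Kernel ι a b) (g : Kernel ι c d) :
    ‖f.contract g i j hia hjb hjc hid‖ ≤ ‖f‖ * ‖g‖ := by
  refine (sq_le_sq₀ (norm_nonneg _) (by positivity)).1 ?_
  have hf := f.summable_sq.comp_injective (contractLeft_injective hia hjb)
  have hg := g.summable_sq.comp_injective (contractRight_injective hjc hid)
  rw [mul_pow, norm_sq_eq_tsum, norm_sq_eq_tsum, norm_sq_eq_tsum]
  have h1 := tsum_comp_le_tsum_of_inj (summable_sq_tsum_mul hf hg) (fun _ => sq_nonneg _)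
    (freeIndices_injective i j)
  have h2 := tsum_norm_tsum_mul_sq_le hf hg
  have h3 := tsum_comp_le_tsum_of_inj f.summable_sq (fun _ => sq_nonneg _)
    (contractLeft_injective hia hjb)
  have h4 := tsum_comp_le_tsum_of_inj g.summable_sq (fun _ => sq_nonneg _)
    (contractRight_injective hjc hid)
  refine le_trans (le_of_eq ?_) (h1.trans (h2.trans (mul_le_mul h3 h4
    (tsum_nonneg fun _ => sq_nonneg _) (tsum_nonneg fun _ => sq_nonneg _))))
  refine tsum_congr fun p => ?_
  rw [contract_eq_tsum]
  rfl

/-- The contraction as a continuous bilinear map. -/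
def contractL : Kernel ι a b →L[ℂ] Kernel ι c d →L[ℂ]
    Kernel ι ((a - i) + (c - j)) ((b - j) + (d - i)) :=
  LinearMap.mkContinuous₂ (LinearMap.mk₂ ℂ (fun f g => f.contract g i j hia hjb hjc hid)
    (fun f f' g => by
      ext p
      simp only [lp.coeFn_add, Pi.add_apply, contract_eq_tsum, add_mul]
      exact (summable_contract hia hjb hjc hid f g p).tsum_add
        (summable_contract hia hjb hjc hid f' g p))
    (fun r f g => by
      ext p
      simp only [lp.coeFn_smul, Pi.smul_apply, contract_eq_tsum, smul_eq_mul, mul_assoc]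
      exact tsum_mul_left)
    (fun f g g' => by
      ext p
      simp only [lp.coeFn_add, Pi.add_apply, contract_eq_tsum, mul_add]
      exact (summable_contract hia hjb hjc hid f g p).tsum_add
        (summable_contract hia hjb hjc hid f g' p))
    (fun r f g => by
      ext p
      simp only [lp.coeFn_smul, Pi.smul_apply, contract_eq_tsum, smul_eq_mul, mul_left_comm _ r]
      exact tsum_mul_left)) 1
    (fun f g => by
      rw [one_mul]
      exact norm_contract_le hia hjb hjc hid f g)

theorem continuous_contract : Continuous fun x : Kernel ι a b × Kernel ι c d =>
    x.1.contract x.2 i j hia hjb hjc hid :=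
  (contractL hia hjb hjc hid).continuous₂

theorem norm_revConj (f : Kernel ι a b) : ‖f.revConj‖ = ‖f‖ := by
  refine (sq_eq_sq₀ (norm_nonneg _) (norm_nonneg _)).1 ?_
  rw [norm_sq_eq_tsum, norm_sq_eq_tsum, ← (Equiv.prodComm _ _).tsum_eq fun p => ‖f p‖ ^ 2]
  simp only [revConj_apply, RCLike.norm_conj]
  rfl

theorem revConj_sub (f g : Kernel ι a b) : (f - g).revConj = f.revConj - g.revConj := by
  ext p
  simp

theorem continuous_revConj : Continuous (Kernel.revConj : Kernel ι a b → Kernel ι b a) :=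
  (LipschitzWith.of_dist_le_mul (K := 1) fun f g => by
    rw [dist_eq_norm, dist_eq_norm, ← revConj_sub, norm_revConj, NNReal.coe_one, one_mul]).continuous

theorem symmetrize_sub (f g : Kernel ι a b) :
    (f - g).symmetrize = f.symmetrize - g.symmetrize := by
  ext p
  simp only [lp.coeFn_sub, Pi.sub_apply, symmetrize_apply, Finset.sum_sub_distrib, mul_sub]

theorem continuous_symmetrize : Continuous (Kernel.symmetrize : Kernel ι a b → Kernel ι a b) :=
  (LipschitzWith.of_dist_le_mul (K := 1) fun f g => by
    rw [dist_eq_norm, dist_eq_norm, ← symmetrize_sub, NNReal.coe_one, one_mul]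
    exact norm_symmetrize_le _).continuous

theorem continuous_sum_ite {M N : ℕ} {X : Type*} [TopologicalSpace X] {p : ℕ → ℕ → Prop}
    [∀ i j, Decidable (p i j)] {φ : Fin M → Fin N → X → ℝ} (hφ : ∀ i j, Continuous (φ i j)) :
    Continuous fun x => ∑ i : Fin M, ∑ j : Fin N, if p i j then φ i j x else 0 := by
  refine continuous_finsetSum _ fun i _ => continuous_finsetSum _ fun j _ => ?_
  split_ifs
  exacts [hφ i j, continuous_const]

theorem continuous_sumContractRevConj :
    Continuous (Kernel.sumContractRevConj : Kernel ι a b → ℝ) :=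
  continuous_sum_ite (p := fun i j => 0 < i + j ∧ i + j < a + b)
    (φ := fun (i : Fin (a + 1)) (j : Fin (b + 1)) f =>
      ‖Kernel.contract f (Kernel.revConj f) i j i.is_le j.is_le j.is_le i.is_le‖ ^ 2)
    fun i j => (((continuous_contract i.is_le j.is_le j.is_le i.is_le).comp
      (continuous_id.prodMk continuous_revConj)).norm).pow 2

theorem continuous_sumSymmContractRevConj :
    Continuous (Kernel.sumSymmContractRevConj : Kernel ι a b → ℝ) :=
  continuous_sum_ite (p := fun i j => 0 < i + j ∧ i + j < a + b)
    (φ := fun (i : Fin (a + 1)) (j : Fin (b + 1)) f =>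
      ‖(Kernel.contract f (Kernel.revConj f) i j i.is_le j.is_le j.is_le i.is_le).symmetrize‖ ^ 2)
    fun i j => ((continuous_symmetrize.comp
      ((continuous_contract i.is_le j.is_le j.is_le i.is_le).comp
      (continuous_id.prodMk continuous_revConj))).norm).pow 2

theorem continuous_sumContractSelf :
    Continuous (Kernel.sumContractSelf : Kernel ι a b → ℝ) :=
  continuous_sum_ite (p := fun i j => 0 < i + j ∧ i + j < 2 * min a b)
    (φ := fun (i : Fin (min a b + 1)) (j : Fin (min a b + 1)) f =>
      ‖Kernel.contract f f i j (i.is_le.trans (min_le_left a b)) (j.is_le.trans (min_le_right a b))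
        (j.is_le.trans (min_le_left a b)) (i.is_le.trans (min_le_right a b))‖ ^ 2)
    fun i j => (((continuous_contract (i.is_le.trans (min_le_left a b))
      (j.is_le.trans (min_le_right a b)) (j.is_le.trans (min_le_left a b))
      (i.is_le.trans (min_le_right a b))).comp (continuous_id.prodMk continuous_id)).norm).pow 2

theorem continuous_sumSymmContractSelf :
    Continuous (Kernel.sumSymmContractSelf : Kernel ι a b → ℝ) :=
  continuous_sum_ite (p := fun i j => 0 < i + j ∧ i + j < 2 * min a b)
    (φ := fun (i : Fin (min a b + 1)) (j : Fin (min a b + 1)) f =>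
      ‖(Kernel.contract f f i j (i.is_le.trans (min_le_left a b))
        (j.is_le.trans (min_le_right a b)) (j.is_le.trans (min_le_left a b))
        (i.is_le.trans (min_le_right a b))).symmetrize‖ ^ 2)
    fun i j => ((continuous_symmetrize.comp ((continuous_contract
      (i.is_le.trans (min_le_left a b)) (j.is_le.trans (min_le_right a b))
      (j.is_le.trans (min_le_left a b)) (i.is_le.trans (min_le_right a b))).comp
      (continuous_id.prodMk continuous_id))).norm).pow 2

theorem norm_symmetrize_contract_sq_le (f : Kernel ι a b) (g : Kernel ι c d) (hg : ‖g‖ ≤ ‖f‖) :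
    ‖(f.contract g i j hia hjb hjc hid).symmetrize‖ ^ 2 ≤ ‖f‖ ^ 4 := by
  calc ‖(f.contract g i j hia hjb hjc hid).symmetrize‖ ^ 2 ≤ (‖f‖ * ‖f‖) ^ 2 := by
        gcongr
        exact (norm_symmetrize_le _).trans ((norm_contract_le _ _ _ _ _ _).trans (by gcongr))
    _ = ‖f‖ ^ 4 := by ring

/-- Symmetrization and contraction do not increase norms. Serves to turn the cumulant bound into a
fourth moment bound. -/
theorem sumSymmContract_le (f : Kernel ι a b) :
    f.sumSymmContractRevConj + f.sumSymmContractSelf ≤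
      2 * ((a + 1 : ℕ) * ((b + 1 : ℕ) * ‖f‖ ^ 4)) := by
  have h1 : f.sumSymmContractRevConj ≤ (a + 1 : ℕ) * ((b + 1 : ℕ) * ‖f‖ ^ 4) :=
    sum_sum_ite_le (p := fun i j => 0 < i + j ∧ i + j < a + b)
      (φ := fun (i : Fin (a + 1)) (j : Fin (b + 1)) =>
        ‖(Kernel.contract f (Kernel.revConj f) i j i.is_le j.is_le j.is_le i.is_le).symmetrize‖ ^ 2)
      (by positivity) fun i j _ => norm_symmetrize_contract_sq_le _ _ _ _ _ _ f.norm_revConj.le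
  have h2 : f.sumSymmContractSelf ≤
      (min a b + 1 : ℕ) * ((min a b + 1 : ℕ) * ‖f‖ ^ 4) :=
    sum_sum_ite_le (p := fun i j => 0 < i + j ∧ i + j < 2 * min a b)
      (φ := fun (i : Fin (min a b + 1)) (j : Fin (min a b + 1)) =>
        ‖(Kernel.contract f f i j (i.is_le.trans (min_le_left a b))
        (j.is_le.trans (min_le_right a b)) (j.is_le.trans (min_le_left a b))
        (i.is_le.trans (min_le_right a b))).symmetrize‖ ^ 2)
      (by positivity) fun i j _ => norm_symmetrize_contract_sq_le _ _ _ _ _ _ le_rfl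
  have h3 : ((min a b + 1 : ℕ) : ℝ) * ((min a b + 1 : ℕ) * ‖f‖ ^ 4) ≤
      (a + 1 : ℕ) * ((b + 1 : ℕ) * ‖f‖ ^ 4) := by
    gcongr
    · exact min_le_left _ _
    · exact min_le_right _ _
  linarith

end Kernel

end Continuity

/-! ### Kernels supported on a set of indices -/

section Comap

variable {ι κ : Type*} {a b c d : ℕ}

namespace Kernel

/-- The kernel vanishes unless all the indices lie in `s`. -/
def SupportedOn (f : Kernel ι a b) (s : Set ι) : Prop :=
  ∀ p, f p ≠ 0 → (∀ x, p.1 x ∈ s) ∧ ∀ x, p.2 x ∈ s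

/-- The kernel with its indices pulled back along an injection. -/
def comap {φ : κ → ι} (hφ : Function.Injective φ) (f : Kernel ι a b) : Kernel κ a b :=
  ⟨fun p => f (φ ∘ p.1, φ ∘ p.2), memlp_two_iff.2 <|
    f.summable_sq.comp_injective (hφ.comp_left.prodMap hφ.comp_left)⟩

variable {φ : κ → ι} (hφ : Function.Injective φ)

@[simp] theorem comap_apply (f : Kernel ι a b) (p) : f.comap hφ p = f (φ ∘ p.1, φ ∘ p.2) := rfl

include hφ in
theorem tsum_comp {M : Type*} [AddCommMonoid M] [TopologicalSpace M]
    {F : (Fin a → ι) × (Fin b → ι) → M}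
    (hF : ∀ p, F p ≠ 0 → (∀ x, p.1 x ∈ Set.range φ) ∧ ∀ x, p.2 x ∈ Set.range φ) :
    ∑' p : (Fin a → κ) × (Fin b → κ), F (φ ∘ p.1, φ ∘ p.2) = ∑' p, F p := by
  refine (hφ.comp_left.prodMap hφ.comp_left).tsum_eq (f := F) fun p hp => ?_
  obtain ⟨h1, h2⟩ := hF p hp
  choose t ht using h1
  choose s hs using h2
  exact ⟨(t, s), Prod.ext (funext ht) (funext hs)⟩

theorem norm_comap {f : Kernel ι a b} (hf : f.SupportedOn (Set.range φ)) :
    ‖f.comap hφ‖ = ‖f‖ := by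
  refine (sq_eq_sq₀ (norm_nonneg _) (norm_nonneg _)).1 ?_
  rw [norm_sq_eq_tsum, norm_sq_eq_tsum]
  exact tsum_comp hφ (F := fun p => ‖f p‖ ^ 2) fun p hp => hf p (by simpa using hp)

theorem IsSymm.comap {f : Kernel ι a b} (hf : f.IsSymm) : (f.comap hφ).IsSymm :=
  fun π σ α β => hf π σ (φ ∘ α) (φ ∘ β)

theorem comap_revConj (f : Kernel ι a b) : (f.comap hφ).revConj = f.revConj.comap hφ := rfl

theorem comap_symmetrize (f : Kernel ι a b) :
    (f.comap hφ).symmetrize = f.symmetrize.comap hφ := by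
  ext p
  rw [comap_apply, symmetrize_apply, symmetrize_apply]
  rfl

theorem join_comp {i : ℕ} (hi : i ≤ a) (t : Fin (a - i) → κ) (u : Fin i → κ) :
    join hi (φ ∘ t) (φ ∘ u) = φ ∘ join hi t u := by
  funext x
  simp only [join, Function.comp_apply]
  exact Fin.addCases (fun y => by simp) (fun y => by simp)
    (Fin.cast (Nat.sub_add_cancel hi).symm x)

theorem forall_join {s : Set ι} {i : ℕ} {hi : i ≤ a} {t : Fin (a - i) → ι} {u : Fin i → ι}
    (h : ∀ x, join hi t u x ∈ s) : (∀ x, t x ∈ s) ∧ ∀ x, u x ∈ s := by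
  have h' (y) : Fin.append t u y ∈ s := by
    simpa [join] using h (Fin.cast (Nat.sub_add_cancel hi) y)
  exact ⟨fun x => by simpa using h' (Fin.castAdd i x),
    fun x => by simpa using h' (Fin.natAdd (a - i) x)⟩

theorem SupportedOn.revConj {f : Kernel ι a b} {s : Set ι} (hf : f.SupportedOn s) :
    f.revConj.SupportedOn s :=
  fun p hp => (hf (p.2, p.1) (by simpa using hp)).symm

theorem SupportedOn.symmetrize {f : Kernel ι a b} {s : Set ι} (hf : f.SupportedOn s) :
    f.symmetrize.SupportedOn s := by
  intro p hp
  rw [symmetrize_apply] at hp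
  obtain ⟨π, -, hπ⟩ := Finset.exists_ne_zero_of_sum_ne_zero (right_ne_zero_of_mul hp)
  obtain ⟨σ, -, hσ⟩ := Finset.exists_ne_zero_of_sum_ne_zero hπ
  obtain ⟨h1, h2⟩ := hf _ hσ
  exact ⟨fun x => by simpa using h1 (π.symm x), fun x => by simpa using h2 (σ.symm x)⟩

variable {i j : ℕ} (hia : i ≤ a) (hjb : j ≤ b) (hjc : j ≤ c) (hid : i ≤ d)

theorem SupportedOn.contract {f : Kernel ι a b} {g : Kernel ι c d} {s : Set ι}
    (hf : f.SupportedOn s) (hg : g.SupportedOn s) :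
    (f.contract g i j hia hjb hjc hid).SupportedOn s := by
  intro p hp
  rw [contract_eq_tsum] at hp
  obtain ⟨k, hk⟩ : ∃ k, f (contractLeft hia hjb ((freeIndices i j p).1, k)) *
      g (contractRight hjc hid ((freeIndices i j p).2, k)) ≠ 0 := by
    by_contra! h
    exact hp (by simp [h])
  obtain ⟨h1, h2⟩ := hf _ (left_ne_zero_of_mul hk)
  obtain ⟨h3, h4⟩ := hg _ (right_ne_zero_of_mul hk)
  refine ⟨fun x => ?_, fun x => ?_⟩
  · exact Fin.addCases (motive := fun x => p.1 x ∈ s)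
      (forall_join (hi := hia) (t := p.1 ∘ Fin.castAdd (c - j)) (u := k.1) h1).1
      (forall_join (hi := hjc) (t := p.1 ∘ Fin.natAdd (a - i)) (u := k.2) h3).1 x
  · exact Fin.addCases (motive := fun x => p.2 x ∈ s)
      (forall_join (hi := hjb) (t := p.2 ∘ Fin.castAdd (d - i)) (u := k.2) h2).1
      (forall_join (hi := hid) (t := p.2 ∘ Fin.natAdd (b - j)) (u := k.1) h4).1 x

/-- The support of f alone suffices, since every summation index of the contraction is an index of
f. -/
theorem comap_contract {f : Kernel ι a b} (hf : f.SupportedOn (Set.range φ)) (g : Kernel ι c d) :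
    (f.comap hφ).contract (g.comap hφ) i j hia hjb hjc hid =
      (f.contract g i j hia hjb hjc hid).comap hφ := by
  ext p
  rw [comap_apply, contract_eq_tsum, contract_eq_tsum]
  rw [← tsum_comp hφ (F := fun k => f (contractLeft hia hjb ((freeIndices i j _).1, k)) *
      g (contractRight hjc hid ((freeIndices i j _).2, k)))]
  · refine tsum_congr fun k => ?_
    simp only [comap_apply, contractLeft, contractRight, freeIndices, ← join_comp]
    rfl
  · intro k hk
    obtain ⟨h1, h2⟩ := hf _ (left_ne_zero_of_mul hk)
    exact ⟨(forall_join (hi := hia) (u := k.1) h1).2, (forall_join (hi := hjb) (u := k.2) h2).2⟩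

variable {f : Kernel ι a b} (hf : f.SupportedOn (Set.range φ))
include hf

theorem sumContractRevConj_comap : (f.comap hφ).sumContractRevConj = f.sumContractRevConj := by
  simp only [sumContractRevConj, comap_revConj, comap_contract hφ _ _ _ _ hf,
    norm_comap hφ (hf.contract _ _ _ _ hf.revConj)]

theorem sumContractSelf_comap : (f.comap hφ).sumContractSelf = f.sumContractSelf := by
  simp only [sumContractSelf, comap_contract hφ _ _ _ _ hf, norm_comap hφ (hf.contract _ _ _ _ hf)]

theorem sumSymmContractRevConj_comap :
    (f.comap hφ).sumSymmContractRevConj = f.sumSymmContractRevConj := by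
  simp only [sumSymmContractRevConj, comap_revConj, comap_contract hφ _ _ _ _ hf, comap_symmetrize,
    norm_comap hφ (hf.contract _ _ _ _ hf.revConj).symmetrize]

theorem sumSymmContractSelf_comap :
    (f.comap hφ).sumSymmContractSelf = f.sumSymmContractSelf := by
  simp only [sumSymmContractSelf, comap_contract hφ _ _ _ _ hf, comap_symmetrize,
    norm_comap hφ (hf.contract _ _ _ _ hf).symmetrize]

end Kernel

end Comap

/-! ### Multiple integrals of kernels over a finite set of indices -/

section FiniteIntegral

variable {Ω κ : Type*} [MeasurableSpace Ω] {P : Measure Ω}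

/-- The fourth cumulant `E|F|⁴ - 2 (E|F|²)² - |E F²|²`. -/
def cumulant (P : Measure Ω) (F : Ω → ℂ) : ℝ :=
  (∫ ω, ‖F ω‖ ^ 4 ∂P) - 2 * (∫ ω, ‖F ω‖ ^ 2 ∂P) ^ 2 - ‖∫ ω, F ω ^ 2 ∂P‖ ^ 2

theorem cumulant_congr_ae {F G : Ω → ℂ} (h : F =ᵐ[P] G) : cumulant P F = cumulant P G := by
  have h1 (n : ℕ) : ∫ ω, ‖F ω‖ ^ n ∂P = ∫ ω, ‖G ω‖ ^ n ∂P :=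
    integral_congr_ae (h.mono fun ω hω => by simp only [hω])
  have h2 : ∫ ω, F ω ^ 2 ∂P = ∫ ω, G ω ^ 2 ∂P :=
    integral_congr_ae (h.mono fun ω hω => by simp only [hω])
  rw [cumulant, cumulant, h1, h1, h2]

/-- The value at `z` of the Wick polynomial `:Q:`. -/
def wickVal (Q : ZPoly κ) (z : κ → ℂ) : ℂ := aeval (zVal z) (wick Q)

theorem wickVal_cj (Q : ZPoly κ) (z : κ → ℂ) :
    aeval (zVal z) (wick (cj Q)) = conj (wickVal Q z) := by
  rw [wick_cj, aeval_cj, wickVal]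

namespace IsStandardGaussian

variable [Fintype κ] [IsProbabilityMeasure P] {Z : κ → Ω → ℂ} (hZ : IsStandardGaussian P Z)
include hZ

theorem integral_wickVal_sq (Q : ZPoly κ) :
    ∫ ω, wickVal Q (fun k => Z k ω) ^ 2 ∂P = pair Q Q := by
  rw [← hZ.isPosGaussianFunctional.map_wick_mul_wick, zExpect_apply]
  simp only [map_mul, wickVal, sq]

theorem integral_norm_wickVal_sq (Q : ZPoly κ) :
    ∫ ω, ‖wickVal Q (fun k => Z k ω)‖ ^ 2 ∂P = nsq Q := by
  rw [nsq, ← hZ.isPosGaussianFunctional.map_wick_mul_wick, zExpect_apply]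
  simp only [map_mul, wickVal_cj]
  rw [← Complex.ofReal_re (∫ ω, ‖wickVal Q (fun k => Z k ω)‖ ^ 2 ∂P), ← integral_complex_ofReal]
  simp only [← Complex.normSq_eq_norm_sq, ← Complex.mul_conj]
  rfl

theorem cumulant_wickVal (Q : ZPoly κ) :
    cumulant P (fun ω => wickVal Q fun k => Z k ω) = cum4 (zExpect P Z hZ.memLp) Q := by
  rw [cumulant, cum4, hZ.integral_wickVal_sq, hZ.integral_norm_wickVal_sq, zExpect_apply]
  congr 2
  rw [← Complex.ofReal_re (∫ ω, ‖wickVal Q (fun k => Z k ω)‖ ^ 4 ∂P), ← integral_complex_ofReal]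
  congr 2
  funext ω
  rw [map_mul, map_mul, map_mul, wickVal_cj, ← wickVal, show
    wickVal Q (fun k => Z k ω) * wickVal Q (fun k => Z k ω) *
      (conj (wickVal Q fun k => Z k ω) * conj (wickVal Q fun k => Z k ω)) =
    (wickVal Q (fun k => Z k ω) * conj (wickVal Q fun k => Z k ω)) ^ 2 by ring, Complex.mul_conj,
    Complex.normSq_eq_norm_sq, ← Complex.ofReal_pow, ← pow_mul]

theorem norm_pair_self_le (Q : ZPoly κ) : ‖pair Q Q‖ ≤ nsq Q := by
  rw [← hZ.integral_wickVal_sq, ← hZ.integral_norm_wickVal_sq]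
  refine (norm_integral_le_integral_norm _).trans (le_of_eq ?_)
  simp only [norm_pow]

end IsStandardGaussian

end FiniteIntegral

/-! ### Finite multiple integrals as Wick polynomials -/

section WienerFun

variable {ι κ H Ω : Type*} {m n : ℕ}

theorem hermiteProduct_comp (Z : H → Ω → ℂ) (e : ι → H) {φ : κ → ι} (hφ : Function.Injective φ)
    (α : Fin m → κ) (β : Fin n → κ) :
    hermiteProduct Z e (φ ∘ α) (φ ∘ β) = hermiteProduct Z (e ∘ φ) α β := by
  classical
  funext ω
  have h1 : occurring (φ ∘ α) (φ ∘ β) = (occurring α β).image φ := by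
    ext k
    simp [occurring, Finset.image_union, Finset.image_image]
  have h2 {a : ℕ} (α : Fin a → κ) (k : κ) : multiplicity (φ ∘ α) (φ k) = multiplicity α k := by
    simp only [multiplicity, Function.comp_apply, hφ.eq_iff]
  simp only [hermiteProduct, h1, Finset.prod_image hφ.injOn, h2]
  rfl

theorem hermiteProduct_eq_wickVal (Z : H → Ω → ℂ) (e : ι → H) (α : Fin m → ι) (β : Fin n → ι)
    (ω : Ω) : hermiteProduct Z e α β ω =
      wickVal (mon Sum.inl α * mon Sum.inr β) fun k => Z (e k) ω :=
  (aeval_wick_mon (fun k => Z (e k) ω) α β).symm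

/-- The multiple integral of a kernel with finitely many nonzero coefficients. -/
def wienerFun (Z : H → Ω → ℂ) (e : ι → H) (f : Kernel ι m n) (ω : Ω) : ℂ :=
  ∑' p, f p * hermiteProduct Z e p.1 p.2 ω

/-- Reduces an arbitrary index set to a finite one; injectivity of φ preserves the multiplicities in
the Hermite products. -/
theorem wienerFun_eq_wickVal [Fintype κ] (Z : H → Ω → ℂ) (e : ι → H) {φ : κ → ι}
    (hφ : Function.Injective φ) {f : Kernel ι m n} (hf : f.SupportedOn (Set.range φ)) :
    wienerFun Z e f = fun ω => wickVal (f.comap hφ).poly fun k => Z (e (φ k)) ω := by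
  funext ω
  rw [wienerFun, ← Kernel.tsum_comp hφ fun p hp => hf p (left_ne_zero_of_mul hp), tsum_fintype,
    Fintype.sum_prod_type]
  rw [wickVal, Kernel.poly, kerPoly]
  simp only [map_sum, map_smul, Kernel.comap_apply, smul_eq_mul]
  refine Finset.sum_congr rfl fun α _ => Finset.sum_congr rfl fun β _ => ?_
  rw [hermiteProduct_comp Z e hφ, hermiteProduct_eq_wickVal]
  rfl

variable [NormedAddCommGroup H] [InnerProductSpace ℂ H] [MeasurableSpace Ω] {P : Measure Ω}
  {Z : H → Ω → ℂ}

theorem IsIsonormal.memLp_hermiteProduct [IsProbabilityMeasure P] (hZ : IsIsonormal P Z)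
    (e : ι → H) (α : Fin m → ι) (β : Fin n → ι) (p : ENNReal) (hp : p ≠ ⊤) :
    MemLp (hermiteProduct Z e α β) p P := by
  have h := memLp_aeval (memLp_zVal fun k => hZ.memLp (e k))
    (wick (mon Sum.inl α * mon Sum.inr β)) p hp
  convert h using 1
  funext ω
  exact hermiteProduct_eq_wickVal Z e α β ω

/-- The constant of the fourth moment bound for multiple integrals. -/
def momentConst (m n : ℕ) : ℝ :=
  upperConst m n * (2 * ((m + 1 : ℕ) * (n + 1 : ℕ))) + 3 * (m.factorial * n.factorial) ^ 2

theorem momentConst_nonneg (m n : ℕ) : 0 ≤ momentConst m n := by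
  have := (upperConst_pos m n).le
  unfold momentConst
  positivity

namespace IsIsonormal

variable [IsProbabilityMeasure P] (hZ : IsIsonormal P Z) {e : ι → H} (he : Orthonormal ℂ e)
  {f : Kernel ι m n} {K : Finset ι} (hfK : f.SupportedOn K)
include hZ he hfK

theorem cumulant_wienerFun_le (hmn : 1 ≤ m + n) (hf : f.IsSymm) :
    cumulant P (wienerFun Z e f) ≤
      upperConst m n * (f.sumSymmContractRevConj + f.sumSymmContractSelf) := by
  have hK : f.SupportedOn (Set.range (Subtype.val : K → ι)) := by
    rwa [Subtype.range_coe_subtype]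
  have hS := hZ.isStandardGaussian (he.comp _ (Subtype.val_injective (p := (· ∈ K))))
  rw [wienerFun_eq_wickVal Z e Subtype.val_injective hK]
  refine (hS.cumulant_wickVal _).le.trans ?_
  rw [← Kernel.sumSymmContractRevConj_comap Subtype.val_injective hK,
    ← Kernel.sumSymmContractSelf_comap Subtype.val_injective hK]
  exact hS.isPosGaussianFunctional.cum4_poly_le hmn (hf.comap Subtype.val_injective)

theorem le_cumulant_wienerFun (hmn : 1 ≤ m + n) (hf : f.IsSymm) :
    lowerConst m n * (f.sumContractRevConj + f.sumContractSelf) ≤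
      cumulant P (wienerFun Z e f) := by
  have hK : f.SupportedOn (Set.range (Subtype.val : K → ι)) := by
    rwa [Subtype.range_coe_subtype]
  have hS := hZ.isStandardGaussian (he.comp _ (Subtype.val_injective (p := (· ∈ K))))
  rw [wienerFun_eq_wickVal Z e Subtype.val_injective hK]
  refine le_trans ?_ (hS.cumulant_wickVal _).ge
  rw [← Kernel.sumContractRevConj_comap Subtype.val_injective hK,
    ← Kernel.sumContractSelf_comap Subtype.val_injective hK]
  exact hS.isPosGaussianFunctional.le_cum4_poly hmn (hf.comap Subtype.val_injective)

/-- A substitute for hypercontractivity: the fourth moment is the cumulant plus squares of second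
moments, and all of these are at most a constant times ‖f‖⁴. No symmetry of f is required. -/
theorem integral_norm_wienerFun_pow_four_le (hmn : 1 ≤ m + n) :
    ∫ ω, ‖wienerFun Z e f ω‖ ^ 4 ∂P ≤ momentConst m n * ‖f‖ ^ 4 := by
  have hK : f.SupportedOn (Set.range (Subtype.val : K → ι)) := by
    rwa [Subtype.range_coe_subtype]
  have hS := hZ.isStandardGaussian (he.comp _ (Subtype.val_injective (p := (· ∈ K))))
  set g := f.comap (Subtype.val_injective (p := (· ∈ K))) with hg
  have hgn : ‖g‖ = ‖f‖ := Kernel.norm_comap _ hK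
  have hgs : ‖g.symmetrize‖ ≤ ‖f‖ := hgn ▸ g.norm_symmetrize_le
  -- The upper bound is applied to the symmetrized kernel, which has the same polynomial.
  have h1 := hS.isPosGaussianFunctional.cum4_poly_le hmn g.isSymm_symmetrize
  rw [g.poly_symmetrize, ← hS.cumulant_wickVal, cumulant, hS.integral_wickVal_sq,
    hS.integral_norm_wickVal_sq] at h1
  have h2 := hS.norm_pair_self_le g.poly
  have h3 : nsq g.poly ≤ m.factorial * n.factorial * ‖f‖ ^ 2 := by
    rw [g.nsq_poly]
    gcongr
  have h4 := g.symmetrize.sumSymmContract_le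
  have h5 : ‖g.symmetrize‖ ^ 4 ≤ ‖f‖ ^ 4 := by gcongr
  have h0 := hS.isPosGaussianFunctional.nsq_nonneg g.poly
  have hu := (upperConst_pos m n).le
  have h6 : ‖pair g.poly g.poly‖ ^ 2 ≤ nsq g.poly ^ 2 := by gcongr
  have h7 : nsq g.poly ^ 2 ≤ (m.factorial * n.factorial * ‖f‖ ^ 2) ^ 2 := by gcongr
  have h8 : upperConst m n * (g.symmetrize.sumSymmContractRevConj +
      g.symmetrize.sumSymmContractSelf) ≤
      upperConst m n * (2 * ((m + 1 : ℕ) * ((n + 1 : ℕ) * ‖f‖ ^ 4))) := by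
    refine mul_le_mul_of_nonneg_left (h4.trans ?_) hu
    gcongr
  have h9 : upperConst m n * (2 * ((m + 1 : ℕ) * ((n + 1 : ℕ) * ‖f‖ ^ 4))) +
      3 * (m.factorial * n.factorial * ‖f‖ ^ 2) ^ 2 = momentConst m n * ‖f‖ ^ 4 := by
    rw [momentConst]
    ring
  have h10 : ∫ ω, ‖wickVal g.poly fun k => Z ((e ∘ Subtype.val) k) ω‖ ^ 4 ∂P ≤
      momentConst m n * ‖f‖ ^ 4 := by linarith
  rwa [wienerFun_eq_wickVal Z e Subtype.val_injective hK]

end IsIsonormal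

end WienerFun

/-! ### Convergence in `L⁴` and passage to the limit -/

section LpFour

open Filter Topology

variable {Ω : Type*} [MeasurableSpace Ω] {P : Measure Ω}

instance fact_one_le_four : Fact ((1 : ENNReal) ≤ 4) := ⟨by norm_num⟩

theorem norm_pow_eq_integral {p : ENNReal} {k : ℕ} (hk : k ≠ 0) (hp : p = k) (F : Lp ℂ p P) :
    ‖F‖ ^ k = ∫ ω, ‖F ω‖ ^ k ∂P := by
  have hk' : (k : ℝ) ≠ 0 := by exact_mod_cast hk
  have h0 : 0 ≤ ∫ ω, ‖F ω‖ ^ k ∂P := integral_nonneg fun _ => by positivity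
  have hpr : p.toReal = k := by rw [hp, ENNReal.toReal_natCast]
  rw [Lp.norm_def, (Lp.memLp F).eLpNorm_eq_integral_rpow_norm (by rw [hp]; exact_mod_cast hk)
    (by rw [hp]; simp), hpr]
  simp only [Real.rpow_natCast]
  rw [ENNReal.toReal_ofReal (by positivity), ← Real.rpow_natCast, ← Real.rpow_mul h0,
    inv_mul_cancel₀ hk', Real.rpow_one]

variable [IsProbabilityMeasure P]

/-- The inclusion of `L⁴` into `L²`. -/
def lpFourToTwo (P : Measure Ω) [IsProbabilityMeasure P] : Lp ℂ 4 P →L[ℂ] Lp ℂ 2 P :=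
  LinearMap.mkContinuous
    { toFun := fun F => ((Lp.memLp F).mono_exponent (by norm_num)).toLp F
      map_add' := fun F G => by
        refine Lp.ext ?_
        filter_upwards [MemLp.coeFn_toLp ((Lp.memLp (F + G)).mono_exponent
            (show (2 : ENNReal) ≤ 4 by norm_num)),
          MemLp.coeFn_toLp ((Lp.memLp F).mono_exponent (show (2 : ENNReal) ≤ 4 by norm_num)),
          MemLp.coeFn_toLp ((Lp.memLp G).mono_exponent (show (2 : ENNReal) ≤ 4 by norm_num)),
          Lp.coeFn_add F G, Lp.coeFn_add
            (((Lp.memLp F).mono_exponent (show (2 : ENNReal) ≤ 4 by norm_num)).toLp F)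
            (((Lp.memLp G).mono_exponent (show (2 : ENNReal) ≤ 4 by norm_num)).toLp G)]
          with ω h1 h2 h3 h4 h5
        rw [h1, h4, h5, Pi.add_apply, Pi.add_apply, h2, h3]
      map_smul' := fun a F => by
        refine Lp.ext ?_
        filter_upwards [MemLp.coeFn_toLp ((Lp.memLp (a • F)).mono_exponent
            (show (2 : ENNReal) ≤ 4 by norm_num)),
          MemLp.coeFn_toLp ((Lp.memLp F).mono_exponent (show (2 : ENNReal) ≤ 4 by norm_num)),
          Lp.coeFn_smul a F, Lp.coeFn_smul a
            (((Lp.memLp F).mono_exponent (show (2 : ENNReal) ≤ 4 by norm_num)).toLp F)]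
          with ω h1 h2 h4 h5
        rw [h1, h4, RingHom.id_apply, h5, Pi.smul_apply, Pi.smul_apply, h2] } 1
    fun F => by
      rw [one_mul, Lp.norm_def F]
      refine (Lp.norm_toLp (F : Ω → ℂ) ((Lp.memLp F).mono_exponent (by norm_num))).trans_le ?_
      exact ENNReal.toReal_mono (Lp.eLpNorm_ne_top F)
        (eLpNorm_le_eLpNorm_of_exponent_le (by norm_num) (Lp.aestronglyMeasurable F))

theorem coeFn_lpFourToTwo (F : Lp ℂ 4 P) : lpFourToTwo P F =ᵐ[P] F :=
  MemLp.coeFn_toLp ((Lp.memLp F).mono_exponent (show (2 : ENNReal) ≤ 4 by norm_num))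

/-- Complex conjugation on `L²`. -/
def conjLp (P : Measure Ω) : Lp ℂ 2 P →L[ℝ] Lp ℂ 2 P :=
  (Complex.conjCLE : ℂ →L[ℝ] ℂ).compLpL 2 P

/-- Writes the cumulant in norms and an inner product, with E F² as the inner product of F̄ and F;
continuity on L⁴ is then visible. -/
theorem cumulant_eq (F : Lp ℂ 4 P) : cumulant P F = ‖F‖ ^ 4 - 2 * (‖lpFourToTwo P F‖ ^ 2) ^ 2 -
    ‖inner ℂ (conjLp P (lpFourToTwo P F)) (lpFourToTwo P F)‖ ^ 2 := by
  have h := coeFn_lpFourToTwo F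
  have h2 : ∫ ω, ‖lpFourToTwo P F ω‖ ^ 2 ∂P = ∫ ω, ‖F ω‖ ^ 2 ∂P :=
    integral_congr_ae (h.mono fun ω hω => by simp only [hω])
  have h3 : ∫ ω, F ω ^ 2 ∂P =
      ∫ ω, inner ℂ (conjLp P (lpFourToTwo P F) ω) (lpFourToTwo P F ω) ∂P := by
    refine integral_congr_ae ?_
    filter_upwards [h, (Complex.conjCLE : ℂ →L[ℝ] ℂ).coeFn_compLpL (p := 2) (lpFourToTwo P F)]
      with ω h1 h2
    rw [conjLp, h2, h1]
    simp [sq]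
  rw [cumulant, norm_pow_eq_integral (by norm_num) (by norm_num) F,
    norm_pow_eq_integral (by norm_num) (by norm_num) (lpFourToTwo P F), L2.inner_def, h2, h3]

theorem continuous_cumulant : Continuous fun F : Lp ℂ 4 P => cumulant P F := by
  simp only [cumulant_eq]
  have h := (lpFourToTwo P).continuous
  have hs := (conjLp P).continuous.comp h
  exact (((continuous_norm.pow 4).sub (((h.norm.pow 2).pow 2).const_mul 2))).sub
    ((hs.inner h).norm.pow 2)

end LpFour

/-! ### Truncated kernels and the limit of the bounds -/

section Limit

open Filter Topology

variable {ι : Type*} {m n : ℕ}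

namespace Kernel

open Classical in
/-- The kernel with the coefficients outside a finite set replaced by `0`. -/
def restrictTo (f : Kernel ι m n) (S : Finset ((Fin m → ι) × (Fin n → ι))) : Kernel ι m n :=
  ∑ p ∈ S, lp.single 2 p (f p)

open Classical in
theorem restrictTo_apply (f : Kernel ι m n) (S : Finset ((Fin m → ι) × (Fin n → ι))) (p) :
    f.restrictTo S p = if p ∈ S then f p else 0 := by
  rw [restrictTo, lp.coeFn_sum, Finset.sum_apply]
  simp [lp.single_apply, Pi.single_apply]

theorem norm_restrictTo_sq (f : Kernel ι m n) (S : Finset ((Fin m → ι) × (Fin n → ι))) :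
    ‖f.restrictTo S‖ ^ 2 = ∑ p ∈ S, ‖f p‖ ^ 2 := by
  classical
  rw [norm_sq_eq_tsum, tsum_eq_sum (s := S)]
  · exact Finset.sum_congr rfl fun p hp => by rw [restrictTo_apply, if_pos hp]
  · intro p hp
    rw [restrictTo_apply, if_neg hp]
    simp

theorem tendsto_restrictTo (f : Kernel ι m n) : Tendsto f.restrictTo atTop (𝓝 f) := by
  classical
  have h := lp.hasSum_single (p := 2) (by simp) f
  rw [HasSum, SummationFilter.unconditional_filter] at h
  convert h using 2
  rw [restrictTo]

theorem exists_supportedOn_restrictTo (f : Kernel ι m n)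
    (S : Finset ((Fin m → ι) × (Fin n → ι))) : ∃ K : Finset ι, (f.restrictTo S).SupportedOn K := by
  classical
  refine ⟨S.biUnion fun p => occurring p.1 p.2, fun p hp => ?_⟩
  have hpS : p ∈ S := by
    by_contra h
    exact hp (by rw [restrictTo_apply, if_neg h])
  have h (k : ι) (hk : k ∈ occurring p.1 p.2) :
      k ∈ ((S.biUnion fun p => occurring p.1 p.2 : Finset ι) : Set ι) :=
    Finset.mem_coe.2 (Finset.mem_biUnion.2 ⟨p, hpS, hk⟩)
  exact ⟨fun x => h _ (by simp [occurring]), fun x => h _ (by simp [occurring])⟩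

/-- The pairs of index lists with entries in a finite set. -/
def box (m n : ℕ) (K : Finset ι) : Finset ((Fin m → ι) × (Fin n → ι)) :=
  (Fintype.piFinset fun _ => K) ×ˢ (Fintype.piFinset fun _ => K)

theorem mem_box {K : Finset ι} {p : (Fin m → ι) × (Fin n → ι)} :
    p ∈ box m n K ↔ (∀ x, p.1 x ∈ K) ∧ ∀ x, p.2 x ∈ K := by
  simp [box]

theorem tendsto_box : Tendsto (box m n : Finset ι → _) atTop atTop := by
  classical
  refine tendsto_atTop_finset_of_monotone (fun K L h p hp => ?_) fun p => ?_
  · rw [mem_box] at hp ⊢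
    exact ⟨fun x => h (hp.1 x), fun x => h (hp.2 x)⟩
  · exact ⟨occurring p.1 p.2, mem_box.2 ⟨fun x => by simp [occurring], fun x => by simp [occurring]⟩⟩

theorem supportedOn_restrictTo_box (f : Kernel ι m n) (K : Finset ι) :
    (f.restrictTo (box m n K)).SupportedOn K := by
  classical
  intro p hp
  by_contra h
  exact hp (by rw [restrictTo_apply, if_neg fun hb => h (mem_box.1 hb)])

/-- Boxes are stable under permutation of indices, which general finite sets are not. They are also
cofinal, so they compute the sum of the series. -/
theorem IsSymm.restrictTo_box {f : Kernel ι m n} (hf : f.IsSymm) (K : Finset ι) :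
    (f.restrictTo (box m n K)).IsSymm := by
  classical
  intro π σ α β
  have : (α ∘ π, β ∘ σ) ∈ box m n K ↔ (α, β) ∈ box m n K := by
    simp only [mem_box, Function.comp_apply]
    rw [π.forall_congr_left, σ.forall_congr_left]
    simp
  rw [restrictTo_apply, restrictTo_apply, hf π σ α β]
  simp only [this]

end Kernel

variable {H Ω : Type*} [NormedAddCommGroup H] [InnerProductSpace ℂ H] [MeasurableSpace Ω]
  {P : Measure Ω} [IsProbabilityMeasure P] {Z : H → Ω → ℂ}

/-- The terms of the series of a multiple integral as elements of `L⁴`. -/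
def wienerItoTermFour (hZ : IsIsonormal P Z) (e : ι → H) (f : Kernel ι m n)
    (p : (Fin m → ι) × (Fin n → ι)) : Lp ℂ 4 P :=
  f p • (hZ.memLp_hermiteProduct e p.1 p.2 4 (by simp)).toLp (hermiteProduct Z e p.1 p.2)

theorem coeFn_sum_wienerItoTermFour (hZ : IsIsonormal P Z) (e : ι → H) (f : Kernel ι m n)
    (S : Finset ((Fin m → ι) × (Fin n → ι))) :
    (∑ p ∈ S, wienerItoTermFour hZ e f p : Lp ℂ 4 P) =ᵐ[P] wienerFun Z e (f.restrictTo S) := by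
  classical
  have h (p : (Fin m → ι) × (Fin n → ι)) : wienerItoTermFour hZ e f p =ᵐ[P]
      fun ω => f p * hermiteProduct Z e p.1 p.2 ω := by
    filter_upwards [Lp.coeFn_smul (f p) ((hZ.memLp_hermiteProduct e p.1 p.2 4 (by simp)).toLp
        (hermiteProduct Z e p.1 p.2)),
      MemLp.coeFn_toLp (hZ.memLp_hermiteProduct e p.1 p.2 4 (by simp))] with ω h1 h2
    rw [wienerItoTermFour, h1, Pi.smul_apply, h2, smul_eq_mul]
  have h' : ∀ᵐ ω ∂P, ∀ p ∈ S, wienerItoTermFour hZ e f p ω =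
      f p * hermiteProduct Z e p.1 p.2 ω :=
    (Finset.eventually_all S).2 fun p _ => h p
  filter_upwards [h', Lp.coeFn_finsetSum S (wienerItoTermFour hZ e f)] with ω h1 h2
  rw [h2, Finset.sum_apply, wienerFun, tsum_eq_sum (s := S)]
  · refine Finset.sum_congr rfl fun p hp => ?_
    rw [h1 p hp, Kernel.restrictTo_apply, if_pos hp]
  · intro p hp
    rw [Kernel.restrictTo_apply, if_neg hp, zero_mul]

/-- Cauchy criterion over arbitrary finite sets of terms. Such partial sums have nonsymmetric
kernels, which is why the fourth moment bound must not assume symmetry. -/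
theorem summable_wienerItoTermFour (hmn : 1 ≤ m + n) (hZ : IsIsonormal P Z) {e : ι → H}
    (he : Orthonormal ℂ e) (f : Kernel ι m n) : Summable (wienerItoTermFour hZ e f) := by
  rw [summable_iff_vanishing_norm]
  intro ε hε
  have hC := momentConst_nonneg m n
  -- With C the moment constant, a tail of squared norm below δ has fourth moment at most C δ² < ((C
  -- + 1) δ)² = ε⁴.
  set δ := ε ^ 2 / (momentConst m n + 1) with hδ
  have hδ0 : 0 < δ := by positivity
  obtain ⟨s, hs⟩ := summable_iff_vanishing_norm.1 f.summable_sq δ hδ0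
  refine ⟨s, fun t ht => ?_⟩
  have h1 := hs t ht
  rw [Real.norm_of_nonneg (Finset.sum_nonneg fun _ _ => sq_nonneg _),
    ← f.norm_restrictTo_sq t] at h1
  obtain ⟨K, hK⟩ := f.exists_supportedOn_restrictTo t
  have h2 := hZ.integral_norm_wienerFun_pow_four_le he hK hmn
  have h3 : ‖∑ p ∈ t, wienerItoTermFour hZ e f p‖ ^ 4 ≤
      momentConst m n * ‖f.restrictTo t‖ ^ 4 := by
    rw [norm_pow_eq_integral (by norm_num) (by norm_num)]
    refine le_trans (le_of_eq (integral_congr_ae ?_)) h2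
    exact (coeFn_sum_wienerItoTermFour hZ e f t).mono fun ω hω => by simp only [hω]
  refine lt_of_pow_lt_pow_left₀ 4 hε.le (h3.trans_lt ?_)
  have h4 : ‖f.restrictTo t‖ ^ 4 ≤ δ ^ 2 := by
    rw [show ‖f.restrictTo t‖ ^ 4 = (‖f.restrictTo t‖ ^ 2) ^ 2 by ring]
    gcongr
  have h5 : (momentConst m n + 1) * δ = ε ^ 2 := by
    rw [hδ]
    field_simp
  calc momentConst m n * ‖f.restrictTo t‖ ^ 4 ≤ momentConst m n * δ ^ 2 := by gcongr
    _ < (momentConst m n + 1) ^ 2 * δ ^ 2 := by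
      refine mul_lt_mul_of_pos_right ?_ (by positivity)
      nlinarith
    _ = ε ^ 4 := by rw [← mul_pow, h5]; ring

theorem lpFourToTwo_wienerItoTermFour (hZ : IsIsonormal P Z) (e : HilbertBasis ι ℂ H)
    (f : Kernel ι m n) (p : (Fin m → ι) × (Fin n → ι)) :
    lpFourToTwo P (wienerItoTermFour hZ e f p) = wienerItoTerm hZ e f p := by
  rw [wienerItoTermFour, map_smul, wienerItoTerm]
  congr 1
  refine Lp.ext ((coeFn_lpFourToTwo _).trans ?_)
  exact (MemLp.coeFn_toLp _).trans (MemLp.coeFn_toLp _).symm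

theorem tendsto_cumulant_wienerFun (hmn : 1 ≤ m + n) (hZ : IsIsonormal P Z) {e : ι → H}
    (he : Orthonormal ℂ e) (f : Kernel ι m n) :
    Tendsto (fun K => cumulant P (wienerFun Z e (f.restrictTo (Kernel.box m n K)))) atTop
      (𝓝 (cumulant P (∑' p, wienerItoTermFour hZ e f p : Lp ℂ 4 P))) := by
  have h := (continuous_cumulant.tendsto _).comp
    ((summable_wienerItoTermFour hmn hZ he f).hasSum.comp Kernel.tendsto_box)
  refine h.congr fun K => ?_
  exact cumulant_congr_ae (coeFn_sum_wienerItoTermFour hZ e f _)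

/-- The L² series is the image of the L⁴ series under a continuous inclusion, so both have the same
sum almost everywhere. The finite bounds hold for each box truncation, and both of their sides
converge. -/
theorem fourth_moment_bounds (hmn : 1 ≤ m + n) (hZ : IsIsonormal P Z) (e : HilbertBasis ι ℂ H)
    {f : Kernel ι m n} (hf : f.IsSymm) :
    Summable (wienerItoTerm hZ e f) ∧ MemLp (wienerIto hZ e f) 4 P ∧
      lowerConst m n * (f.sumContractRevConj + f.sumContractSelf) ≤
        cumulant P (wienerIto hZ e f) ∧
      cumulant P (wienerIto hZ e f) ≤
        upperConst m n * (f.sumSymmContractRevConj + f.sumSymmContractSelf) := by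
  have he := e.orthonormal
  have hs := (summable_wienerItoTermFour hmn hZ he f).hasSum
  have hs2 : HasSum (wienerItoTerm hZ e f)
      (lpFourToTwo P (∑' p, wienerItoTermFour hZ e f p)) := by
    have := hs.mapL (lpFourToTwo P)
    simpa only [lpFourToTwo_wienerItoTermFour] using this
  have hF : (wienerIto hZ e f : Ω → ℂ) =ᵐ[P] (∑' p, wienerItoTermFour hZ e f p : Lp ℂ 4 P) := by
    rw [wienerIto, hs2.tsum_eq]
    exact coeFn_lpFourToTwo _
  have hf' : Tendsto (fun K => f.restrictTo (Kernel.box m n K)) atTop (𝓝 f) :=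
    f.tendsto_restrictTo.comp Kernel.tendsto_box
  have hc := tendsto_cumulant_wienerFun hmn hZ he f
  rw [← cumulant_congr_ae hF] at hc
  refine ⟨hs2.summable, (memLp_congr_ae hF).2 (Lp.memLp _), ?_, ?_⟩
  · refine le_of_tendsto_of_tendsto' (((Kernel.continuous_sumContractRevConj.add
      Kernel.continuous_sumContractSelf).const_mul (lowerConst m n)).tendsto f |>.comp hf') hc
      fun K => ?_
    exact hZ.le_cumulant_wienerFun he (f.supportedOn_restrictTo_box K) hmn (hf.restrictTo_box K)
  · refine le_of_tendsto_of_tendsto' hc (((Kernel.continuous_sumSymmContractRevConj.add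
      Kernel.continuous_sumSymmContractSelf).const_mul (upperConst m n)).tendsto f |>.comp hf')
      fun K => ?_
    exact hZ.cumulant_wienerFun_le he (f.supportedOn_restrictTo_box K) hmn (hf.restrictTo_box K)

end Limit

end ComplexWiener

end

theorem mainTheorem8 (m n : ℕ) (hmn : 1 ≤ m + n) :
    ∃ c₁ c₂ : ℝ, 0 < c₁ ∧ 0 < c₂ ∧
      ∀ (H : Type u) [NormedAddCommGroup H] [InnerProductSpace ℂ H] [CompleteSpace H]
        [TopologicalSpace.SeparableSpace H]
        (ι : Type v) (e : HilbertBasis ι ℂ H)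
        (Ω : Type w) [MeasurableSpace Ω] (P : Measure Ω) [IsProbabilityMeasure P]
        (Z : H → Ω → ℂ) (hZ : ComplexWiener.IsIsonormal P Z)
        (f : ComplexWiener.Kernel ι m n), f.IsSymm →
        ∀ F : Lp ℂ 2 P, F = ComplexWiener.wienerIto hZ e f →
          Summable (ComplexWiener.wienerItoTerm hZ e f) ∧
          MemLp F 4 P ∧
          c₁ * (f.sumContractRevConj + f.sumContractSelf) ≤
            (∫ ω, ‖F ω‖ ^ 4 ∂P) - 2 * (∫ ω, ‖F ω‖ ^ 2 ∂P) ^ 2 - ‖∫ ω, F ω ^ 2 ∂P‖ ^ 2 ∧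
          (∫ ω, ‖F ω‖ ^ 4 ∂P) - 2 * (∫ ω, ‖F ω‖ ^ 2 ∂P) ^ 2 - ‖∫ ω, F ω ^ 2 ∂P‖ ^ 2 ≤
            c₂ * (f.sumSymmContractRevConj + f.sumSymmContractSelf) := by
  refine ⟨ComplexWiener.lowerConst m n, ComplexWiener.upperConst m n,
    ComplexWiener.lowerConst_pos m n, ComplexWiener.upperConst_pos m n, ?_⟩
  rintro H _ _ _ _ ι e Ω _ P _ Z hZ f hf F rfl
  exact ComplexWiener.fourth_moment_bounds hmn hZ e hf
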